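/- Let $\alpha>\frac12$, let $f\in L^\infty(\mathbf R)$ be real valued with $\operatorname{supp} f\subset[0,1]$, and let $\{\omega(j)\}_{j\ge1}$ be a real stochastic process on a probability space with $|\omega(j)|\le 1$, adapted to a filtration $\{\mathcal F_j\}_{j\ge 1}$, such that for some $\rho>0$ $$\bigl|\mathbf E[\omega(j)\mid\mathcal F_k]\bigr|\le e^{-\rho|j-k|}\quad\text{a.s. for all } 1\le k<j .$$ For $t\ge 0$ put $V(t)=\sum_{j\ge1}\frac{\omega(j)}{j^{\alpha}}f(t-j)$. For $\kappa>0$ let $\theta_t(\kappa)$, $t\ge0$, be the Prüfer phase: if $\psi\not\equiv 0$ solves $-\psi''+V\psi=\kappa^2\psi$ on $[0,\infty)$ with $\psi(0)=0$, then $$\begin{pmatrix}\psi(t)\\ \psi'(t)/\kappa\end{pmatrix}=r_t(\kappa)\begin{pmatrix}\sin\theta_t(\kappa)\\ \cos\theta_t(\kappa)\end{pmatrix},\qquad r_t(\kappa)>0,$$ with $t\mapsto\theta_t(\kappa)$ continuous and $\theta_0(\kappa)=0$ (the sign of $\psi$ being chosen so that $\psi'(0)>0$). Set $$J^{(m,t)}(\kappa)=\int_m^t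 e^{2i\theta_s(\kappa)}V(s)\,ds .$$ Let $0<\eta<\alpha-\frac12$ and $\eta\le 1$, and let $\kappa_{\min}>0$. Then there is a constant $C>0$ such that for all $\kappa_1,\kappa_2\ge\kappa_{\min}$ and all real $0\le m\le N$, $$\mathbf E\Bigl[\sup_{m\le t\le N}\bigl|J^{(m,t)}(\kappa_1)-J^{(m,t)}(\kappa_2)\bigr|^2\Bigr]\le C\,|\kappa_1-\kappa_2|^{2\eta}.$$ -/

import Mathlib

open MeasureTheory ProbabilityTheory Set

noncomputable section

/-- The alloy-type potential `V(t) = ∑_{j ≥ 1} ω(j) j^{-α} f(t - j)` on the half-line `t ≥ 0`,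
for one realization `a = ω(·)` of the amplitudes. Only the values `a 1, a 2, …` are used, and for
`f` supported in `[0, 1]` at most two summands are nonzero at each `t`. -/
def alloyPotential (α : ℝ) (f : ℝ → ℝ) (a : ℕ → ℝ) (t : ℝ) : ℝ :=
  ∑' j : ℕ, a (j + 1) / ((j : ℝ) + 1) ^ α * f (t - ((j : ℝ) + 1))

/-- The standing assumption on the amplitudes: `|ω(j)| ≤ 1`, `ω` is adapted to the filtration `ℱ`,
and `|E[ω(j) | ℱ_k]| ≤ e^{-ρ (j - k)}` almost surely for `k < j`. Time runs over `j = 1, 2, …`;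
nothing is asked of `ω 0`. -/
structure ExpDecayingCorrelations {Ω : Type*} {mΩ : MeasurableSpace Ω} (P : Measure Ω)
    (ρ : ℝ) (ℱ : Filtration ℕ mΩ) (ω : ℕ → Ω → ℝ) : Prop where
  bounded : ∀ j, 1 ≤ j → ∀ x, |ω j x| ≤ 1
  adapted : ∀ j, 1 ≤ j → StronglyMeasurable[ℱ j] (ω j)
  decay : ∀ k j, 1 ≤ k → k < j → ∀ᵐ x ∂P, |(P[ω j | ℱ k]) x| ≤ Real.exp (-ρ * ((j : ℝ) - k))

/-- `ψ` solves `-ψ'' + V ψ = E ψ` on `[0, ∞)`, with `φ = ψ'`: `ψ` is differentiable with derivative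
`φ`, `φ` is locally absolutely continuous, and the equation holds almost everywhere. -/
structure IsSchrodingerSolution (V : ℝ → ℝ) (E : ℝ) (ψ φ : ℝ → ℝ) : Prop where
  hasDeriv : ∀ t, 0 ≤ t → HasDerivWithinAt ψ (φ t) (Ici 0) t
  absCont : ∀ T, 0 ≤ T → AbsolutelyContinuousOnInterval φ 0 T
  equation : ∀ᵐ t : ℝ, 0 < t → HasDerivAt φ (V t * ψ t - E * ψ t) t

/-- `θ` is the Prüfer phase at momentum `κ` on `[0, ∞)`: for a (nontrivial) solution `ψ` of
`-ψ'' + V ψ = κ² ψ`, `ψ(0) = 0`, one has `(ψ, ψ'/κ) = r (sin θ, cos θ)` with `r > 0`, and `θ` is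
the continuous branch with `θ(0) = 0`. For `κ > 0` and locally integrable `V` these conditions
determine `θ` on `[0, ∞)`. -/
structure IsPruferPhase (V : ℝ → ℝ) (κ : ℝ) (θ : ℝ → ℝ) : Prop where
  continuousOn : ContinuousOn θ (Ici 0)
  zero : θ 0 = 0
  exists_solution : ∃ ψ φ r : ℝ → ℝ, IsSchrodingerSolution V (κ ^ 2) ψ φ ∧ ψ 0 = 0 ∧
    ∀ t, 0 ≤ t → 0 < r t ∧ ψ t = r t * Real.sin (θ t) ∧ φ t / κ = r t * Real.cos (θ t)

theorem AbsolutelyContinuousOnInterval.lipschitz_comp {F g : ℝ → ℝ} {a b : ℝ} {K : NNReal}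
    (hF : AbsolutelyContinuousOnInterval F a b) (hg : LipschitzOnWith K g (F '' uIcc a b)) :
    AbsolutelyContinuousOnInterval (fun t => g (F t)) a b := by
  rw [absolutelyContinuousOnInterval_iff] at hF ⊢
  intro ε hε
  obtain ⟨δ, hδ, h⟩ := hF (ε / (K + 1)) (by positivity)
  refine ⟨δ, hδ, fun I hI hlen => ?_⟩
  have h1 := h I hI hlen
  have h2 : ∑ i ∈ Finset.range I.1, dist (g (F (I.2 i).1)) (g (F (I.2 i).2)) ≤
      (K + 1) * ∑ i ∈ Finset.range I.1, dist (F (I.2 i).1) (F (I.2 i).2) := by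
    rw [Finset.mul_sum]
    refine Finset.sum_le_sum fun i hi => ?_
    have hm := hI.1 i hi
    refine (hg.dist_le_mul _ (mem_image_of_mem _ hm.1) _ (mem_image_of_mem _ hm.2)).trans ?_
    have : 0 ≤ dist (F (I.2 i).1) (F (I.2 i).2) := dist_nonneg
    nlinarith
  refine h2.trans_lt ?_
  rw [lt_div_iff₀ (by positivity)] at h1
  linarith

/-- The integral equation of the phase has a solution when the potential is essentially bounded. -/
theorem exists_phase_equation {V : ℝ → ℝ} {κ M : ℝ} (hκ : 0 < κ)
    (hV : AEStronglyMeasurable V volume) (hM : ∀ᵐ t, |V t| ≤ M) :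
    ∃ h : ℝ → ℝ, AEStronglyMeasurable h volume ∧ (∀ᵐ t, |h t| ≤ 2 * M) ∧ ∀ t, 0 ≤ t →
      h t = (Real.cos (2 * (κ * t + 1 / (2 * κ) * ∫ s in (0 : ℝ)..t, h s)) - 1) * V t := by
  have hM0 : 0 ≤ M := by
    obtain ⟨t, ht⟩ := hM.exists
    exact (abs_nonneg _).trans ht
  set L : ℝ := M / κ + 1 with hL
  have hL0 : 0 < L := by positivity
  let p : ℝ → ℝ := fun t => max t 0
  have hp : Continuous p := by fun_prop
  let G : (BoundedContinuousFunction ℝ ℝ) → ℝ → ℝ := fun u s =>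
    (Real.cos (2 * (κ * s + Real.exp (L * p s) * u s)) - 1) * V s
  have hGm : ∀ u, AEStronglyMeasurable (G u) volume := fun u => by
    refine AEStronglyMeasurable.mul (Continuous.aestronglyMeasurable ?_) hV
    fun_prop
  have hGb : ∀ u, ∀ᵐ t, ‖G u t‖ ≤ 2 * M := fun u => by
    filter_upwards [hM] with t ht
    rw [Real.norm_eq_abs, abs_mul]
    have : |Real.cos (2 * (κ * t + Real.exp (L * p t) * u t)) - 1| ≤ 2 := by
      rw [abs_le]
      constructor <;> linarith [Real.cos_le_one (2 * (κ * t + Real.exp (L * p t) * u t)),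
        Real.neg_one_le_cos (2 * (κ * t + Real.exp (L * p t) * u t))]
    exact mul_le_mul this ht (abs_nonneg _) (by norm_num)
  have hGi : ∀ u a b, IntervalIntegrable (G u) volume a b := fun u a b =>
    IntervalIntegrable.mono_fun' (g := fun _ => 2 * M) intervalIntegrable_const
      (hGm u).restrict (ae_restrict_of_ae (hGb u))
  have hexp : ∀ x : ℝ, Real.exp (-(L * x)) * x ≤ 1 / L := fun x => by
    rw [Real.exp_neg, inv_mul_le_iff₀ (Real.exp_pos _), ← div_eq_mul_one_div, le_div_iff₀ hL0]
    linarith [Real.add_one_le_exp (L * x)]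
  let Φ : BoundedContinuousFunction ℝ ℝ → BoundedContinuousFunction ℝ ℝ := fun u =>
    BoundedContinuousFunction.ofNormedAddCommGroup
      (fun t => Real.exp (-(L * p t)) * (1 / (2 * κ) * ∫ s in (0 : ℝ)..p t, G u s))
      (by
        have : Continuous fun t => ∫ s in (0 : ℝ)..t, G u s :=
          intervalIntegral.continuous_primitive (hGi u) 0
        have := this.comp hp
        simp only [Function.comp_def] at this
        fun_prop)
      (1 / (2 * κ) * (2 * M) * (1 / L)) (fun t => by
        have h0 : 0 ≤ p t := le_max_right _ _
        have h1 : ‖∫ s in (0 : ℝ)..p t, G u s‖ ≤ 2 * M * p t := by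
          have := intervalIntegral.norm_integral_le_of_norm_le_const_ae (a := 0) (b := p t)
            (C := 2 * M) (f := G u) (by filter_upwards [hGb u] with s hs _ using hs)
          simpa [abs_of_nonneg h0] using this
        rw [norm_mul, norm_mul, Real.norm_of_nonneg (Real.exp_pos _).le,
          Real.norm_of_nonneg (by positivity : 0 ≤ 1 / (2 * κ))]
        calc _ ≤ Real.exp (-(L * p t)) * (1 / (2 * κ) * (2 * M * p t)) := by gcongr
          _ = 1 / (2 * κ) * (2 * M) * (Real.exp (-(L * p t)) * p t) := by ring
          _ ≤ _ := by gcongr; exact hexp _)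
  have hΦ : ∀ u t, Φ u t = Real.exp (-(L * p t)) * (1 / (2 * κ) * ∫ s in (0 : ℝ)..p t, G u s) :=
    fun u t => rfl
  have hlt : M / κ / L < 1 := by rw [div_lt_one hL0]; linarith
  have hK0 : 0 ≤ M / κ / L := by positivity
  have hcontr : ContractingWith (M / κ / L).toNNReal Φ := by
    refine ⟨by rw [← NNReal.coe_lt_coe, Real.coe_toNNReal _ hK0]; exact_mod_cast hlt,
      LipschitzWith.of_dist_le_mul fun u v => ?_⟩
    rw [Real.coe_toNNReal _ hK0, BoundedContinuousFunction.dist_le (mul_nonneg hK0 dist_nonneg)]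
    intro t
    have h0 : 0 ≤ p t := le_max_right _ _
    set d := dist u v with hd
    have hd0 : 0 ≤ d := dist_nonneg
    have hint : ‖∫ s in (0 : ℝ)..p t, (G u s - G v s)‖ ≤
        ∫ s in (0 : ℝ)..p t, 2 * M * d * Real.exp (L * s) := by
      refine intervalIntegral.norm_integral_le_of_norm_le h0 ?_
        (Continuous.intervalIntegrable (by fun_prop) _ _)
      filter_upwards [hM] with s hs hs'
      have hps : p s = s := max_eq_left hs'.1.le
      have huv : |u s - v s| ≤ d := by
        rw [← Real.dist_eq]; exact BoundedContinuousFunction.dist_coe_le_dist s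
      have hcos : |Real.cos (2 * (κ * s + Real.exp (L * s) * u s)) -
          Real.cos (2 * (κ * s + Real.exp (L * s) * v s))| ≤ 2 * Real.exp (L * s) * d := by
        have hl := Real.lipschitzWith_cos.dist_le_mul (2 * (κ * s + Real.exp (L * s) * u s))
          (2 * (κ * s + Real.exp (L * s) * v s))
        rw [Real.dist_eq, Real.dist_eq] at hl
        refine hl.trans ?_
        rw [show 2 * (κ * s + Real.exp (L * s) * u s) - 2 * (κ * s + Real.exp (L * s) * v s) =
          2 * Real.exp (L * s) * (u s - v s) by ring, abs_mul,
          abs_of_pos (by positivity : 0 < 2 * Real.exp (L * s))]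
        simp only [NNReal.coe_one, one_mul]
        gcongr
      have : G u s - G v s = (Real.cos (2 * (κ * s + Real.exp (L * s) * u s)) -
          Real.cos (2 * (κ * s + Real.exp (L * s) * v s))) * V s := by
        simp only [G, hps]; ring
      rw [this, norm_mul, Real.norm_eq_abs, Real.norm_eq_abs]
      calc _ ≤ 2 * Real.exp (L * s) * d * M := by gcongr
        _ = _ := by ring
    have hev : ∫ s in (0 : ℝ)..p t, 2 * M * d * Real.exp (L * s) =
        2 * M * d * ((Real.exp (L * p t) - 1) / L) := by
      rw [intervalIntegral.integral_const_mul,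
        intervalIntegral.integral_comp_mul_left (fun x => Real.exp x) hL0.ne', integral_exp]
      simp [div_eq_inv_mul]
    rw [hev] at hint
    rw [hΦ, hΦ, Real.dist_eq, ← mul_sub, ← mul_sub,
      ← intervalIntegral.integral_sub (hGi u _ _) (hGi v _ _), abs_mul, abs_mul,
      abs_of_pos (Real.exp_pos _), abs_of_pos (by positivity : 0 < 1 / (2 * κ)),
      ← Real.norm_eq_abs]
    calc _ ≤ Real.exp (-(L * p t)) * (1 / (2 * κ) * (2 * M * d * ((Real.exp (L * p t) - 1) / L))) := by
          gcongr
      _ = M / κ / L * d * (1 - Real.exp (-(L * p t))) := by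
          rw [Real.exp_neg]
          field_simp
      _ ≤ M / κ / L * d * 1 := by
          gcongr
          linarith [Real.exp_pos (-(L * p t))]
      _ = _ := by simp
  obtain ⟨u, hu⟩ : ∃ u, Φ u = u := ⟨_, hcontr.fixedPoint_isFixedPt⟩
  refine ⟨G u, hGm u, hGb u, fun t ht => ?_⟩
  have hpt : p t = t := max_eq_left ht
  have h1 : u t = Real.exp (-(L * t)) * (1 / (2 * κ) * ∫ s in (0 : ℝ)..t, G u s) := by
    conv_lhs => rw [← hu]
    rw [hΦ, hpt]
  have h2 : Real.exp (L * t) * u t = 1 / (2 * κ) * ∫ s in (0 : ℝ)..t, G u s := by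
    rw [h1, ← mul_assoc, ← Real.exp_add]; simp
  rw [← h2]
  simp only [G, hpt]

/-- The Prüfer phase exists when the potential is essentially bounded. -/
theorem exists_isPruferPhase {V : ℝ → ℝ} {κ M : ℝ} (hκ : 0 < κ)
    (hV : AEStronglyMeasurable V volume) (hM : ∀ᵐ t, |V t| ≤ M) :
    ∃ θ, IsPruferPhase V κ θ := by
  obtain ⟨h, hm, hb, heq⟩ := exists_phase_equation hκ hV hM
  have bdd_int : ∀ {g : ℝ → ℝ} {B : ℝ}, AEStronglyMeasurable g volume → (∀ᵐ t, |g t| ≤ B) →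
      LocallyIntegrable g volume ∧ ∀ a b, IntervalIntegrable g volume a b := fun {g B} h1 h2 => by
    constructor
    · exact (locallyIntegrable_const B).mono h1 (by
        filter_upwards [h2] with t ht
        exact ht.trans (le_abs_self B))
    · exact fun a b => IntervalIntegrable.mono_fun' (g := fun _ => B) intervalIntegrable_const
        h1.restrict (ae_restrict_of_ae h2)
  obtain ⟨hlh, hih⟩ := bdd_int hm hb
  let θ : ℝ → ℝ := fun t => κ * t + 1 / (2 * κ) * ∫ s in (0 : ℝ)..t, h s
  have hθc : Continuous θ := by
    have := intervalIntegral.continuous_primitive hih 0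
    fun_prop
  let q : ℝ → ℝ := fun t => V t * Real.sin (2 * θ t)
  have hqm : AEStronglyMeasurable q volume :=
    hV.mul (Continuous.aestronglyMeasurable (by fun_prop))
  obtain ⟨hlq, hiq⟩ := bdd_int hqm (B := M) (by
    filter_upwards [hM] with t ht
    rw [abs_mul]
    exact (mul_le_of_le_one_right (abs_nonneg _) (Real.abs_sin_le_one _)).trans ht)
  let R : ℝ → ℝ := fun t => 1 / (2 * κ) * ∫ s in (0 : ℝ)..t, q s
  have hRc : Continuous R := by
    have := intervalIntegral.continuous_primitive hiq 0
    fun_prop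
  let ψ : ℝ → ℝ := fun t => Real.exp (R t) * Real.sin (θ t)
  let φ : ℝ → ℝ := fun t => κ * (Real.exp (R t) * Real.cos (θ t))
  have hφc : Continuous φ := by fun_prop
  -- absolute continuity
  have acθ : ∀ T, AbsolutelyContinuousOnInterval θ 0 T := fun T => by
    refine AbsolutelyContinuousOnInterval.add ?_ (AbsolutelyContinuousOnInterval.const_mul _
      ((hih 0 T).absolutelyContinuousOnInterval_intervalIntegral left_mem_uIcc))
    exact (ContDiff.contDiffOn (by fun_prop : ContDiff ℝ 1 fun t : ℝ => κ * t)).absolutelyContinuousOnInterval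
  have acR : ∀ T, AbsolutelyContinuousOnInterval R 0 T := fun T =>
    AbsolutelyContinuousOnInterval.const_mul _
      ((hiq 0 T).absolutelyContinuousOnInterval_intervalIntegral left_mem_uIcc)
  have acE : ∀ T, AbsolutelyContinuousOnInterval (fun t => Real.exp (R t)) 0 T := fun T => by
    obtain ⟨B, hB⟩ := (acR T).exists_bound
    refine (acR T).lipschitz_comp (K := (Real.exp B).toNNReal) ?_
    have hexp : LipschitzOnWith (Real.exp B).toNNReal Real.exp (Iic B) := by
      refine Convex.lipschitzOnWith_of_nnnorm_deriv_le (𝕜 := ℝ)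
        (fun x _ => Real.differentiableAt_exp) (fun x hx => ?_) (convex_Iic B)
      rw [Real.deriv_exp, ← NNReal.coe_le_coe, coe_nnnorm, Real.norm_of_nonneg (Real.exp_pos _).le,
        Real.coe_toNNReal _ (Real.exp_pos _).le]
      exact Real.exp_le_exp.mpr hx
    refine hexp.mono ?_
    rintro _ ⟨t, ht, rfl⟩
    exact (le_abs_self _).trans (hB t ht)
  have acψ : ∀ T, AbsolutelyContinuousOnInterval ψ 0 T := fun T =>
    (acE T).mul ((acθ T).lipschitz_comp (K := 1) (Real.lipschitzWith_sin.lipschitzOnWith))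
  have acφ : ∀ T, AbsolutelyContinuousOnInterval φ 0 T := fun T =>
    ((acE T).mul ((acθ T).lipschitz_comp (K := 1) (Real.lipschitzWith_cos.lipschitzOnWith))).const_mul κ
  -- derivatives
  have key : ∀ᵐ t : ℝ, 0 < t → HasDerivAt ψ (φ t) t ∧
      HasDerivAt φ (V t * ψ t - κ ^ 2 * ψ t) t := by
    filter_upwards [LocallyIntegrable.ae_hasDerivAt_integral hlh,
      LocallyIntegrable.ae_hasDerivAt_integral hlq] with t h1 h2 ht
    have dθ : HasDerivAt θ (κ * 1 + 1 / (2 * κ) * h t) t :=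
      ((hasDerivAt_id t).const_mul κ).add ((h1 0).const_mul _)
    have dR : HasDerivAt R (1 / (2 * κ) * q t) t := (h2 0).const_mul _
    have e1 : h t = -2 * Real.sin (θ t) ^ 2 * V t := by
      rw [heq t ht.le]
      change (Real.cos (2 * θ t) - 1) * V t = _
      rw [Real.cos_two_mul, Real.cos_sq']; ring
    have e2 : q t = 2 * Real.sin (θ t) * Real.cos (θ t) * V t := by
      simp only [q]; rw [Real.sin_two_mul]; ring
    have hs := Real.sin_sq_add_cos_sq (θ t)
    constructor
    · refine (dR.exp.mul dθ.sin).congr_deriv ?_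
      rw [e1, e2]
      simp only [φ]
      field_simp
      ring
    · refine ((dR.exp.mul dθ.cos).const_mul κ).congr_deriv ?_
      rw [e1, e2]
      simp only [ψ]
      field_simp
      linear_combination (V t * Real.sin (θ t)) * hs
  have hψint : ∀ t, 0 ≤ t → ψ t = ∫ s in (0 : ℝ)..t, φ s := fun t ht => by
    have hac : AbsolutelyContinuousOnInterval (fun x => ψ x - ∫ s in (0 : ℝ)..x, φ s) 0 t :=
      (acψ t).sub ((hφc.intervalIntegrable 0 t).absolutelyContinuousOnInterval_intervalIntegral
        left_mem_uIcc)
    obtain ⟨c, hc⟩ := hac.const_of_ae_hasDerivAt_zero (by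
      have hne : ∀ᵐ x : ℝ, x ≠ 0 := by simp [ae_iff, measure_singleton]
      filter_upwards [key, hne] with x hx hx0 hxm
      rw [uIcc_of_le ht] at hxm
      have := (hx (lt_of_le_of_ne hxm.1 (Ne.symm hx0))).1.sub (hφc.integral_hasStrictDerivAt 0 x).hasDerivAt
      rw [sub_self] at this
      exact this)
    have h0 := hc 0 left_mem_uIcc
    have h1 := hc t right_mem_uIcc
    have hψ0 : ψ 0 = 0 := by simp [ψ, θ]
    simp only [hψ0, intervalIntegral.integral_same, sub_zero] at h0
    rw [← h0] at h1
    linarith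
  refine ⟨θ, hθc.continuousOn, by simp [θ], ψ, φ, fun t => Real.exp (R t), ⟨?_, ?_, ?_⟩,
    by simp [ψ, θ], fun t _ => ⟨Real.exp_pos _, rfl, ?_⟩⟩
  · intro t ht
    exact ((hφc.integral_hasStrictDerivAt 0 t).hasDerivAt.hasDerivWithinAt).congr
      (fun x hx => hψint x hx) (hψint t ht)
  · exact fun T _ => acφ T
  · filter_upwards [key] with t ht h0 using (ht h0).2
  · simp only [φ]
    field_simp

open Classical in
/-- The Prüfer phase `θ_t(κ)` of the potential `V` (the zero function where none exists). -/
def pruferPhase (V : ℝ → ℝ) (κ : ℝ) : ℝ → ℝ :=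
  if h : ∃ θ, IsPruferPhase V κ θ then h.choose else 0

theorem isPruferPhase_pruferPhase {V : ℝ → ℝ} {κ M : ℝ} (hκ : 0 < κ)
    (hV : AEStronglyMeasurable V volume) (hM : ∀ᵐ t, |V t| ≤ M) :
    IsPruferPhase V κ (pruferPhase V κ) := by
  have h := exists_isPruferPhase hκ hV hM
  rw [pruferPhase, dif_pos h]
  exact h.choose_spec

/-- `J^{(m,t)}(κ) = ∫_m^t e^{2 i θ_s(κ)} V(s) ds`. -/
def oscillatoryJ (V : ℝ → ℝ) (κ m t : ℝ) : ℂ :=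
  ∫ s in m..t, Complex.exp (2 * Complex.I * (pruferPhase V κ s : ℂ)) * (V s : ℂ)

end

/-! Write `δ = |κ₁ - κ₂|`, `x_j = ω(j) j^{-α}`, `β_j = (j+1)^{-α}`, `z_j = e^{2iθ_j}`, `J_j =
J^{(0,j)}` and `Δ_j = |J_j(κ₁) - J_j(κ₂)|`. The estimate is a Grönwall argument in mean square, in
which phases and oscillatory integrals control each other.

Phases by integrals: the Prüfer equation in integrated form is `θ_t = κ t + (Re J^{(0,t)} - ∫₀ᵗ V) /
(2κ)`, and `∫₀ᵗ V` does not depend on `κ`. Hence the phases at two momenta differ by at most a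
multiple of `δ t + Δ_t` (`exists_norm_phaseExp_sub_le`). Since unimodular numbers are at distance at
most 2, `δ t` may be weakened to `(δ t)^η`. So `y_j = min(1, δ) + |z_j(κ₁) - z_j(κ₂)|` is at most a
multiple of `w_j + Δ_j` with `w_j = δ^η (j+1)^η`.

Integrals by phases: on one unit cell `J_{j+1} - J_j = x_j F(κ) z_j + O(x_j²)` with `F(κ) = ∫₀¹
e^{2iκu} f(u) du`, and stability of the phase equation makes the errors at the two momenta differ by
only `O(β_j² y_j)` (`IsUnitPhase.exists_increment_bound`). The main terms need not be absolutely
summable. Put `T_{k,j} = ∑_i e^{2iκi} E[x_{j+i} | ℱ_{k-1}]`, which is `O(β_j)` by the decay of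
correlations. Since `T_{j+1,j} = x_j + e^{2iκ} T_{j+1,j+1}`, `x_j z_j = (T_{j+1,j} - T_{j,j}) z_j +
(T_{j,j} z_j - T_{j+1,j+1} z_{j+1}) + T_{j+1,j+1} (z_{j+1} - e^{2iκ} z_j)`: a martingale difference,
a telescoping term, and a term of second order in `β_j` (`exists_discrete_bound`).

Closing the loop: by orthogonality, Doob's inequality and Cauchy–Schwarz, the mean square of the
maximum of `Δ` is bounded by `∑ β_j² E[y_j²]` and a boundary term in `w_0²`. Inserting the bound on
`y_j` gives a discrete Grönwall inequality (`exists_maximal_bound`). Its coefficients `β_j²` are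
summable because `α > 1/2`; its source `∑ β_j² w_j² = δ^{2η} ∑ (j+1)^{-2α+2η}` is finite because `η
< α - 1/2`, and it carries the factor `δ^{2η}`. -/

/-! ### The integral equation of the Prüfer phase -/

theorem intervalIntegrable_of_ae_bdd {g : ℝ → ℝ} {B : ℝ} (hg : AEStronglyMeasurable g volume)
    (hB : ∀ᵐ t, |g t| ≤ B) (a b : ℝ) : IntervalIntegrable g volume a b :=
  IntervalIntegrable.mono_fun' (g := fun _ => B) intervalIntegrable_const
    hg.restrict (ae_restrict_of_ae hB)

theorem locallyIntegrable_of_ae_bdd {g : ℝ → ℝ} {B : ℝ} (hg : AEStronglyMeasurable g volume)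
    (hB : ∀ᵐ t, |g t| ≤ B) : LocallyIntegrable g volume :=
  (locallyIntegrable_const B).mono hg (by
    filter_upwards [hB] with t ht
    exact ht.trans (le_abs_self B))

/-- A continuous function on `[0, ∞)` vanishing at `0` with values in `π ℤ` is zero. -/
theorem eq_zero_of_sin_eq_zero {u : ℝ → ℝ} (hu : ContinuousOn u (Ici 0)) (h0 : u 0 = 0)
    (hs : ∀ t, 0 ≤ t → Real.sin (u t) = 0) {t : ℝ} (ht : 0 ≤ t) : u t = 0 := by
  have hsub : uIcc 0 t ⊆ Ici 0 := by
    rw [uIcc_of_le ht]; exact Icc_subset_Ici_self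
  have hivt := intermediate_value_uIcc (hu.mono hsub)
  rw [h0] at hivt
  by_contra hne
  rcases lt_or_gt_of_ne hne with h | h
  -- By the intermediate value theorem `u` takes this value, which lies in `(-π, 0)`, where the sine
  -- does not vanish.
  · have hv : max (u t) (-1) ∈ uIcc 0 (u t) := by
      rw [uIcc_of_ge h.le]; exact ⟨le_max_left _ _, max_le h.le (by norm_num)⟩
    obtain ⟨s, hsm, hse⟩ := hivt hv
    have := hs s (hsub hsm)
    rw [hse] at this
    have h2 : Real.sin (max (u t) (-1)) < 0 :=
      Real.sin_neg_of_neg_of_neg_pi_lt (max_lt h (by norm_num))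
        (lt_of_lt_of_le (by linarith [Real.pi_gt_three]) (le_max_right _ _))
    linarith
  · have hv : min (u t) 1 ∈ uIcc 0 (u t) := by
      rw [uIcc_of_le h.le]; exact ⟨le_min h.le (by norm_num), min_le_left _ _⟩
    obtain ⟨s, hsm, hse⟩ := hivt hv
    have := hs s (hsub hsm)
    rw [hse] at this
    have h2 : 0 < Real.sin (min (u t) 1) :=
      Real.sin_pos_of_pos_of_lt_pi (lt_min h (by norm_num))
        (lt_of_le_of_lt (min_le_right _ _) (by linarith [Real.pi_gt_three]))
    linarith

/-- `φ` is absolutely continuous, hence bounded, on `[0, T]`, so its primitive `ψ` is Lipschitz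
there. -/
theorem IsSchrodingerSolution.absCont_left {V : ℝ → ℝ} {E : ℝ} {ψ φ : ℝ → ℝ}
    (h : IsSchrodingerSolution V E ψ φ) {T : ℝ} (hT : 0 ≤ T) :
    AbsolutelyContinuousOnInterval ψ 0 T := by
  obtain ⟨B, hB⟩ := (h.absCont T hT).exists_bound
  have hB0 : 0 ≤ B := (norm_nonneg _).trans (hB 0 left_mem_uIcc)
  refine LipschitzOnWith.absolutelyContinuousOnInterval (K := B.toNNReal) ?_
  rw [uIcc_of_le hT]
  refine Convex.lipschitzOnWith_of_nnnorm_hasDerivWithin_le (convex_Icc 0 T) (f' := φ)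
    (fun t ht => (h.hasDeriv t ht.1).mono Icc_subset_Ici_self) fun t ht => ?_
  rw [← NNReal.coe_le_coe, coe_nnnorm, Real.coe_toNNReal _ hB0]
  exact hB t (by rwa [uIcc_of_le hT])

/-- The integral equation of the Prüfer phase. -/
theorem IsPruferPhase.integral_eq {V : ℝ → ℝ} {κ M : ℝ} {θ : ℝ → ℝ} (hκ : 0 < κ)
    (hV : AEStronglyMeasurable V volume) (hM : ∀ᵐ t, |V t| ≤ M) (hθ : IsPruferPhase V κ θ)
    {t : ℝ} (ht : 0 ≤ t) :
    θ t = κ * t + 1 / (2 * κ) * ∫ s in (0 : ℝ)..t, (Real.cos (2 * θ s) - 1) * V s := by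
  obtain ⟨ψ, φ, r, hsol, hψ0, hr⟩ := hθ.exists_solution
  -- `θ` is only known to be continuous on `[0, ∞)`; freezing it on the negative axis gives globally
  -- measurable integrands.
  let p : ℝ → ℝ := fun t => θ (max t 0)
  have hp : Continuous p :=
    hθ.continuousOn.comp_continuous (by fun_prop) fun t => mem_Ici.2 (le_max_right _ _)
  have hpe : ∀ t, 0 ≤ t → p t = θ t := fun t ht => by simp only [p, max_eq_left ht]
  let h : ℝ → ℝ := fun s => (Real.cos (2 * p s) - 1) * V s
  let q : ℝ → ℝ := fun s => Real.sin (2 * p s) * V s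
  have hhm : AEStronglyMeasurable h volume :=
    (Continuous.aestronglyMeasurable (by fun_prop)).mul hV
  have hqm : AEStronglyMeasurable q volume :=
    (Continuous.aestronglyMeasurable (by fun_prop)).mul hV
  have hhb : ∀ᵐ t, |h t| ≤ 2 * M := by
    filter_upwards [hM] with t ht
    rw [abs_mul]
    have : |Real.cos (2 * p t) - 1| ≤ 2 := by
      rw [abs_le]
      constructor <;> linarith [Real.cos_le_one (2 * p t), Real.neg_one_le_cos (2 * p t)]
    exact mul_le_mul this ht (abs_nonneg _) (by norm_num)
  have hqb : ∀ᵐ t, |q t| ≤ M := by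
    filter_upwards [hM] with t ht
    rw [abs_mul]
    exact (mul_le_of_le_one_left (abs_nonneg _) (Real.abs_sin_le_one _)).trans ht
  let g : ℝ → ℝ := fun t => κ * t + 1 / (2 * κ) * ∫ s in (0 : ℝ)..t, h s
  let R : ℝ → ℝ := fun t => -(1 / (2 * κ) * ∫ s in (0 : ℝ)..t, q s)
  have hih := intervalIntegrable_of_ae_bdd hhm hhb
  have hiq := intervalIntegrable_of_ae_bdd hqm hqb
  have hgc : Continuous g := by
    have := intervalIntegral.continuous_primitive hih 0
    fun_prop
  have acg : ∀ T, AbsolutelyContinuousOnInterval g 0 T := fun T => by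
    refine AbsolutelyContinuousOnInterval.add ?_ (AbsolutelyContinuousOnInterval.const_mul _
      ((hih 0 T).absolutelyContinuousOnInterval_intervalIntegral left_mem_uIcc))
    exact (ContDiff.contDiffOn
      (by fun_prop : ContDiff ℝ 1 fun t : ℝ => κ * t)).absolutelyContinuousOnInterval
  have acR : ∀ T, AbsolutelyContinuousOnInterval R 0 T := fun T =>
    (AbsolutelyContinuousOnInterval.const_mul _
      ((hiq 0 T).absolutelyContinuousOnInterval_intervalIntegral left_mem_uIcc)).neg
  have acE : ∀ T, AbsolutelyContinuousOnInterval (fun t => Real.exp (R t)) 0 T := fun T => by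
    obtain ⟨B, hB⟩ := (acR T).exists_bound
    refine (acR T).lipschitz_comp (K := (Real.exp B).toNNReal) ?_
    have hexp : LipschitzOnWith (Real.exp B).toNNReal Real.exp (Iic B) := by
      refine Convex.lipschitzOnWith_of_nnnorm_deriv_le (𝕜 := ℝ)
        (fun x _ => Real.differentiableAt_exp) (fun x hx => ?_) (convex_Iic B)
      rw [Real.deriv_exp, ← NNReal.coe_le_coe, coe_nnnorm, Real.norm_of_nonneg (Real.exp_pos _).le,
        Real.coe_toNNReal _ (Real.exp_pos _).le]
      exact Real.exp_le_exp.mpr hx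
    refine hexp.mono ?_
    rintro _ ⟨t, ht, rfl⟩
    exact (le_abs_self _).trans (hB t ht)
  -- With `ψ = r sin θ` and `φ = κ r cos θ`, `A` equals `e^R r sin (θ - g)`, and `e^R` compensates
  -- the growth of `r`. This form involves derivatives of `ψ`, `φ`, `g` and `R` only; `θ` and `r`
  -- are not known to be differentiable. Once `A = 0`, the continuous function `θ - g` takes values
  -- in `π ℤ`.
  let A : ℝ → ℝ := fun t => Real.exp (R t) * (ψ t * Real.cos (g t) - 1 / κ * φ t * Real.sin (g t))
  have acA : ∀ T, 0 ≤ T → AbsolutelyContinuousOnInterval A 0 T := fun T hT =>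
    (acE T).mul (((hsol.absCont_left hT).mul
      ((acg T).lipschitz_comp (K := 1) Real.lipschitzWith_cos.lipschitzOnWith)).sub
      (((hsol.absCont T hT).const_mul _).mul
        ((acg T).lipschitz_comp (K := 1) Real.lipschitzWith_sin.lipschitzOnWith)))
  have key : ∀ᵐ t : ℝ, 0 < t → HasDerivAt A 0 t := by
    filter_upwards [LocallyIntegrable.ae_hasDerivAt_integral (locallyIntegrable_of_ae_bdd hhm hhb),
      LocallyIntegrable.ae_hasDerivAt_integral (locallyIntegrable_of_ae_bdd hqm hqb), hsol.equation]
      with t h1 h2 h3 ht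
    have dg : HasDerivAt g (κ * 1 + 1 / (2 * κ) * h t) t :=
      ((hasDerivAt_id t).const_mul κ).add ((h1 0).const_mul _)
    have dR : HasDerivAt R (-(1 / (2 * κ) * q t)) t := ((h2 0).const_mul _).neg
    have dψ : HasDerivAt ψ (φ t) t := (hsol.hasDeriv t ht.le).hasDerivAt (Ici_mem_nhds ht)
    have e1 : h t = -2 * Real.sin (θ t) ^ 2 * V t := by
      simp only [h, hpe t ht.le]
      rw [Real.cos_two_mul, Real.cos_sq']; ring
    have e2 : q t = 2 * Real.sin (θ t) * Real.cos (θ t) * V t := by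
      simp only [q, hpe t ht.le]; rw [Real.sin_two_mul]
    obtain ⟨hr0, hr1, hr2⟩ := hr t ht.le
    rw [div_eq_iff hκ.ne'] at hr2
    have hs := Real.sin_sq_add_cos_sq (θ t)
    refine (dR.exp.mul ((dψ.mul dg.cos).sub (((h3 ht).const_mul _).mul dg.sin))).congr_deriv ?_
    rw [e1, e2, hr1, hr2]
    simp only [Pi.mul_apply, Pi.sub_apply]
    field_simp
    rw [hr1, hr2]
    linear_combination (Real.exp (R t) * κ * r t * Real.sin (θ t) * V t * Real.sin (g t)) * hs
  have hA : ∀ t, 0 ≤ t → A t = 0 := fun t ht => by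
    obtain ⟨c, hc⟩ := (acA t ht).const_of_ae_hasDerivAt_zero (by
      have hne : ∀ᵐ x : ℝ, x ≠ 0 := by simp [ae_iff, measure_singleton]
      filter_upwards [key, hne] with x hx hx0 hxm
      rw [uIcc_of_le ht] at hxm
      exact hx (lt_of_le_of_ne hxm.1 (Ne.symm hx0)))
    have h0 := hc 0 left_mem_uIcc
    rw [hc t right_mem_uIcc, ← h0]
    simp [A, g, hψ0]
  have hu : θ t - g t = 0 := by
    refine eq_zero_of_sin_eq_zero (u := fun t => θ t - g t)
      (hθ.continuousOn.sub hgc.continuousOn) (by simp [g, hθ.zero]) (fun s hs => ?_) ht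
    obtain ⟨hr0, hr1, hr2⟩ := hr s hs
    have h1 := hA s hs
    have h2 : r s * Real.sin (θ s - g s) = 0 := by
      simp only [A, mul_eq_zero, (Real.exp_pos _).ne', false_or] at h1
      rw [Real.sin_sub]
      rw [one_div_mul_eq_div, hr2, hr1] at h1
      linarith
    exact (mul_eq_zero.mp h2).resolve_left hr0.ne'
  have hfin : g t = κ * t + 1 / (2 * κ) * ∫ s in (0 : ℝ)..t, (Real.cos (2 * θ s) - 1) * V s := by
    simp only [g, h]
    congr 2
    refine intervalIntegral.integral_congr fun s hs => ?_
    rw [uIcc_of_le ht] at hs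
    simp only [hpe s hs.1]
  rw [← hfin]; linarith

/-! ### Unimodular phases -/

/-- The unimodular number `e^{2ia}`. -/
noncomputable def phaseExp (a : ℝ) : ℂ := Complex.exp (2 * Complex.I * (a : ℂ))

theorem continuous_phaseExp : Continuous phaseExp := by
  unfold phaseExp; fun_prop

theorem phaseExp_add (a b : ℝ) : phaseExp (a + b) = phaseExp a * phaseExp b := by
  unfold phaseExp; rw [← Complex.exp_add]; push_cast; ring_nf

theorem norm_phaseExp (a : ℝ) : ‖phaseExp a‖ = 1 := by
  have : (2 * Complex.I * (a : ℂ)) = ((2 * a : ℝ) : ℂ) * Complex.I := by push_cast; ring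
  rw [phaseExp, this, Complex.norm_exp_ofReal_mul_I]

theorem phaseExp_zero : phaseExp 0 = 1 := by simp [phaseExp]

theorem phaseExp_re (a : ℝ) : (phaseExp a).re = Real.cos (2 * a) := by
  have : (2 * Complex.I * (a : ℂ)) = ((2 * a : ℝ) : ℂ) * Complex.I := by push_cast; ring
  rw [phaseExp, this, Complex.exp_ofReal_mul_I_re]

theorem norm_phaseExp_sub_one_le (a : ℝ) : ‖phaseExp a - 1‖ ≤ 2 * |a| := by
  have : (2 * Complex.I * (a : ℂ)) = Complex.I * ((2 * a : ℝ) : ℂ) := by push_cast; ring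
  rw [phaseExp, this]
  refine Real.norm_exp_I_mul_ofReal_sub_one_le.trans_eq ?_
  rw [Real.norm_eq_abs, abs_mul]; norm_num

theorem norm_phaseExp_sub_le (a b : ℝ) : ‖phaseExp a - phaseExp b‖ ≤ 2 * |a - b| := by
  have : phaseExp a - phaseExp b = phaseExp b * (phaseExp (a - b) - 1) := by
    rw [mul_sub, ← phaseExp_add]; simp
  rw [this, norm_mul, norm_phaseExp, one_mul]
  exact norm_phaseExp_sub_one_le _

theorem norm_phaseExp_sub_le_two (a b : ℝ) : ‖phaseExp a - phaseExp b‖ ≤ 2 :=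
  (norm_sub_le _ _).trans (by rw [norm_phaseExp, norm_phaseExp]; norm_num)

/-- The cap at 1 keeps the constants uniform over all momenta above `κmin`, however far apart. -/
theorem norm_phaseExp_mul_sub_le {κ₁ κ₂ u : ℝ} (h0 : 0 ≤ u) (h1 : u ≤ 1) :
    ‖phaseExp (κ₁ * u) - phaseExp (κ₂ * u)‖ ≤ 2 * min 1 |κ₁ - κ₂| := by
  rw [← mul_min_of_nonneg _ _ (by norm_num : (0 : ℝ) ≤ 2) |>.symm]
  refine le_min ((norm_phaseExp_sub_le_two _ _).trans_eq (by norm_num))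
    ((norm_phaseExp_sub_le _ _).trans ?_)
  rw [← sub_mul, abs_mul, abs_of_nonneg h0]
  nlinarith [abs_nonneg (κ₁ - κ₂)]

theorem norm_phaseExp_mul_nat_sub_le (κ₁ κ₂ : ℝ) (n : ℕ) :
    ‖phaseExp (κ₁ * n) - phaseExp (κ₂ * n)‖ ≤ 2 * n * min 1 |κ₁ - κ₂| := by
  rcases Nat.eq_zero_or_pos n with rfl | hn
  · simp
  have h1 : (1 : ℝ) ≤ n := by exact_mod_cast hn
  rcases le_total 1 |κ₁ - κ₂| with h | h
  · rw [min_eq_left h]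
    exact (norm_phaseExp_sub_le_two _ _).trans (by linarith)
  · rw [min_eq_right h]
    refine (norm_phaseExp_sub_le _ _).trans_eq ?_
    rw [← sub_mul, abs_mul, abs_of_nonneg (by linarith : (0 : ℝ) ≤ n)]; ring

/-! ### Stability of the phase equation over one unit interval -/

/-- Grönwall's inequality in integral form on the unit interval. -/
theorem le_of_le_add_integral {h : ℝ → ℝ} {a B : ℝ} (ha : 0 ≤ a) (hB : 0 ≤ B)
    (hc : ContinuousOn h (Icc 0 1))
    (hle : ∀ s ∈ Icc (0 : ℝ) 1, h s ≤ a + B * ∫ u in (0 : ℝ)..s, h u) :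
    ∀ s ∈ Icc (0 : ℝ) 1, h s ≤ 2 * a * Real.exp (2 * B + 1) := by
  -- The weight `e^{-Ls}` makes the integral term at most `B / L ≤ 1/2` of the weighted maximum, so
  -- it can be absorbed on the left at the maximizer `s₀`.
  set L := 2 * B + 1 with hL
  have hL0 : 0 < L := by positivity
  obtain ⟨s₀, hs₀, hmax⟩ := isCompact_Icc.exists_isMaxOn (nonempty_Icc.mpr zero_le_one)
    (ContinuousOn.mul (f := fun s => Real.exp (-(L * s))) (by fun_prop) hc)
  set K := Real.exp (-(L * s₀)) * h s₀ with hK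
  have hhK : ∀ s ∈ Icc (0 : ℝ) 1, h s ≤ K * Real.exp (L * s) := fun s hs => by
    have h1 : Real.exp (-(L * s)) * h s ≤ K := hmax hs
    rw [Real.exp_neg, inv_mul_le_iff₀ (Real.exp_pos _)] at h1
    linarith
  have hKa : K ≤ 2 * a := by
    by_contra hcon
    push Not at hcon
    have hK0 : 0 < K := by linarith
    have hint : ∫ u in (0 : ℝ)..s₀, h u ≤ ∫ u in (0 : ℝ)..s₀, K * Real.exp (L * u) := by
      refine intervalIntegral.integral_mono_on hs₀.1 ?_
        (Continuous.intervalIntegrable (by fun_prop) _ _)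
        fun u hu => hhK u ⟨hu.1, hu.2.trans hs₀.2⟩
      refine (hc.mono ?_).intervalIntegrable
      rw [uIcc_of_le hs₀.1]
      exact Icc_subset_Icc_right hs₀.2
    have hev : ∫ u in (0 : ℝ)..s₀, K * Real.exp (L * u) = K * ((Real.exp (L * s₀) - 1) / L) := by
      rw [intervalIntegral.integral_const_mul,
        intervalIntegral.integral_comp_mul_left (fun x => Real.exp x) hL0.ne', integral_exp]
      simp [div_eq_inv_mul]
    rw [hev] at hint
    have h2 := hle s₀ hs₀
    have h3 : h s₀ = K * Real.exp (L * s₀) := by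
      rw [hK, Real.exp_neg]; field_simp
    have hE : 1 ≤ Real.exp (L * s₀) := Real.one_le_exp (mul_nonneg hL0.le hs₀.1)
    have h4 : B * (K * ((Real.exp (L * s₀) - 1) / L)) ≤ K * Real.exp (L * s₀) / 2 := by
      have : B / L ≤ 1 / 2 := by rw [div_le_iff₀ hL0]; linarith
      calc B * (K * ((Real.exp (L * s₀) - 1) / L)) = B / L * (K * (Real.exp (L * s₀) - 1)) := by ring
        _ ≤ 1 / 2 * (K * (Real.exp (L * s₀) - 1)) := by
            gcongr
        _ ≤ _ := by linarith
    have h5 : K * Real.exp (L * s₀) ≤ a + K * Real.exp (L * s₀) / 2 := by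
      rw [← h3] at h4 ⊢
      have := mul_le_mul_of_nonneg_left hint hB
      linarith
    nlinarith
  intro s hs
  refine (hhK s hs).trans ?_
  have h6 : Real.exp (L * s) ≤ Real.exp L := Real.exp_le_exp.mpr (by nlinarith [hs.2])
  calc K * Real.exp (L * s) ≤ 2 * a * Real.exp (L * s) := by gcongr
    _ ≤ _ := by gcongr

theorem norm_integral_mul_le {f : ℝ → ℝ} {M : ℝ} (hM : ∀ᵐ t, |f t| ≤ M) {G : ℝ → ℂ} {B s : ℝ}
    (hs : s ∈ Icc (0 : ℝ) 1) (hB : 0 ≤ B) (hG : ∀ u ∈ Icc (0 : ℝ) 1, ‖G u‖ ≤ B) :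
    ‖∫ u in (0 : ℝ)..s, G u * (f u : ℂ)‖ ≤ B * M := by
  have hM0 : 0 ≤ M := by
    obtain ⟨t, ht⟩ := hM.exists
    exact (abs_nonneg _).trans ht
  have := intervalIntegral.norm_integral_le_of_norm_le_const_ae (a := 0) (b := s) (C := B * M)
    (f := fun u => G u * (f u : ℂ)) (by
      filter_upwards [hM] with u hu hmem
      rw [uIoc_of_le hs.1] at hmem
      rw [norm_mul, Complex.norm_real, Real.norm_eq_abs]
      exact mul_le_mul (hG u ⟨hmem.1.le, hmem.2.trans hs.2⟩) hu (abs_nonneg _) hB)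
  refine this.trans ?_
  rw [sub_zero, abs_of_nonneg hs.1]
  exact mul_le_of_le_one_right (by positivity) hs.2

/-- `y` solves, on the unit interval, the phase equation at momentum `κ` of the potential `x f`. -/
structure IsUnitPhase (f : ℝ → ℝ) (κ x : ℝ) (y : ℝ → ℝ) : Prop where
  continuousOn : ContinuousOn y (Icc 0 1)
  eq : ∀ s ∈ Icc (0 : ℝ) 1, y s = y 0 + κ * s +
    x / (2 * κ) * ∫ u in (0 : ℝ)..s, (Real.cos (2 * y u) - 1) * f u

section UnitPhase

variable {f : ℝ → ℝ} {M κmin : ℝ}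

/-- Over one cell the phase departs from the free rotation `κ s` only to first order in the
amplitude. -/
theorem IsUnitPhase.abs_sub_le (hM : ∀ᵐ t, |f t| ≤ M) (hκmin : 0 < κmin) {κ x : ℝ} {y : ℝ → ℝ}
    (hκ : κmin ≤ κ) (h : IsUnitPhase f κ x y) {s : ℝ} (hs : s ∈ Icc (0 : ℝ) 1) :
    |y s - y 0 - κ * s| ≤ M / κmin * |x| := by
  have hκ0 : 0 < κ := hκmin.trans_le hκ
  have hM0 : 0 ≤ M := by
    obtain ⟨t, ht⟩ := hM.exists
    exact (abs_nonneg _).trans ht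
  have h1 := intervalIntegral.norm_integral_le_of_norm_le_const_ae (a := 0) (b := s) (C := 2 * M)
    (f := fun u => (Real.cos (2 * y u) - 1) * f u) (by
      filter_upwards [hM] with u hu _
      rw [Real.norm_eq_abs, abs_mul]
      have : |Real.cos (2 * y u) - 1| ≤ 2 := by
        rw [abs_le]
        constructor <;> linarith [Real.cos_le_one (2 * y u), Real.neg_one_le_cos (2 * y u)]
      exact mul_le_mul this hu (abs_nonneg _) (by norm_num))
  rw [sub_zero, abs_of_nonneg hs.1, Real.norm_eq_abs] at h1
  rw [h.eq s hs, add_assoc, add_sub_cancel_left, add_sub_cancel_left, abs_mul, abs_div,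
    abs_of_pos (by positivity : 0 < 2 * κ)]
  have hs0 : 0 ≤ s := hs.1
  calc _ ≤ |x| / (2 * κ) * (2 * M * s) := by gcongr
    _ ≤ |x| / (2 * κmin) * (2 * M * 1) := by gcongr; exact hs.2
    _ = _ := by field_simp

/-- For distant momenta each reciprocal is bounded by `1 / κmin`; for close ones their difference
carries the product of the reciprocals, at most `1 / κmin ^ 2`. -/
theorem abs_inv_sub_inv_le (hκmin : 0 < κmin) {κ₁ κ₂ : ℝ} (h₁ : κmin ≤ κ₁) (h₂ : κmin ≤ κ₂) :
    |1 / (2 * κ₁) - 1 / (2 * κ₂)| ≤ (1 / κmin + 1 / κmin ^ 2) * min 1 |κ₁ - κ₂| := by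
  have h10 : 0 < κ₁ := hκmin.trans_le h₁
  have h20 : 0 < κ₂ := hκmin.trans_le h₂
  rcases le_total 1 |κ₁ - κ₂| with h | h
  · rw [min_eq_left h, mul_one]
    have e1 : 1 / (2 * κ₁) ≤ 1 / κmin := by gcongr; linarith
    have e2 : 1 / (2 * κ₂) ≤ 1 / κmin := by gcongr; linarith
    have e3 : 0 < 1 / (2 * κ₁) := by positivity
    have e4 : 0 < 1 / (2 * κ₂) := by positivity
    have e5 : 0 < 1 / κmin ^ 2 := by positivity
    rw [abs_le]; constructor <;> linarith
  · rw [min_eq_right h]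
    have : 1 / (2 * κ₁) - 1 / (2 * κ₂) = (κ₂ - κ₁) / (2 * (κ₁ * κ₂)) := by field_simp
    rw [this, abs_div, abs_sub_comm, abs_of_pos (by positivity : 0 < 2 * (κ₁ * κ₂)),
      div_eq_mul_one_div, mul_comm]
    gcongr
    have e1 : 1 / (2 * (κ₁ * κ₂)) ≤ 1 / κmin ^ 2 := by
      gcongr
      nlinarith [mul_le_mul h₁ h₂ hκmin.le h10.le]
    have : 0 < 1 / κmin := by positivity
    linarith

/-- Stability of the phase displacement over the unit interval. -/
theorem IsUnitPhase.exists_bound (hf : AEStronglyMeasurable f volume) (hM : ∀ᵐ t, |f t| ≤ M)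
    (hκmin : 0 < κmin) :
    ∃ K : ℝ, 0 < K ∧ ∀ (κ₁ κ₂ x₁ x₂ : ℝ) (y₁ y₂ : ℝ → ℝ), κmin ≤ κ₁ → κmin ≤ κ₂ →
      |x₁| ≤ 1 → |x₂| ≤ 1 → IsUnitPhase f κ₁ x₁ y₁ → IsUnitPhase f κ₂ x₂ y₂ →
      ∀ s ∈ Icc (0 : ℝ) 1, |(y₁ s - y₁ 0 - κ₁ * s) - (y₂ s - y₂ 0 - κ₂ * s)| ≤
        K * (|x₁ - x₂| + |x₁| * (min 1 |κ₁ - κ₂| + ‖phaseExp (y₁ 0) - phaseExp (y₂ 0)‖)) := by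
  have hM0 : 0 ≤ M := by
    obtain ⟨t, ht⟩ := hM.exists
    exact (abs_nonneg _).trans ht
  set c := 1 / κmin + 1 / κmin ^ 2 with hc
  have hc0 : 0 < c := by positivity
  have hκc : 1 / κmin ≤ c := by rw [hc]; have : 0 < 1 / κmin ^ 2 := by positivity
                                linarith
  set B := 2 * M * c with hB
  refine ⟨2 * (B + B + B + 1) * Real.exp (2 * B + 1), by positivity, ?_⟩
  intro κ₁ κ₂ x₁ x₂ y₁ y₂ h₁ h₂ hx₁ hx₂ hy₁ hy₂
  have h10 : 0 < κ₁ := hκmin.trans_le h₁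
  have h20 : 0 < κ₂ := hκmin.trans_le h₂
  set δ := min 1 |κ₁ - κ₂| with hδ
  set d := ‖phaseExp (y₁ 0) - phaseExp (y₂ 0)‖ with hd
  have hδ0 : 0 ≤ δ := le_min zero_le_one (abs_nonneg _)
  have hd0 : 0 ≤ d := norm_nonneg _
  let p : ℝ → ℝ := fun s => |(y₁ s - y₁ 0 - κ₁ * s) - (y₂ s - y₂ 0 - κ₂ * s)|
  have hpc : ContinuousOn p (Icc 0 1) := by
    have := hy₁.continuousOn
    have := hy₂.continuousOn
    fun_prop
  -- Here `e^{2iy}` is the product of its initial value, the free rotation and the displacement, all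
  -- unimodular; the three terms of the bound compare the factors one at a time.
  have hw : ∀ u ∈ Icc (0 : ℝ) 1, |Real.cos (2 * y₁ u) - Real.cos (2 * y₂ u)| ≤
      d + 2 * δ + 2 * p u := fun u hu => by
    have e : ∀ (y : ℝ → ℝ) (κ : ℝ), phaseExp (y u) =
        phaseExp (y 0) * phaseExp (κ * u) * phaseExp (y u - y 0 - κ * u) := fun y κ => by
      rw [← phaseExp_add, ← phaseExp_add]; ring_nf
    have h3 : |Real.cos (2 * y₁ u) - Real.cos (2 * y₂ u)| ≤ ‖phaseExp (y₁ u) - phaseExp (y₂ u)‖ := by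
      rw [← phaseExp_re, ← phaseExp_re, ← Complex.sub_re]
      exact Complex.abs_re_le_norm _
    refine h3.trans ?_
    rw [e y₁ κ₁, e y₂ κ₂]
    have n1 := norm_phaseExp (y₁ 0)
    have n2 := norm_phaseExp (y₂ 0)
    have n3 := norm_phaseExp (κ₁ * u)
    have n4 := norm_phaseExp (κ₂ * u)
    have n5 := norm_phaseExp (y₁ u - y₁ 0 - κ₁ * u)
    have n6 := norm_phaseExp_mul_sub_le (κ₁ := κ₁) (κ₂ := κ₂) hu.1 hu.2
    have n7 := norm_phaseExp_sub_le (y₁ u - y₁ 0 - κ₁ * u) (y₂ u - y₂ 0 - κ₂ * u)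
    generalize phaseExp (y₁ u - y₁ 0 - κ₁ * u) = w₁ at *
    generalize phaseExp (y₂ u - y₂ 0 - κ₂ * u) = w₂ at *
    have : phaseExp (y₁ 0) * phaseExp (κ₁ * u) * w₁ - phaseExp (y₂ 0) * phaseExp (κ₂ * u) * w₂ =
      (phaseExp (y₁ 0) - phaseExp (y₂ 0)) * phaseExp (κ₁ * u) * w₁ +
      phaseExp (y₂ 0) * (phaseExp (κ₁ * u) - phaseExp (κ₂ * u)) * w₁ +
      phaseExp (y₂ 0) * phaseExp (κ₂ * u) * (w₁ - w₂) := by ring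
    rw [this]
    refine (norm_add₃_le).trans ?_
    simp only [norm_mul, n2, n3, n4, n5, one_mul, mul_one]
    exact add_le_add (add_le_add le_rfl n6) n7
  have hint : ∀ (y : ℝ → ℝ), ContinuousOn y (Icc 0 1) → ∀ s ∈ Icc (0 : ℝ) 1,
      IntervalIntegrable (fun u => (Real.cos (2 * y u) - 1) * f u) volume 0 s := fun y hy s hs => by
    have hfi := intervalIntegrable_of_ae_bdd hf hM 0 s
    refine hfi.continuousOn_mul ?_
    rw [uIcc_of_le hs.1]
    have := hy.mono (Icc_subset_Icc_right hs.2)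
    fun_prop
  have hle : ∀ s ∈ Icc (0 : ℝ) 1, p s ≤
      (B + B + B + 1) * (|x₁ - x₂| + |x₁| * (δ + d)) + B * ∫ u in (0 : ℝ)..s, p u := fun s hs => by
    have i1 := hint y₁ hy₁.continuousOn s hs
    have i2 := hint y₂ hy₂.continuousOn s hs
    have e1 : (y₁ s - y₁ 0 - κ₁ * s) - (y₂ s - y₂ 0 - κ₂ * s) =
        ∫ u in (0 : ℝ)..s, (x₁ / (2 * κ₁) * ((Real.cos (2 * y₁ u) - 1) * f u) -
          x₂ / (2 * κ₂) * ((Real.cos (2 * y₂ u) - 1) * f u)) := by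
      rw [intervalIntegral.integral_sub (i1.const_mul _) (i2.const_mul _),
        intervalIntegral.integral_const_mul, intervalIntegral.integral_const_mul,
        hy₁.eq s hs, hy₂.eq s hs]
      ring
    have hps : p s ≤ ∫ u in (0 : ℝ)..s, ((B + B + B) * (|x₁ - x₂| + |x₁| * (δ + d)) + B * p u) := by
      simp only [p]
      rw [e1, ← Real.norm_eq_abs]
      refine intervalIntegral.norm_integral_le_of_norm_le hs.1 ?_ ?_
      · filter_upwards [hM] with u hu hmem
        have humem : u ∈ Icc (0 : ℝ) 1 := ⟨hmem.1.le, hmem.2.trans hs.2⟩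
        have hwu := hw u humem
        have hp0 : 0 ≤ p u := abs_nonneg _
        -- The split leaves a factor `x₁` on everything caused by different momenta or initial
        -- phases. Only the displacement term gives it up, through `|x₁| ≤ 1`, and that term goes to
        -- Grönwall.
        have e2 : x₁ / (2 * κ₁) * ((Real.cos (2 * y₁ u) - 1) * f u) -
            x₂ / (2 * κ₂) * ((Real.cos (2 * y₂ u) - 1) * f u) =
            (x₁ * (1 / (2 * κ₁)) * (Real.cos (2 * y₁ u) - Real.cos (2 * y₂ u)) +
            (x₁ * (1 / (2 * κ₁) - 1 / (2 * κ₂)) + (x₁ - x₂) * (1 / (2 * κ₂))) *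
              (Real.cos (2 * y₂ u) - 1)) * f u := by ring
        have c2 : |Real.cos (2 * y₂ u) - 1| ≤ 2 := by
          rw [abs_le]
          constructor <;> linarith [Real.cos_le_one (2 * y₂ u), Real.neg_one_le_cos (2 * y₂ u)]
        have k1 : 1 / (2 * κ₁) ≤ c := hκc.trans' (by gcongr; linarith)
        have k2 : 1 / (2 * κ₂) ≤ c := hκc.trans' (by gcongr; linarith)
        have k3 : |1 / (2 * κ₁) - 1 / (2 * κ₂)| ≤ c * δ := abs_inv_sub_inv_le hκmin h₁ h₂
        rw [e2, Real.norm_eq_abs, abs_mul]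
        have b1 : |x₁ * (1 / (2 * κ₁)) * (Real.cos (2 * y₁ u) - Real.cos (2 * y₂ u))| ≤
            |x₁| * c * (d + 2 * δ) + c * (2 * p u) := by
          rw [abs_mul, abs_mul, abs_of_pos (by positivity : 0 < 1 / (2 * κ₁))]
          calc _ ≤ |x₁| * c * (d + 2 * δ + 2 * p u) := by gcongr
            _ = |x₁| * c * (d + 2 * δ) + |x₁| * (c * (2 * p u)) := by ring
            _ ≤ |x₁| * c * (d + 2 * δ) + 1 * (c * (2 * p u)) := by gcongr
            _ = _ := by ring
        have b2 : |(x₁ * (1 / (2 * κ₁) - 1 / (2 * κ₂)) + (x₁ - x₂) * (1 / (2 * κ₂))) *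
              (Real.cos (2 * y₂ u) - 1)| ≤ (|x₁| * (c * δ) + |x₁ - x₂| * c) * 2 := by
          rw [abs_mul]
          gcongr
          refine (abs_add_le _ _).trans ?_
          rw [abs_mul, abs_mul, abs_of_pos (by positivity : 0 < 1 / (2 * κ₂))]
          gcongr
        calc _ ≤ ((|x₁| * c * (d + 2 * δ) + c * (2 * p u)) +
              (|x₁| * (c * δ) + |x₁ - x₂| * c) * 2) * M := by
              gcongr
              exact (abs_add_le _ _).trans (add_le_add b1 b2)
          _ ≤ _ := by
              have q1 : 0 ≤ M * c * |x₁| * d := by positivity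
              have q2 : 0 ≤ M * c * |x₁| * δ := by positivity
              have q3 : 0 ≤ M * c * |x₁ - x₂| := by positivity
              rw [hB]
              nlinarith
      · refine ContinuousOn.intervalIntegrable ?_
        rw [uIcc_of_le hs.1]
        exact continuousOn_const.add
          (continuousOn_const.mul (hpc.mono (Icc_subset_Icc_right hs.2)))
    refine hps.trans ?_
    have ip : IntervalIntegrable p volume 0 s := by
      refine ContinuousOn.intervalIntegrable ?_
      rw [uIcc_of_le hs.1]
      exact hpc.mono (Icc_subset_Icc_right hs.2)
    rw [intervalIntegral.integral_add intervalIntegrable_const (ip.const_mul _),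
      intervalIntegral.integral_const, intervalIntegral.integral_const_mul]
    have q0 : 0 ≤ |x₁ - x₂| + |x₁| * (δ + d) := by positivity
    have q1 : (s - 0) • ((B + B + B) * (|x₁ - x₂| + |x₁| * (δ + d))) ≤
        (B + B + B) * (|x₁ - x₂| + |x₁| * (δ + d)) := by
      rw [sub_zero, smul_eq_mul]
      exact mul_le_of_le_one_left (by positivity) hs.2
    linarith
  intro s hs
  have := le_of_le_add_integral (by positivity) (by positivity) hpc hle s hs
  refine this.trans_eq ?_
  ring

end UnitPhase

/-- The Fourier transform `∫₀¹ e^{2iκu} f(u) du` of the single-site profile. -/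
noncomputable def profileTransform (f : ℝ → ℝ) (κ : ℝ) : ℂ :=
  ∫ u in (0 : ℝ)..1, phaseExp (κ * u) * (f u : ℂ)

section UnitPhase

variable {f : ℝ → ℝ} {M κmin : ℝ}

theorem norm_profileTransform_le (hM : ∀ᵐ t, |f t| ≤ M) (κ : ℝ) : ‖profileTransform f κ‖ ≤ M := by
  have := norm_integral_mul_le hM (G := fun u => phaseExp (κ * u)) (right_mem_Icc.mpr zero_le_one)
    zero_le_one (fun u _ => (norm_phaseExp _).le)
  rwa [one_mul] at this

theorem intervalIntegrable_mul_ofReal (hf : AEStronglyMeasurable f volume) (hM : ∀ᵐ t, |f t| ≤ M)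
    {G : ℝ → ℂ} {a b : ℝ} (hG : ContinuousOn G (uIcc a b)) :
    IntervalIntegrable (fun u => G u * (f u : ℂ)) volume a b :=
  have h := intervalIntegrable_of_ae_bdd hf hM a b
  IntervalIntegrable.continuousOn_mul (f := fun u => (f u : ℂ)) ⟨h.1.ofReal, h.2.ofReal⟩ hG

theorem norm_profileTransform_sub_le (hf : AEStronglyMeasurable f volume)
    (hM : ∀ᵐ t, |f t| ≤ M) (κ₁ κ₂ : ℝ) :
    ‖profileTransform f κ₁ - profileTransform f κ₂‖ ≤ 2 * min 1 |κ₁ - κ₂| * M := by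
  have hi : ∀ κ, IntervalIntegrable (fun u => phaseExp (κ * u) * (f u : ℂ)) volume 0 1 := fun κ =>
    intervalIntegrable_mul_ofReal hf hM
      (continuous_phaseExp.comp (by fun_prop : Continuous fun u : ℝ => κ * u)).continuousOn
  rw [profileTransform, profileTransform, ← intervalIntegral.integral_sub (hi κ₁) (hi κ₂)]
  simp_rw [← sub_mul]
  exact norm_integral_mul_le hM (right_mem_Icc.mpr zero_le_one) (by positivity)
    fun u hu => norm_phaseExp_mul_sub_le hu.1 hu.2

/-- Stability of the unimodular phase and of the oscillatory integral over the unit interval. -/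
theorem IsUnitPhase.exists_increment_bound (hf : AEStronglyMeasurable f volume)
    (hM : ∀ᵐ t, |f t| ≤ M) (hκmin : 0 < κmin) :
    ∃ K : ℝ, 0 < K ∧ ∀ (κ₁ κ₂ x : ℝ) (y₁ y₂ : ℝ → ℝ) (D : ℝ), κmin ≤ κ₁ → κmin ≤ κ₂ →
      |x| ≤ 1 → IsUnitPhase f κ₁ x y₁ → IsUnitPhase f κ₂ x y₂ →
      D = min 1 |κ₁ - κ₂| + ‖phaseExp (y₁ 0) - phaseExp (y₂ 0)‖ →
      ‖(phaseExp (y₁ 1) - phaseExp κ₁ * phaseExp (y₁ 0)) -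
        (phaseExp (y₂ 1) - phaseExp κ₂ * phaseExp (y₂ 0))‖ ≤ K * |x| * D ∧
      ‖(x * (∫ u in (0 : ℝ)..1, phaseExp (y₁ u) * (f u : ℂ)) -
          x * (profileTransform f κ₁ * phaseExp (y₁ 0))) -
        (x * (∫ u in (0 : ℝ)..1, phaseExp (y₂ u) * (f u : ℂ)) -
          x * (profileTransform f κ₂ * phaseExp (y₂ 0)))‖ ≤ K * |x| ^ 2 * D ∧
      ∀ s ∈ Icc (0 : ℝ) 1, ‖x * (∫ u in (0 : ℝ)..s, phaseExp (y₁ u) * (f u : ℂ)) -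
        x * ∫ u in (0 : ℝ)..s, phaseExp (y₂ u) * (f u : ℂ)‖ ≤ K * |x| * D := by
  have hM0 : 0 ≤ M := by
    obtain ⟨t, ht⟩ := hM.exists
    exact (abs_nonneg _).trans ht
  obtain ⟨K₀, hK₀, hb⟩ := IsUnitPhase.exists_bound hf hM hκmin
  set K₁ := 2 * (2 * (M / κmin)) + 2 * K₀ with hK₁
  have hK₁0 : 0 < K₁ := by positivity
  refine ⟨(K₁ + 2) * (M + 1), by positivity, ?_⟩
  intro κ₁ κ₂ x y₁ y₂ D h₁ h₂ hx hy₁ hy₂ hD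
  set δ := min 1 |κ₁ - κ₂| with hδ
  set d := ‖phaseExp (y₁ 0) - phaseExp (y₂ 0)‖ with hd
  have hδ0 : 0 ≤ δ := le_min zero_le_one (abs_nonneg _)
  have hd0 : 0 ≤ d := norm_nonneg _
  have hD0 : 0 ≤ D := by rw [hD]; positivity
  -- `Q` is the deviation from free evolution, of first order in `x`. This gives the first claim; in
  -- the second, the prefactor `x` of the integral supplies the second power of `|x|`.
  let Q : (ℝ → ℝ) → ℝ → ℝ → ℂ := fun y κ u => phaseExp (y u) - phaseExp (κ * u) * phaseExp (y 0)
  have hfree : ∀ u ∈ Icc (0 : ℝ) 1, ‖phaseExp (κ₁ * u) * phaseExp (y₁ 0) -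
      phaseExp (κ₂ * u) * phaseExp (y₂ 0)‖ ≤ 2 * D := fun u hu => by
    have : phaseExp (κ₁ * u) * phaseExp (y₁ 0) - phaseExp (κ₂ * u) * phaseExp (y₂ 0) =
      phaseExp (κ₁ * u) * (phaseExp (y₁ 0) - phaseExp (y₂ 0)) +
      (phaseExp (κ₁ * u) - phaseExp (κ₂ * u)) * phaseExp (y₂ 0) := by ring
    rw [this]
    refine (norm_add_le _ _).trans ?_
    rw [norm_mul, norm_mul, norm_phaseExp, norm_phaseExp, one_mul, mul_one]
    have := norm_phaseExp_mul_sub_le (κ₁ := κ₁) (κ₂ := κ₂) hu.1 hu.2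
    linarith
  have hQ : ∀ u ∈ Icc (0 : ℝ) 1, ‖Q y₁ κ₁ u - Q y₂ κ₂ u‖ ≤ K₁ * |x| * D := fun u hu => by
    have e : ∀ (y : ℝ → ℝ) (κ : ℝ), Q y κ u =
        phaseExp (κ * u) * phaseExp (y 0) * (phaseExp (y u - y 0 - κ * u) - 1) := fun y κ => by
      rw [mul_sub, ← phaseExp_add, ← phaseExp_add]; simp only [Q, ← phaseExp_add]; ring_nf
    rw [e, e]
    have n1 := norm_phaseExp_sub_one_le (y₁ u - y₁ 0 - κ₁ * u)
    have n2 := norm_phaseExp_sub_le (y₁ u - y₁ 0 - κ₁ * u) (y₂ u - y₂ 0 - κ₂ * u)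
    have n3 := hy₁.abs_sub_le hM hκmin h₁ hu
    have n4 := hb κ₁ κ₂ x x y₁ y₂ h₁ h₂ hx hx hy₁ hy₂ u hu
    rw [sub_self, abs_zero, zero_add, ← hD] at n4
    have n5 := hfree u hu
    have n6 : ‖phaseExp (κ₂ * u) * phaseExp (y₂ 0)‖ = 1 := by
      rw [norm_mul, norm_phaseExp, norm_phaseExp, one_mul]
    generalize phaseExp (y₁ u - y₁ 0 - κ₁ * u) = w₁ at *
    generalize phaseExp (y₂ u - y₂ 0 - κ₂ * u) = w₂ at *
    generalize phaseExp (κ₁ * u) * phaseExp (y₁ 0) = v₁ at *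
    generalize phaseExp (κ₂ * u) * phaseExp (y₂ 0) = v₂ at *
    have : v₁ * (w₁ - 1) - v₂ * (w₂ - 1) = (v₁ - v₂) * (w₁ - 1) + v₂ * (w₁ - w₂) := by ring
    rw [this]
    refine (norm_add_le _ _).trans ?_
    rw [norm_mul, norm_mul, n6, one_mul]
    calc _ ≤ (2 * D) * (2 * (M / κmin * |x|)) + 2 * (K₀ * (|x| * D)) := by
          gcongr
          · exact n1.trans (by linarith)
          · exact n2.trans (by linarith)
      _ = _ := by rw [hK₁]; ring
  have hint : ∀ (y : ℝ → ℝ), ContinuousOn y (Icc 0 1) → ∀ s ∈ Icc (0 : ℝ) 1,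
      IntervalIntegrable (fun u => phaseExp (y u) * (f u : ℂ)) volume 0 s := fun y hy s hs => by
    refine intervalIntegrable_mul_ofReal hf hM ?_
    rw [uIcc_of_le hs.1]
    exact continuous_phaseExp.comp_continuousOn (hy.mono (Icc_subset_Icc_right hs.2))
  have h1m : (1 : ℝ) ∈ Icc (0 : ℝ) 1 := right_mem_Icc.mpr zero_le_one
  refine ⟨?_, ?_, fun s hs => ?_⟩
  · have := hQ 1 h1m
    simp only [Q, mul_one] at this
    refine this.trans ?_
    gcongr
    nlinarith
  · have hifree : ∀ (y : ℝ → ℝ) (κ : ℝ), IntervalIntegrable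
        (fun u => phaseExp (κ * u) * phaseExp (y 0) * (f u : ℂ)) volume 0 1 := fun y κ => by
      refine intervalIntegrable_mul_ofReal hf hM (Continuous.continuousOn ?_)
      exact (continuous_phaseExp.comp (by fun_prop : Continuous fun u : ℝ => κ * u)).mul
        continuous_const
    have e : ∀ (y : ℝ → ℝ) (κ : ℝ), ContinuousOn y (Icc 0 1) →
        (x * (∫ u in (0 : ℝ)..1, phaseExp (y u) * (f u : ℂ)) -
          x * (profileTransform f κ * phaseExp (y 0))) =
        x * ∫ u in (0 : ℝ)..1, Q y κ u * (f u : ℂ) := fun y κ hy => by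
      rw [profileTransform, ← intervalIntegral.integral_mul_const, ← mul_sub]
      congr 1
      rw [← intervalIntegral.integral_sub (hint y hy 1 h1m)]
      · refine intervalIntegral.integral_congr fun u _ => ?_
        simp only [Q]; ring
      · refine (hifree y κ).congr (fun u _ => ?_)
        ring
    have hiQ : ∀ (y : ℝ → ℝ) (κ : ℝ), ContinuousOn y (Icc 0 1) →
        IntervalIntegrable (fun u => Q y κ u * (f u : ℂ)) volume 0 1 := fun y κ hy => by
      refine ((hint y hy 1 h1m).sub (hifree y κ)).congr (fun u _ => ?_)
      simp only [Q]; ring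
    rw [e y₁ κ₁ hy₁.continuousOn, e y₂ κ₂ hy₂.continuousOn, ← mul_sub,
      ← intervalIntegral.integral_sub (hiQ y₁ κ₁ hy₁.continuousOn) (hiQ y₂ κ₂ hy₂.continuousOn),
      norm_mul, Complex.norm_real, Real.norm_eq_abs]
    simp_rw [← sub_mul]
    have := norm_integral_mul_le hM h1m (by positivity) hQ
    calc |x| * _ ≤ |x| * (K₁ * |x| * D * M) := by gcongr
      _ = K₁ * M * |x| ^ 2 * D := by ring
      _ ≤ _ := by gcongr <;> linarith
  · rw [← mul_sub, ← intervalIntegral.integral_sub (hint y₁ hy₁.continuousOn s hs)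
      (hint y₂ hy₂.continuousOn s hs), norm_mul, Complex.norm_real, Real.norm_eq_abs]
    simp_rw [← sub_mul]
    have hw : ∀ u ∈ Icc (0 : ℝ) 1, ‖phaseExp (y₁ u) - phaseExp (y₂ u)‖ ≤ (K₁ + 2) * D :=
      fun u hu => by
        have e : phaseExp (y₁ u) - phaseExp (y₂ u) = (Q y₁ κ₁ u - Q y₂ κ₂ u) +
          (phaseExp (κ₁ * u) * phaseExp (y₁ 0) - phaseExp (κ₂ * u) * phaseExp (y₂ 0)) := by
          simp only [Q]; ring
        rw [e]
        refine (norm_add_le _ _).trans ?_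
        have h3 : K₁ * |x| * D ≤ K₁ * 1 * D := by gcongr
        linarith [hQ u hu, hfree u hu]
    have := norm_integral_mul_le hM hs (by positivity) hw
    calc |x| * _ ≤ |x| * ((K₁ + 2) * D * M) := by gcongr
      _ = (K₁ + 2) * M * |x| * D := by ring
      _ ≤ _ := by gcongr; linarith

/-- The unimodular phase at the end of the unit interval is Lipschitz in the initial phase and the
amplitude. -/
theorem IsUnitPhase.exists_lipschitz (hf : AEStronglyMeasurable f volume)
    (hM : ∀ᵐ t, |f t| ≤ M) {κ : ℝ} (hκ : 0 < κ) :
    ∃ K : ℝ, 0 < K ∧ ∀ (x₁ x₂ : ℝ) (y₁ y₂ : ℝ → ℝ), |x₁| ≤ 1 → |x₂| ≤ 1 →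
      IsUnitPhase f κ x₁ y₁ → IsUnitPhase f κ x₂ y₂ → ‖phaseExp (y₁ 1) - phaseExp (y₂ 1)‖ ≤
        K * (|x₁ - x₂| + ‖phaseExp (y₁ 0) - phaseExp (y₂ 0)‖) := by
  obtain ⟨K, hK, hb⟩ := IsUnitPhase.exists_bound hf hM hκ
  refine ⟨2 * K + 1, by positivity, fun x₁ x₂ y₁ y₂ hx₁ hx₂ hy₁ hy₂ => ?_⟩
  have h1 := hb κ κ x₁ x₂ y₁ y₂ le_rfl le_rfl hx₁ hx₂ hy₁ hy₂ 1 (right_mem_Icc.mpr zero_le_one)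
  have e : ∀ y : ℝ → ℝ, phaseExp (y 1) = phaseExp κ * phaseExp (y 0) *
      phaseExp (y 1 - y 0 - κ * 1) := fun y => by
    rw [← phaseExp_add, ← phaseExp_add]; ring_nf
  have n1 := norm_phaseExp_sub_le (y₁ 1 - y₁ 0 - κ * 1) (y₂ 1 - y₂ 0 - κ * 1)
  rw [e y₁, e y₂]
  have n2 := norm_phaseExp (y₁ 1 - y₁ 0 - κ * 1)
  have n3 := norm_phaseExp κ
  have n4 := norm_phaseExp (y₂ 0)
  generalize phaseExp (y₁ 1 - y₁ 0 - κ * 1) = w₁ at *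
  generalize phaseExp (y₂ 1 - y₂ 0 - κ * 1) = w₂ at *
  set d := ‖phaseExp (y₁ 0) - phaseExp (y₂ 0)‖ with hd
  have hd0 : 0 ≤ d := norm_nonneg _
  have : phaseExp κ * phaseExp (y₁ 0) * w₁ - phaseExp κ * phaseExp (y₂ 0) * w₂ =
    phaseExp κ * (phaseExp (y₁ 0) - phaseExp (y₂ 0)) * w₁ +
    phaseExp κ * phaseExp (y₂ 0) * (w₁ - w₂) := by ring
  rw [this]
  refine (norm_add_le _ _).trans ?_
  simp only [norm_mul, n2, n3, n4, one_mul, mul_one, sub_self, abs_zero, ← hd] at h1 n1 ⊢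
  rw [min_eq_right zero_le_one, zero_add] at h1
  have h3 : K * (|x₁ - x₂| + |x₁| * d) ≤ K * (|x₁ - x₂| + 1 * d) := by gcongr
  have := abs_nonneg (x₁ - x₂)
  nlinarith

end UnitPhase

/-! ### The alloy potential cell by cell -/

/-- The coefficient of `f (t - j)` in the alloy potential. -/
noncomputable def alloyAmplitude (α : ℝ) (a : ℕ → ℝ) : ℕ → ℝ
  | 0 => 0
  | j + 1 => a (j + 1) / ((j : ℝ) + 1) ^ α

/-- The shifted weight `(j + 1) ^ (-α)` makes sense at `j = 0`; the price is `2 ^ α`, since `j + 1 ≤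
2 j` for `j ≥ 1`. -/
theorem abs_alloyAmplitude_le {α : ℝ} (hα : 0 ≤ α) {a : ℕ → ℝ} (ha : ∀ j, 1 ≤ j → |a j| ≤ 1)
    (j : ℕ) : |alloyAmplitude α a j| ≤ 2 ^ α * ((j : ℝ) + 1) ^ (-α) := by
  cases j with
  | zero => simp only [alloyAmplitude, abs_zero]; positivity
  | succ j =>
    have hj : (0 : ℝ) < (j : ℝ) + 1 := by positivity
    rw [alloyAmplitude, abs_div, abs_of_pos (Real.rpow_pos_of_pos hj α), Real.rpow_neg (by positivity),
      ← div_eq_mul_inv, div_le_div_iff₀ (Real.rpow_pos_of_pos hj α) (by positivity),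
      ← Real.mul_rpow (by norm_num) hj.le]
    have h1 := ha (j + 1) (by omega)
    have h2 : ((((j + 1 : ℕ) : ℝ)) + 1) ^ α ≤ (2 * ((j : ℝ) + 1)) ^ α := by
      refine Real.rpow_le_rpow (by positivity) ?_ hα
      push_cast; linarith [(Nat.cast_nonneg j : (0 : ℝ) ≤ j)]
    calc _ ≤ 1 * ((((j + 1 : ℕ) : ℝ)) + 1) ^ α := by gcongr
      _ ≤ _ := by rwa [one_mul]

theorem abs_alloyAmplitude_le_one {α : ℝ} (hα : 0 ≤ α) {a : ℕ → ℝ}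
    (ha : ∀ j, 1 ≤ j → |a j| ≤ 1) (j : ℕ) : |alloyAmplitude α a j| ≤ 1 := by
  cases j with
  | zero => simp [alloyAmplitude]
  | succ j =>
    have hj : (1 : ℝ) ≤ (j : ℝ) + 1 := by linarith [(Nat.cast_nonneg j : (0 : ℝ) ≤ j)]
    have h1 : 1 ≤ ((j : ℝ) + 1) ^ α := Real.one_le_rpow hj hα
    rw [alloyAmplitude, abs_div, abs_of_pos (by linarith : 0 < ((j : ℝ) + 1) ^ α),
      div_le_one (by linarith)]
    exact (ha (j + 1) (by omega)).trans h1

section Alloy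

variable {f : ℝ → ℝ} {α M κmin : ℝ} {a : ℕ → ℝ}

/-- The interval is open because at an integer two neighbouring profiles may both contribute, one
through `f 0` and one through `f 1`. Under integrals these points are negligible. -/
theorem alloyPotential_eq (hf : Function.support f ⊆ Icc 0 1) {j : ℕ} {t : ℝ}
    (ht : t ∈ Ioo (j : ℝ) (j + 1)) :
    alloyPotential α f a t = alloyAmplitude α a j * f (t - j) := by
  have hz : ∀ i : ℕ, i + 1 ≠ j → f (t - ((i : ℝ) + 1)) = 0 := fun i hi => by
    by_contra hne
    have hmem := hf (Function.mem_support.mpr hne)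
    refine hi (le_antisymm ?_ ?_)
    · have : (i : ℝ) + 1 < (j : ℝ) + 1 := by linarith [hmem.1, ht.2]
      have h2 : i + 1 < j + 1 := by exact_mod_cast this
      omega
    · have : (j : ℝ) < (i : ℝ) + 2 := by linarith [hmem.2, ht.1]
      have h2 : j < i + 2 := by exact_mod_cast this
      omega
  rw [alloyPotential]
  cases j with
  | zero =>
    rw [tsum_congr (g := fun _ => (0 : ℝ)) fun i => by rw [hz i (by omega), mul_zero]]
    simp [alloyAmplitude]
  | succ j =>
    rw [tsum_eq_single j fun i hi => by rw [hz i (by omega), mul_zero]]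
    simp [alloyAmplitude]

theorem alloyPotential_of_neg (hf : Function.support f ⊆ Icc 0 1) {t : ℝ} (ht : t < 0) :
    alloyPotential α f a t = 0 := by
  rw [alloyPotential, tsum_congr (g := fun _ => (0 : ℝ)), tsum_zero]
  intro i
  rw [show f (t - ((i : ℝ) + 1)) = 0 from ?_, mul_zero]
  by_contra hne
  have hmem := hf (Function.mem_support.mpr hne)
  linarith [hmem.1, (Nat.cast_nonneg i : (0 : ℝ) ≤ i)]

theorem aestronglyMeasurable_alloyPotential (hfm : AEStronglyMeasurable f volume)
    (hf : Function.support f ⊆ Icc 0 1) :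
    AEStronglyMeasurable (alloyPotential α f a) volume := by
  refine aestronglyMeasurable_of_tendsto_ae Filter.atTop
    (f := fun (n : ℕ) t => ∑ j ∈ Finset.range n,
      a (j + 1) / ((j : ℝ) + 1) ^ α * f (t - ((j : ℝ) + 1))) (fun n => ?_)
    (Filter.Eventually.of_forall fun t => ?_)
  · refine Finset.aestronglyMeasurable_fun_sum _ fun j _ => ?_
    exact (hfm.comp_measurePreserving
      (measurePreserving_sub_right volume ((j : ℝ) + 1))).const_mul _
  · refine (summable_of_hasFiniteSupport ?_).hasSum.tendsto_sum_nat
    refine (Set.finite_le_nat ⌊t⌋₊).subset fun i hi => ?_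
    have hne : f (t - ((i : ℝ) + 1)) ≠ 0 := fun h => hi (by simp [h])
    have hmem := hf (Function.mem_support.mpr hne)
    exact Nat.le_floor (by linarith [hmem.1])

theorem ae_abs_alloyPotential_le (hα : 0 ≤ α) (ha : ∀ j, 1 ≤ j → |a j| ≤ 1)
    (hM : ∀ᵐ t, |f t| ≤ M) (hf : Function.support f ⊆ Icc 0 1) :
    ∀ᵐ t, |alloyPotential α f a t| ≤ M := by
  have hM0 : 0 ≤ M := by
    obtain ⟨t, ht⟩ := hM.exists
    exact (abs_nonneg _).trans ht
  have h1 : ∀ᵐ t : ℝ, ∀ j : ℕ, t ≠ j := by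
    rw [ae_all_iff]
    intro j
    simp [ae_iff, measure_singleton]
  have h2 : ∀ᵐ t : ℝ, ∀ j : ℕ, |f (t - j)| ≤ M := by
    rw [ae_all_iff]
    exact fun j => (measurePreserving_sub_right volume (j : ℝ)).quasiMeasurePreserving.ae hM
  filter_upwards [h1, h2] with t ht1 ht2
  rcases lt_or_ge t 0 with h | h
  · rwa [alloyPotential_of_neg hf h, abs_zero]
  · rw [alloyPotential_eq hf (j := ⌊t⌋₊)
      ⟨lt_of_le_of_ne (Nat.floor_le h) (Ne.symm (ht1 _)), Nat.lt_floor_add_one t⟩, abs_mul]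
    exact (mul_le_of_le_one_left (abs_nonneg _) (abs_alloyAmplitude_le_one hα ha _)).trans (ht2 _)

theorem integral_alloyPotential_smul {E : Type*} [NormedAddCommGroup E] [NormedSpace ℝ E]
    (hf : Function.support f ⊆ Icc 0 1) (G : ℝ → E) (j : ℕ) {s : ℝ} (hs : s ∈ Icc (0 : ℝ) 1) :
    ∫ t in (j : ℝ)..j + s, alloyPotential α f a t • G t =
      alloyAmplitude α a j • ∫ u in (0 : ℝ)..s, f u • G (j + u) := by
  rw [← intervalIntegral.integral_smul]
  have h := intervalIntegral.integral_comp_add_left (a := 0) (b := s)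
    (fun t => alloyPotential α f a t • G t) (j : ℝ)
  rw [add_zero] at h
  rw [← h]
  refine intervalIntegral.integral_congr_ae ?_
  have hne : ∀ᵐ x : ℝ, x ≠ 1 := by simp [ae_iff, measure_singleton]
  filter_upwards [hne] with u hu hmem
  rw [uIoc_of_le hs.1] at hmem
  rw [alloyPotential_eq hf (j := j) ⟨by linarith [hmem.1],
    by linarith [lt_of_le_of_ne (hmem.2.trans hs.2) hu]⟩, add_sub_cancel_left, smul_smul]

theorem isPruferPhase_alloyPotential (hfm : AEStronglyMeasurable f volume)
    (hM : ∀ᵐ t, |f t| ≤ M) (hf : Function.support f ⊆ Icc 0 1) (hα : 0 ≤ α)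
    (ha : ∀ j, 1 ≤ j → |a j| ≤ 1) {κ : ℝ} (hκ : 0 < κ) :
    IsPruferPhase (alloyPotential α f a) κ (pruferPhase (alloyPotential α f a) κ) :=
  isPruferPhase_pruferPhase hκ (aestronglyMeasurable_alloyPotential hfm hf)
    (ae_abs_alloyPotential_le hα ha hM hf)

theorem IsPruferPhase.intervalIntegrable {V : ℝ → ℝ} {κ : ℝ} {θ : ℝ → ℝ}
    (hV : AEStronglyMeasurable V volume) (hM : ∀ᵐ t, |V t| ≤ M) (hθ : IsPruferPhase V κ θ)
    {s t : ℝ} (hs : 0 ≤ s) (ht : 0 ≤ t) :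
    IntervalIntegrable (fun u => phaseExp (θ u) * (V u : ℂ)) volume s t :=
  intervalIntegrable_mul_ofReal hV hM (continuous_phaseExp.comp_continuousOn
    (hθ.continuousOn.mono fun _ hu => (le_min hs ht).trans hu.1))

/-- Subtracting the integral equation at `j` from the one at `j + s` leaves an integral over one
cell, where the potential is an amplitude times a translate of `f`. -/
theorem isUnitPhase_pruferPhase (hfm : AEStronglyMeasurable f volume)
    (hM : ∀ᵐ t, |f t| ≤ M) (hf : Function.support f ⊆ Icc 0 1) (hα : 0 ≤ α)
    (ha : ∀ j, 1 ≤ j → |a j| ≤ 1) {κ : ℝ} (hκ : 0 < κ) (j : ℕ) :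
    IsUnitPhase f κ (alloyAmplitude α a j)
      (fun s => pruferPhase (alloyPotential α f a) κ (j + s)) := by
  have hθ := isPruferPhase_alloyPotential hfm hM hf hα ha hκ
  have hVm := aestronglyMeasurable_alloyPotential (α := α) (a := a) hfm hf
  have hVb := ae_abs_alloyPotential_le hα ha hM hf
  set V := alloyPotential α f a with hV
  set θ := pruferPhase V κ
  have hj : (0 : ℝ) ≤ j := Nat.cast_nonneg j
  refine ⟨hθ.continuousOn.comp (by fun_prop) fun s hs => mem_Ici.2 (by linarith [hs.1]), ?_⟩
  intro s hs
  have hi : ∀ b c : ℝ, 0 ≤ b → 0 ≤ c →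
      IntervalIntegrable (fun u => (Real.cos (2 * θ u) - 1) * V u) volume b c := fun b c hb hc => by
    refine (intervalIntegrable_of_ae_bdd hVm hVb b c).continuousOn_mul ?_
    have := hθ.continuousOn.mono (fun u (hu : u ∈ uIcc b c) => (le_min hb hc).trans hu.1)
    fun_prop
  have e1 := hθ.integral_eq hκ hVm hVb (t := j + s) (by linarith [hs.1])
  have e2 := hθ.integral_eq hκ hVm hVb hj
  have e3 := intervalIntegral.integral_add_adjacent_intervals (hi 0 j le_rfl hj)
    (hi j (j + s) hj (by linarith [hs.1]))
  have e4 := integral_alloyPotential_smul (α := α) (a := a) hf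
    (fun u => Real.cos (2 * θ u) - 1) j hs
  simp only [smul_eq_mul, ← hV] at e4
  simp only [add_zero]
  rw [e1, e2, ← e3]
  have e5 : ∫ u in (j : ℝ)..j + s, (Real.cos (2 * θ u) - 1) * V u =
      alloyAmplitude α a j * ∫ u in (0 : ℝ)..s, (Real.cos (2 * θ (j + u)) - 1) * f u := by
    simp_rw [mul_comm _ (V _), e4, mul_comm (f _)]
  rw [e5]; ring

theorem oscillatoryJ_add_sub (hfm : AEStronglyMeasurable f volume)
    (hM : ∀ᵐ t, |f t| ≤ M) (hf : Function.support f ⊆ Icc 0 1) (hα : 0 ≤ α)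
    (ha : ∀ j, 1 ≤ j → |a j| ≤ 1) {κ : ℝ} (hκ : 0 < κ) (j : ℕ) {s : ℝ} (hs : s ∈ Icc (0 : ℝ) 1) :
    oscillatoryJ (alloyPotential α f a) κ 0 (j + s) - oscillatoryJ (alloyPotential α f a) κ 0 j =
      alloyAmplitude α a j * ∫ u in (0 : ℝ)..s,
        phaseExp (pruferPhase (alloyPotential α f a) κ (j + u)) * (f u : ℂ) := by
  have hθ := isPruferPhase_alloyPotential hfm hM hf hα ha hκ
  have hVm := aestronglyMeasurable_alloyPotential (α := α) (a := a) hfm hf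
  have hVb := ae_abs_alloyPotential_le hα ha hM hf
  have hj : (0 : ℝ) ≤ j := Nat.cast_nonneg j
  have e3 := intervalIntegral.integral_add_adjacent_intervals
    (hθ.intervalIntegrable hVm hVb le_rfl hj)
    (hθ.intervalIntegrable hVm hVb hj (by linarith [hs.1] : (0 : ℝ) ≤ j + s))
  have e4 := integral_alloyPotential_smul (α := α) (a := a) hf
    (fun u => phaseExp (pruferPhase (alloyPotential α f a) κ u)) j hs
  simp only [Complex.real_smul] at e4
  simp_rw [mul_comm ((f _ : ℝ) : ℂ), mul_comm ((alloyPotential α f a _ : ℝ) : ℂ)] at e4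
  simp only [phaseExp] at e3 e4 ⊢
  simp only [oscillatoryJ]
  rw [← e4, ← e3, add_sub_cancel_left]

theorem oscillatoryJ_sub (hfm : AEStronglyMeasurable f volume)
    (hM : ∀ᵐ t, |f t| ≤ M) (hf : Function.support f ⊆ Icc 0 1) (hα : 0 ≤ α)
    (ha : ∀ j, 1 ≤ j → |a j| ≤ 1) {κ : ℝ} (hκ : 0 < κ) {m t : ℝ} (hm : 0 ≤ m) (ht : 0 ≤ t) :
    oscillatoryJ (alloyPotential α f a) κ m t = oscillatoryJ (alloyPotential α f a) κ 0 t -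
      oscillatoryJ (alloyPotential α f a) κ 0 m := by
  have hθ := isPruferPhase_alloyPotential hfm hM hf hα ha hκ
  have hVm := aestronglyMeasurable_alloyPotential (α := α) (a := a) hfm hf
  have hVb := ae_abs_alloyPotential_le hα ha hM hf
  exact (intervalIntegral.integral_interval_sub_left
    (hθ.intervalIntegrable hVm hVb le_rfl ht) (hθ.intervalIntegrable hVm hVb le_rfl hm)).symm

end Alloy

/-! ### Phase differences controlled by the oscillatory integrals -/

/-- The difference of two phases is controlled by the free phase difference and the difference of
the oscillatory integrals. -/
theorem exists_norm_phaseExp_sub_le {M κmin : ℝ} (hκmin : 0 < κmin) (hM0 : 0 ≤ M) :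
    ∃ K : ℝ, 0 < K ∧ ∀ (V : ℝ → ℝ) (κ₁ κ₂ t : ℝ), AEStronglyMeasurable V volume →
      (∀ᵐ t, |V t| ≤ M) → κmin ≤ κ₁ → κmin ≤ κ₂ → 0 ≤ t →
      ‖phaseExp (pruferPhase V κ₁ t) - phaseExp (pruferPhase V κ₂ t)‖ ≤
        K * (|κ₁ - κ₂| * t + ‖oscillatoryJ V κ₁ 0 t - oscillatoryJ V κ₂ 0 t‖) := by
  set c := 1 / κmin + 1 / κmin ^ 2 with hc
  have hc0 : 0 < c := by positivity
  have hκc : 1 / κmin ≤ c := by rw [hc]; have : 0 < 1 / κmin ^ 2 := by positivity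
                                linarith
  refine ⟨2 * (1 + 2 * M * c + c), by positivity, ?_⟩
  intro V κ₁ κ₂ t hVm hVb h₁ h₂ ht
  have h10 : 0 < κ₁ := hκmin.trans_le h₁
  have h20 : 0 < κ₂ := hκmin.trans_le h₂
  -- `cos (2θ) V` is the real part of the integrand of `J`. The remaining term `∫ V` is common to
  -- both momenta, so only the prefactors `1 / (2κ)` and the integrals `J` can differ.
  have key : ∀ κ, 0 < κ → pruferPhase V κ t = κ * t +
      1 / (2 * κ) * ((oscillatoryJ V κ 0 t).re - ∫ s in (0 : ℝ)..t, V s) := fun κ hκ => by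
    have hθ := isPruferPhase_pruferPhase hκ hVm hVb
    rw [hθ.integral_eq hκ hVm hVb ht]
    congr 2
    have hi := intervalIntegrable_of_ae_bdd hVm hVb 0 t
    have hcos : ContinuousOn (fun s => Real.cos (2 * pruferPhase V κ s)) (uIcc 0 t) := by
      have := hθ.continuousOn.mono (fun u (hu : u ∈ uIcc 0 t) => (le_min le_rfl ht).trans hu.1)
      fun_prop
    have hre : (oscillatoryJ V κ 0 t).re =
        ∫ s in (0 : ℝ)..t, Real.cos (2 * pruferPhase V κ s) * V s := by
      have hi2 := hθ.intervalIntegrable hVm hVb le_rfl ht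
      change (∫ s in (0 : ℝ)..t, phaseExp (pruferPhase V κ s) * (V s : ℂ)).re = _
      have h4 := Complex.reCLM.intervalIntegral_comp_comm hi2
      simp only [Complex.reCLM_apply] at h4
      rw [← h4]
      refine intervalIntegral.integral_congr fun s _ => ?_
      simp [phaseExp_re]
    rw [hre, ← intervalIntegral.integral_sub (hi.continuousOn_mul hcos) hi]
    refine intervalIntegral.integral_congr fun s _ => ?_
    ring
  refine (norm_phaseExp_sub_le _ _).trans ?_
  rw [key κ₁ h10, key κ₂ h20]
  have hre : |(oscillatoryJ V κ₁ 0 t).re - (oscillatoryJ V κ₂ 0 t).re| ≤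
      ‖oscillatoryJ V κ₁ 0 t - oscillatoryJ V κ₂ 0 t‖ := by
    rw [← Complex.sub_re]; exact Complex.abs_re_le_norm _
  have hJ2 : |(oscillatoryJ V κ₂ 0 t).re| ≤ M * t := by
    refine (Complex.abs_re_le_norm _).trans ?_
    have := intervalIntegral.norm_integral_le_of_norm_le_const_ae (a := 0) (b := t) (C := M)
      (f := fun u => phaseExp (pruferPhase V κ₂ u) * (V u : ℂ)) (by
        filter_upwards [hVb] with u hu _
        rwa [norm_mul, norm_phaseExp, one_mul, Complex.norm_real])
    rw [sub_zero, abs_of_nonneg ht] at this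
    exact this
  have hU : |∫ s in (0 : ℝ)..t, V s| ≤ M * t := by
    have := intervalIntegral.norm_integral_le_of_norm_le_const_ae (a := 0) (b := t) (C := M)
      (f := V) (by filter_upwards [hVb] with u hu _ using hu)
    rwa [sub_zero, abs_of_nonneg ht] at this
  have hk := abs_inv_sub_inv_le hκmin h₁ h₂
  have hk' : |1 / (2 * κ₁) - 1 / (2 * κ₂)| ≤ c * |κ₁ - κ₂| :=
    hk.trans (by gcongr; exact min_le_right _ _)
  have hk1 : 1 / (2 * κ₁) ≤ c := hκc.trans' (by gcongr; linarith)
  generalize (oscillatoryJ V κ₁ 0 t).re = a₁ at *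
  generalize (oscillatoryJ V κ₂ 0 t).re = a₂ at *
  generalize ‖oscillatoryJ V κ₁ 0 t - oscillatoryJ V κ₂ 0 t‖ = dJ at *
  generalize (∫ s in (0 : ℝ)..t, V s) = U at *
  have hdJ : 0 ≤ dJ := (abs_nonneg _).trans hre
  have e : κ₁ * t + 1 / (2 * κ₁) * (a₁ - U) - (κ₂ * t + 1 / (2 * κ₂) * (a₂ - U)) =
    (κ₁ - κ₂) * t + (1 / (2 * κ₁) - 1 / (2 * κ₂)) * (a₂ - U) + 1 / (2 * κ₁) * (a₁ - a₂) := by ring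
  rw [e]
  have h3 : |a₂ - U| ≤ 2 * M * t := (abs_sub _ _).trans (by linarith)
  have h4 : |(κ₁ - κ₂) * t + (1 / (2 * κ₁) - 1 / (2 * κ₂)) * (a₂ - U) + 1 / (2 * κ₁) * (a₁ - a₂)| ≤
      |κ₁ - κ₂| * t + c * |κ₁ - κ₂| * (2 * M * t) + c * dJ := by
    refine (abs_add_three _ _ _).trans ?_
    rw [abs_mul, abs_mul, abs_mul, abs_of_nonneg ht, abs_of_pos (by positivity : 0 < 1 / (2 * κ₁))]
    gcongr
  have q1 : 0 ≤ c * (|κ₁ - κ₂| * t) := by positivity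
  have q2 : 0 ≤ M * c * dJ := by positivity
  nlinarith

/-! ### Doob's maximal inequality for complex martingale sums -/

section Doob

/-- The trajectorial form of Doob's maximal inequality. -/
theorem partialSups_sq_le {s : ℕ → ℝ} (n : ℕ) :
    partialSups s n ^ 2 ≤ 4 * s n ^ 2 -
      4 * ∑ i ∈ Finset.range n, partialSups s i * (s (i + 1) - s i) := by
  -- Discrete integration by parts: the running maximum changes only when it becomes equal to `s`.
  -- The claim then follows from `4 s² - 4 m s + 2 m² = (m - 2 s)² + m²`.
  have key : ∑ i ∈ Finset.range n, partialSups s i * (s (i + 1) - s i) ≤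
      partialSups s n * s n - partialSups s n ^ 2 / 2 := by
    induction n with
    | zero => simp only [Finset.range_zero, Finset.sum_empty, partialSups_zero]; nlinarith [sq_nonneg (s 0)]
    | succ n ih =>
      rw [Finset.sum_range_succ]
      have hsucc : partialSups s (n + 1) = max (partialSups s n) (s (n + 1)) := by
        simp
      rcases le_total (partialSups s n) (s (n + 1)) with h | h
      · rw [hsucc, max_eq_right h]
        nlinarith [sq_nonneg (s (n + 1) - partialSups s n)]
      · rw [hsucc, max_eq_left h]
        nlinarith
  nlinarith [sq_nonneg (partialSups s n - 2 * s n)]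

variable {Ω : Type*} {mΩ : MeasurableSpace Ω}

theorem integrable_of_bdd {E : Type*} [NormedAddCommGroup E] {P : Measure Ω} [IsFiniteMeasure P]
    {g : Ω → E} (hg : StronglyMeasurable g) (hb : ∃ B : ℝ, ∀ x, ‖g x‖ ≤ B) : Integrable g P := by
  obtain ⟨B, hB⟩ := hb
  exact Integrable.of_bound hg.aestronglyMeasurable B (Filter.Eventually.of_forall hB)

/-- Bounded complex martingale differences: `D j` is `G (j + 1)`-measurable and orthogonal to the
bounded `G j`-measurable functions. -/
structure IsBoundedMartingaleDifference (P : Measure Ω) (G : Filtration ℕ mΩ) (D : ℕ → Ω → ℂ) :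
    Prop where
  measurable : ∀ j, StronglyMeasurable[G (j + 1)] (D j)
  bounded : ∀ j, ∃ B : ℝ, ∀ x, ‖D j x‖ ≤ B
  orthogonal : ∀ j (g : Ω → ℂ), StronglyMeasurable[G j] g → (∃ B : ℝ, ∀ x, ‖g x‖ ≤ B) →
    ∫ x, g x * D j x ∂P = 0

namespace IsBoundedMartingaleDifference

variable {P : Measure Ω} {G : Filtration ℕ mΩ} {D : ℕ → Ω → ℂ}

theorem stronglyMeasurable_sum (h : IsBoundedMartingaleDifference P G D) (n : ℕ) :
    StronglyMeasurable[G n] (fun x => ∑ j ∈ Finset.range n, D j x) :=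
  Finset.stronglyMeasurable_fun_sum _ fun j hj =>
    (h.measurable j).mono (G.mono (Finset.mem_range.mp hj))

theorem bounded_sum (h : IsBoundedMartingaleDifference P G D) (n : ℕ) :
    ∃ B : ℝ, ∀ x, ‖∑ j ∈ Finset.range n, D j x‖ ≤ B := by
  choose B hB using h.bounded
  exact ⟨∑ j ∈ Finset.range n, B j, fun x =>
    (norm_sum_le _ _).trans (Finset.sum_le_sum fun j _ => hB j x)⟩

/-- The conjugate of the partial sum is an admissible test function against the next increment, so
the cross terms vanish. -/
theorem integral_norm_sum_sq [IsFiniteMeasure P] (h : IsBoundedMartingaleDifference P G D)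
    (n : ℕ) : ∫ x, ‖∑ j ∈ Finset.range n, D j x‖ ^ 2 ∂P =
      ∑ j ∈ Finset.range n, ∫ x, ‖D j x‖ ^ 2 ∂P := by
  induction n with
  | zero => simp
  | succ n ih =>
    obtain ⟨B, hB⟩ := h.bounded_sum n
    obtain ⟨B', hB'⟩ := h.bounded n
    have hM := (h.stronglyMeasurable_sum n).mono (G.le n)
    have hD := (h.measurable n).mono (G.le (n + 1))
    let g : Ω → ℂ := fun x => (starRingEnd ℂ) (∑ j ∈ Finset.range n, D j x)
    have hg : StronglyMeasurable[G n] g :=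
      Complex.continuous_conj.comp_stronglyMeasurable (h.stronglyMeasurable_sum n)
    have hgb : ∀ x, ‖g x‖ ≤ B := fun x => by simpa only [g, RCLike.norm_conj] using hB x
    have horth := h.orthogonal n g hg ⟨B, hgb⟩
    have igD : Integrable (fun x => g x * D n x) P :=
      integrable_of_bdd ((hg.mono (G.le n)).mul hD) ⟨B * B', fun x => by
        rw [norm_mul]
        exact mul_le_mul (hgb x) (hB' x) (norm_nonneg _) ((norm_nonneg _).trans (hgb x))⟩
    have i1 : Integrable (fun x => ‖∑ j ∈ Finset.range n, D j x‖ ^ 2) P :=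
      integrable_of_bdd (hM.norm.pow 2) ⟨B ^ 2, fun x => by
        rw [norm_pow, norm_norm]; exact pow_le_pow_left₀ (norm_nonneg _) (hB x) 2⟩
    have i2 : Integrable (fun x => ‖D n x‖ ^ 2) P :=
      integrable_of_bdd (hD.norm.pow 2) ⟨B' ^ 2, fun x => by
        rw [norm_pow, norm_norm]; exact pow_le_pow_left₀ (norm_nonneg _) (hB' x) 2⟩
    have i3 : Integrable (fun x => 2 * (g x * D n x).re) P := igD.re.const_mul 2
    have hre : ∫ x, (g x * D n x).re ∂P = 0 := by
      have := integral_re (𝕜 := ℂ) igD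
      simp only [RCLike.re_to_complex] at this
      rw [this, horth, Complex.zero_re]
    have e : ∀ x, ‖∑ j ∈ Finset.range (n + 1), D j x‖ ^ 2 =
        ‖∑ j ∈ Finset.range n, D j x‖ ^ 2 + ‖D n x‖ ^ 2 + 2 * (g x * D n x).re := fun x => by
      rw [Finset.sum_range_succ, ← Complex.normSq_eq_norm_sq, ← Complex.normSq_eq_norm_sq,
        ← Complex.normSq_eq_norm_sq, Complex.normSq_add]
      simp only [g, Complex.mul_re, Complex.conj_re, Complex.conj_im]
      ring
    simp_rw [e]
    have i12 : Integrable (fun x => ‖∑ j ∈ Finset.range n, D j x‖ ^ 2 + ‖D n x‖ ^ 2) P := i1.add i2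
    rw [integral_add i12 i3, integral_add i1 i2, ih, integral_const_mul, hre,
      Finset.sum_range_succ]
    ring

theorem stronglyMeasurable_partialSups (h : IsBoundedMartingaleDifference P G D) (n : ℕ) :
    StronglyMeasurable[G n]
      (fun x => partialSups (fun k => ‖∑ j ∈ Finset.range k, D j x‖) n) := by
  induction n with
  | zero => simpa using stronglyMeasurable_const
  | succ n ih =>
    have hsucc : ∀ x, partialSups (fun k => ‖∑ j ∈ Finset.range k, D j x‖) (n + 1) =
        max (partialSups (fun k => ‖∑ j ∈ Finset.range k, D j x‖) n)
          ‖∑ j ∈ Finset.range (n + 1), D j x‖ := fun x => by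
      simp
    simp_rw [hsucc]
    exact continuous_max.comp_stronglyMeasurable
      ((ih.mono (G.mono n.le_succ)).prodMk (h.stronglyMeasurable_sum (n + 1)).norm)

theorem bounded_partialSups (h : IsBoundedMartingaleDifference P G D) (n : ℕ) :
    ∃ B : ℝ, ∀ x, |partialSups (fun k => ‖∑ j ∈ Finset.range k, D j x‖) n| ≤ B := by
  choose B hB using h.bounded
  refine ⟨∑ j ∈ Finset.range n, B j, fun x => ?_⟩
  have hnn : ∀ j, 0 ≤ B j := fun j => (norm_nonneg _).trans (hB j x)
  rw [abs_of_nonneg]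
  · refine partialSups_le _ _ _ fun k hk => ?_
    exact ((norm_sum_le _ _).trans (Finset.sum_le_sum fun j _ => hB j x)).trans
      (Finset.sum_le_sum_of_subset_of_nonneg (Finset.range_mono hk) fun j _ _ => hnn j)
  · exact (norm_nonneg _).trans
      (le_partialSups_of_le (fun k => ‖∑ j ∈ Finset.range k, D j x‖) (Nat.zero_le n))

/-- Doob's `L²` maximal inequality. -/
theorem integral_partialSups_sq_le [IsFiniteMeasure P] (h : IsBoundedMartingaleDifference P G D)
    (n : ℕ) : ∫ x, partialSups (fun k => ‖∑ j ∈ Finset.range k, D j x‖) n ^ 2 ∂P ≤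
      4 * ∑ j ∈ Finset.range n, ∫ x, ‖D j x‖ ^ 2 ∂P := by
  let S : ℕ → Ω → ℂ := fun k x => ∑ j ∈ Finset.range k, D j x
  let m : ℕ → Ω → ℝ := fun k x => partialSups (fun k => ‖S k x‖) k
  have hm : ∀ k, StronglyMeasurable[G k] (m k) := h.stronglyMeasurable_partialSups
  have hmb : ∀ k, ∃ B : ℝ, ∀ x, |m k x| ≤ B := h.bounded_partialSups
  have hSm : ∀ k, StronglyMeasurable[G k] (S k) := h.stronglyMeasurable_sum
  -- The running maximum times the conjugate direction of `S k` is known at time `k`. Since `‖S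
  -- (k+1)‖ - ‖S k‖` is at least the component of `D k` along that direction, the subtracted sum of
  -- the pathwise inequality is bounded below by terms of mean zero. Where `S k = 0` the inverse is
  -- 0 and the direction is taken to be 0.
  let g : ℕ → Ω → ℂ := fun k x =>
    (m k x : ℂ) * (starRingEnd ℂ (S k x) * ((‖S k x‖⁻¹ : ℝ) : ℂ))
  have hunit : ∀ k x, ‖starRingEnd ℂ (S k x) * ((‖S k x‖⁻¹ : ℝ) : ℂ)‖ ≤ 1 := fun k x => by
    rw [norm_mul, RCLike.norm_conj, Complex.norm_real, norm_inv, norm_norm]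
    exact mul_inv_le_one
  have hg : ∀ k, StronglyMeasurable[G k] (g k) := fun k => by
    refine (Complex.continuous_ofReal.comp_stronglyMeasurable (hm k)).mul
      ((Complex.continuous_conj.comp_stronglyMeasurable (hSm k)).mul
        (Complex.continuous_ofReal.comp_stronglyMeasurable ?_))
    exact (hSm k).norm.measurable.inv.stronglyMeasurable
  have hgb : ∀ k, ∃ B : ℝ, ∀ x, ‖g k x‖ ≤ B := fun k => by
    obtain ⟨B, hB⟩ := hmb k
    refine ⟨B, fun x => ?_⟩
    simp only [g]
    rw [norm_mul, Complex.norm_real, Real.norm_eq_abs]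
    exact (mul_le_of_le_one_right (abs_nonneg _) (hunit k x)).trans (hB x)
  have igD : ∀ k, Integrable (fun x => g k x * D k x) P := fun k => by
    obtain ⟨B, hB⟩ := hgb k
    obtain ⟨B', hB'⟩ := h.bounded k
    exact integrable_of_bdd (((hg k).mono (G.le k)).mul ((h.measurable k).mono (G.le _)))
      ⟨B * B', fun x => by
        rw [norm_mul]
        exact mul_le_mul (hB x) (hB' x) (norm_nonneg _) ((norm_nonneg _).trans (hB x))⟩
  have igDre : ∀ k, Integrable (fun x => (g k x * D k x).re) P := fun k => (igD k).re
  have hre : ∀ k, ∫ x, (g k x * D k x).re ∂P = 0 := fun k => by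
    have := integral_re (𝕜 := ℂ) (igD k)
    simp only [RCLike.re_to_complex] at this
    rw [this, h.orthogonal k (g k) (hg k) (hgb k), Complex.zero_re]
  have i1 : Integrable (fun x => m n x ^ 2) P := by
    obtain ⟨B, hB⟩ := hmb n
    exact integrable_of_bdd (((hm n).mono (G.le n)).pow 2) ⟨B ^ 2, fun x => by
      rw [norm_pow]; exact pow_le_pow_left₀ (norm_nonneg _) (hB x) 2⟩
  have i2 : Integrable (fun x => ‖S n x‖ ^ 2) P := by
    obtain ⟨B, hB⟩ := h.bounded_sum n
    exact integrable_of_bdd (((hSm n).mono (G.le n)).norm.pow 2) ⟨B ^ 2, fun x => by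
      rw [norm_pow, norm_norm]; exact pow_le_pow_left₀ (norm_nonneg _) (hB x) 2⟩
  have i3 : Integrable (fun x => ∑ k ∈ Finset.range n, (g k x * D k x).re) P :=
    integrable_finsetSum _ fun k _ => (igD k).re
  have hpath : ∀ x, m n x ^ 2 ≤
      4 * ‖S n x‖ ^ 2 - 4 * ∑ k ∈ Finset.range n, (g k x * D k x).re := fun x => by
    refine (partialSups_sq_le n).trans ?_
    gcongr with k _
    have hm0 : 0 ≤ m k x := (norm_nonneg _).trans (le_partialSups (fun k => ‖S k x‖) k)
    set u := starRingEnd ℂ (S k x) * ((‖S k x‖⁻¹ : ℝ) : ℂ) with hu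
    have e1 : (g k x * D k x).re = m k x * (u * D k x).re := by
      simp only [g, ← hu]
      rw [mul_assoc, Complex.re_ofReal_mul]
    have e2 : (u * S k x).re = ‖S k x‖ := by
      by_cases h0 : S k x = 0
      · simp [h0]
      · have hn : ‖S k x‖ ≠ 0 := norm_ne_zero_iff.mpr h0
        rw [hu, mul_right_comm, mul_comm (starRingEnd ℂ _), Complex.mul_conj,
          Complex.normSq_eq_norm_sq, ← Complex.ofReal_mul, Complex.ofReal_re]
        field_simp
    have e3 : (u * S (k + 1) x).re ≤ ‖S (k + 1) x‖ := by
      refine (Complex.re_le_norm _).trans ?_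
      rw [norm_mul]
      exact mul_le_of_le_one_left (norm_nonneg _) (hunit k x)
    have e4 : S (k + 1) x = S k x + D k x := Finset.sum_range_succ _ _
    rw [e1]
    refine mul_le_mul_of_nonneg_left ?_ hm0
    rw [e4, mul_add, Complex.add_re, e2] at e3
    rw [e4]
    linarith
  have := integral_mono i1 ((i2.const_mul 4).sub (i3.const_mul 4)) hpath
  refine this.trans_eq ?_
  rw [← h.integral_norm_sum_sq n]
  simp only [Pi.sub_apply]
  rw [integral_sub (i2.const_mul 4) (i3.const_mul 4), integral_const_mul, integral_const_mul,
    integral_finsetSum _ fun k _ => igDre k]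
  have hz : ∑ k ∈ Finset.range n, ∫ x, (g k x * D k x).re ∂P = 0 :=
    Finset.sum_eq_zero fun k _ => hre k
  rw [hz]
  simp [S]

end IsBoundedMartingaleDifference

end Doob

/-! ### Grönwall's argument in mean square -/

theorem add_four_sq_le (a b c d : ℝ) :
    (a + b + c + d) ^ 2 ≤ 4 * (a ^ 2 + b ^ 2 + c ^ 2 + d ^ 2) := by
  nlinarith [sq_nonneg (a - b), sq_nonneg (a - c), sq_nonneg (a - d), sq_nonneg (b - c),
    sq_nonneg (b - d), sq_nonneg (c - d)]

section SecondMoment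

variable {Ω : Type*} {mΩ : MeasurableSpace Ω}

/-- A Grönwall argument in mean square: a process `Δ` that is a bounded martingale transform of
`y` up to boundary terms and absolutely summable errors, where `y` is in turn controlled by `Δ` and
a deterministic sequence `w`, has a maximal function bounded in mean square by `w`. -/
theorem exists_maximal_bound (P : Measure Ω) [IsFiniteMeasure P] {K S : ℝ} (hK : 0 < K)
    (hS : 0 ≤ S) :
    ∃ C : ℝ, 0 < C ∧ ∀ (G : Filtration ℕ mΩ) (D : ℕ → Ω → ℂ) (β w : ℕ → ℝ) (W : ℝ) (N : ℕ)
      (y Δ : ℕ → Ω → ℝ), IsBoundedMartingaleDifference P G D → (∀ j, 0 ≤ β j) → β 0 ≤ 1 →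
      Antitone β → (∀ n, ∑ j ∈ Finset.range n, β j ^ 2 ≤ S) →
      (∀ n, ∑ j ∈ Finset.range n, β j ^ 2 * w j ^ 2 ≤ W) → w 0 ^ 2 ≤ W →
      (∀ j, StronglyMeasurable (y j)) → (∀ j, ∃ B : ℝ, ∀ x, ‖y j x‖ ≤ B) → (∀ j x, 0 ≤ y j x) →
      (∀ j x, 0 ≤ Δ j x) → (∀ j x, ‖D j x‖ ≤ K * β j * y j x) → (∀ j x, y (j + 1) x ≤ K * y j x) →
      (∀ x, y 0 x ≤ K * w 0) → (∀ j x, y j x ≤ K * (w j + Δ j x)) →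
      (∀ n x, n ≤ N → Δ n x ≤ ‖∑ j ∈ Finset.range n, D j x‖ + K * β n * y n x + K * β 0 * y 0 x +
        K * ∑ j ∈ Finset.range n, β j ^ 2 * y j x) →
      ∃ H : Ω → ℝ, Integrable H P ∧ (∀ x, 0 ≤ H x) ∧ (∀ n x, n ≤ N → Δ n x ^ 2 ≤ H x) ∧
        (∀ n x, n < N → β n ^ 2 * y n x ^ 2 ≤ H x) ∧ ∫ x, H x ∂P ≤ C * W := by
  set p : ℝ := P.real univ with hp
  have hp0 : 0 ≤ p := measureReal_nonneg
  -- The 4 comes from squaring four summands; `2 * K ^ 4` pays for the two boundary terms and `K ^ 2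
  -- * S` for the accumulated errors.
  set C₁ : ℝ := 4 * (1 + 2 * K ^ 4 + K ^ 2 * S) with hC₁
  have hC₁1 : 1 ≤ C₁ := by
    have h1 : 0 ≤ K ^ 4 := by positivity
    have h2 : 0 ≤ K ^ 2 * S := by positivity
    rw [hC₁]; linarith
  set c : ℝ := 2 * K ^ 2 * C₁ * (K ^ 2 + 1) with hc
  have hc0 : 0 ≤ c := by positivity
  set C₂ : ℝ := 2 * K ^ 2 * (1 + C₁ * S) * p * Real.exp (c * S) with hC₂
  have hC₂0 : 0 ≤ C₂ := by positivity
  refine ⟨C₁ * (4 * K ^ 2 * C₂ + p + C₂) + 1, by positivity, ?_⟩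
  intro G D β w W N y Δ hD hβ0 hβ1 hβa hβS hW hw0 hym hyb hy0 hΔ0 hDy hyy hyw hyΔ hΔ
  have hW0 : 0 ≤ W := (sq_nonneg _).trans hw0
  -- `Z` dominates the boundary and error terms path by path; its mean `A` also dominates the second
  -- moment of the martingale, so the recursion closes on `A`.
  let Z : ℕ → Ω → ℝ := fun n x => ∑ j ∈ Finset.range n, β j ^ 2 * y j x ^ 2
  let A : ℕ → ℝ := fun n => ∑ j ∈ Finset.range n, β j ^ 2 * ∫ x, y j x ^ 2 ∂P
  have iy : ∀ j, Integrable (fun x => y j x ^ 2) P := fun j => by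
    obtain ⟨B, hB⟩ := hyb j
    exact integrable_of_bdd ((hym j).pow 2) ⟨B ^ 2, fun x => by
      rw [norm_pow]; exact pow_le_pow_left₀ (norm_nonneg _) (hB x) 2⟩
  have iZ : ∀ n, Integrable (Z n) P := fun n => integrable_finsetSum _ fun j _ => (iy j).const_mul _
  have hZA : ∀ n, ∫ x, Z n x ∂P = A n := fun n => by
    simp only [Z, A]
    rw [integral_finsetSum _ fun j _ => (iy j).const_mul _]
    simp_rw [integral_const_mul]
  have hZ0 : ∀ n x, 0 ≤ Z n x := fun n x =>
    Finset.sum_nonneg fun j _ => by positivity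
  have hDA : ∀ n, ∑ j ∈ Finset.range n, ∫ x, ‖D j x‖ ^ 2 ∂P ≤ K ^ 2 * A n := fun n => by
    simp only [A]
    rw [Finset.mul_sum]
    refine Finset.sum_le_sum fun j _ => ?_
    rw [← mul_assoc, ← integral_const_mul]
    refine integral_mono_of_nonneg (Filter.Eventually.of_forall fun x => by positivity)
      ((iy j).const_mul _) (Filter.Eventually.of_forall fun x => ?_)
    calc ‖D j x‖ ^ 2 ≤ (K * β j * y j x) ^ 2 := pow_le_pow_left₀ (norm_nonneg _) (hDy j x) 2
      _ = _ := by ring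
  have iM : ∀ n, Integrable (fun x => ‖∑ j ∈ Finset.range n, D j x‖ ^ 2) P := fun n => by
    obtain ⟨B, hB⟩ := hD.bounded_sum n
    exact integrable_of_bdd (((hD.stronglyMeasurable_sum n).mono (G.le n)).norm.pow 2)
      ⟨B ^ 2, fun x => by
        rw [norm_pow, norm_norm]; exact pow_le_pow_left₀ (norm_nonneg _) (hB x) 2⟩
  -- The sum `Z n` stops before index `n`, so the boundary term at `n` is first moved back one step
  -- by `hyy`; at `n = 0` the initial bound by `w 0` serves instead.
  have hbdry : ∀ n x, (β n * y n x) ^ 2 ≤ K ^ 2 * (w 0 ^ 2 + Z n x) := fun n x => by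
    cases n with
    | zero =>
      have h1 : β 0 * y 0 x ≤ 1 * (K * w 0) :=
        mul_le_mul hβ1 (hyw x) (hy0 0 x) zero_le_one
      calc (β 0 * y 0 x) ^ 2 ≤ (1 * (K * w 0)) ^ 2 :=
            pow_le_pow_left₀ (mul_nonneg (hβ0 0) (hy0 0 x)) h1 2
        _ = K ^ 2 * (w 0 ^ 2 + 0) := by ring
        _ ≤ _ := by gcongr; exact hZ0 0 x
    | succ n =>
      have h1 : β (n + 1) * y (n + 1) x ≤ β n * (K * y n x) :=
        mul_le_mul (hβa n.le_succ) (hyy n x) (hy0 _ x) (hβ0 n)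
      have h2 : β n ^ 2 * y n x ^ 2 ≤ Z (n + 1) x :=
        Finset.single_le_sum (f := fun j => β j ^ 2 * y j x ^ 2) (fun j _ => by positivity)
          (Finset.self_mem_range_succ n)
      calc (β (n + 1) * y (n + 1) x) ^ 2 ≤ (β n * (K * y n x)) ^ 2 :=
            pow_le_pow_left₀ (mul_nonneg (hβ0 _) (hy0 _ x)) h1 2
        _ = K ^ 2 * (0 + β n ^ 2 * y n x ^ 2) := by ring
        _ ≤ _ := by gcongr; positivity
  -- Cauchy–Schwarz with the factors `β j` and `β j * y j`.
  have herr : ∀ n x, (∑ j ∈ Finset.range n, β j ^ 2 * y j x) ^ 2 ≤ S * Z n x := fun n x => by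
    have h1 := Finset.sum_mul_sq_le_sq_mul_sq (Finset.range n) β (fun j => β j * y j x)
    have e1 : ∀ j, β j * (β j * y j x) = β j ^ 2 * y j x := fun j => by ring
    have e2 : ∀ j, (β j * y j x) ^ 2 = β j ^ 2 * y j x ^ 2 := fun j => by ring
    simp_rw [e1, e2] at h1
    exact h1.trans (mul_le_mul_of_nonneg_right (hβS n) (hZ0 n x))
  have hΔsq : ∀ n x, n ≤ N → Δ n x ^ 2 ≤
      C₁ * (‖∑ j ∈ Finset.range n, D j x‖ ^ 2 + w 0 ^ 2 + Z n x) := fun n x hn => by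
    refine (pow_le_pow_left₀ (hΔ0 n x) (hΔ n x hn) 2).trans ((add_four_sq_le _ _ _ _).trans ?_)
    have h1 := hbdry n x
    have h2 := hbdry 0 x
    have h3 := herr n x
    have hz : Z 0 x = 0 := rfl
    rw [hz] at h2
    have q1 : (K * β n * y n x) ^ 2 ≤ K ^ 4 * (w 0 ^ 2 + Z n x) := by
      calc _ = K ^ 2 * (β n * y n x) ^ 2 := by ring
        _ ≤ K ^ 2 * (K ^ 2 * (w 0 ^ 2 + Z n x)) := by gcongr
        _ = _ := by ring
    have q2 : (K * β 0 * y 0 x) ^ 2 ≤ K ^ 4 * (w 0 ^ 2 + Z n x) := by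
      calc _ = K ^ 2 * (β 0 * y 0 x) ^ 2 := by ring
        _ ≤ K ^ 2 * (K ^ 2 * (w 0 ^ 2 + Z n x)) := by
            gcongr; exact h2.trans (by gcongr; exact hZ0 n x)
        _ = _ := by ring
    have q3 : (K * ∑ j ∈ Finset.range n, β j ^ 2 * y j x) ^ 2 ≤ K ^ 2 * (S * Z n x) := by
      rw [mul_pow]; gcongr
    have hz0 := hZ0 n x
    have r1 : 0 ≤ K ^ 4 * ‖∑ j ∈ Finset.range n, D j x‖ ^ 2 := by positivity
    have r2 : 0 ≤ K ^ 2 * S * ‖∑ j ∈ Finset.range n, D j x‖ ^ 2 := by positivity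
    have r3 : 0 ≤ K ^ 2 * S * w 0 ^ 2 := by positivity
    have r4 : 0 ≤ w 0 ^ 2 := sq_nonneg _
    rw [hC₁]
    linarith
  have hstep : ∀ n, n ≤ N → A (n + 1) ≤
      (1 + c * β n ^ 2) * A n + 2 * K ^ 2 * p * (β n ^ 2 * w n ^ 2 + C₁ * W * β n ^ 2) :=
    fun n hn => by
    have h1 : ∫ x, y n x ^ 2 ∂P ≤ ∫ x, (2 * K ^ 2 * (w n ^ 2 + C₁ * w 0 ^ 2) +
        2 * K ^ 2 * C₁ * (‖∑ j ∈ Finset.range n, D j x‖ ^ 2 + Z n x)) ∂P := by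
      refine integral_mono (iy n)
        ((integrable_const _).add (((iM n).add (iZ n)).const_mul _)) fun x => ?_
      have h2 := pow_le_pow_left₀ (hy0 n x) (hyΔ n x) 2
      have h3 := hΔsq n x hn
      have h4 : (K * (w n + Δ n x)) ^ 2 ≤ 2 * K ^ 2 * (w n ^ 2 + Δ n x ^ 2) := by
        nlinarith [mul_nonneg (sq_nonneg K) (sq_nonneg (w n - Δ n x))]
      calc y n x ^ 2 ≤ 2 * K ^ 2 * (w n ^ 2 + Δ n x ^ 2) := h2.trans h4
        _ ≤ 2 * K ^ 2 * (w n ^ 2 +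
            C₁ * (‖∑ j ∈ Finset.range n, D j x‖ ^ 2 + w 0 ^ 2 + Z n x)) := by gcongr
        _ = _ := by ring
    have iMZ : Integrable (fun x => ‖∑ j ∈ Finset.range n, D j x‖ ^ 2 + Z n x) P :=
      (iM n).add (iZ n)
    rw [integral_add (integrable_const _) (iMZ.const_mul _), integral_const, integral_const_mul,
      integral_add (iM n) (iZ n), hZA, hD.integral_norm_sum_sq, smul_eq_mul, ← hp] at h1
    have h5 : ∫ x, y n x ^ 2 ∂P ≤ p * (2 * K ^ 2 * (w n ^ 2 + C₁ * W)) + c * A n := by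
      refine h1.trans ?_
      have : 2 * K ^ 2 * C₁ * (K ^ 2 * A n + A n) = c * A n := by rw [hc]; ring
      rw [← this]
      gcongr
      exact hDA n
    have e : A (n + 1) = A n + β n ^ 2 * ∫ x, y n x ^ 2 ∂P := Finset.sum_range_succ _ _
    rw [e]
    calc _ ≤ A n + β n ^ 2 * (p * (2 * K ^ 2 * (w n ^ 2 + C₁ * W)) + c * A n) := by gcongr
      _ = _ := by ring
  have hAN : A N ≤ C₂ * W := by
    have hb0 : ∀ k, 0 ≤ 2 * K ^ 2 * p * (β k ^ 2 * w k ^ 2 + C₁ * W * β k ^ 2) := fun k => by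
      positivity
    have hA0 : ∀ n, 0 ≤ A n := fun n => by rw [← hZA]; exact integral_nonneg (hZ0 n)
    -- The recursion is available only up to `N`, so the sequence is frozen from there on.
    have h1 := discrete_gronwall (u := fun n => A (min n N)) (n₀ := 0)
      (c := fun n => c * β n ^ 2)
      (b := fun k => 2 * K ^ 2 * p * (β k ^ 2 * w k ^ 2 + C₁ * W * β k ^ 2)) (hA0 _)
      (fun n _ => by
        rcases Nat.lt_or_ge n N with h | h
        · rw [min_eq_left h, min_eq_left h.le]
          exact hstep n h.le
        · rw [min_eq_right h, min_eq_right (h.trans n.le_succ)]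
          have := mul_nonneg (mul_nonneg hc0 (sq_nonneg (β n))) (hA0 N)
          linarith [hb0 n]) (fun n _ => by positivity) (fun n _ => hb0 n) (Nat.zero_le N)
    simp only [min_self, Nat.zero_min, Nat.Ico_zero_eq_range] at h1
    have hz : A 0 = 0 := rfl
    rw [hz, zero_add, ← Finset.mul_sum, ← Finset.mul_sum, Finset.sum_add_distrib,
      ← Finset.mul_sum] at h1
    refine h1.trans ?_
    calc _ ≤ 2 * K ^ 2 * p * (W + C₁ * W * S) * Real.exp (c * S) := by
          gcongr
          · exact hW N
          · exact hβS N
          · exact hβS N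
      _ = _ := by rw [hC₂]; ring
  have hdoob := hD.integral_partialSups_sq_le N
  have iSup : Integrable
      (fun x => partialSups (fun k => ‖∑ j ∈ Finset.range k, D j x‖) N ^ 2) P := by
    obtain ⟨B, hB⟩ := hD.bounded_partialSups N
    exact integrable_of_bdd (((hD.stronglyMeasurable_partialSups N).mono (G.le N)).pow 2)
      ⟨B ^ 2, fun x => by rw [norm_pow]; exact pow_le_pow_left₀ (norm_nonneg _) (hB x) 2⟩
  have hZmono : ∀ n x, n ≤ N → Z n x ≤ Z N x := fun n x hn =>
    Finset.sum_le_sum_of_subset_of_nonneg (Finset.range_mono hn) fun j _ _ => by positivity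
  have iS : Integrable
      (fun x => partialSups (fun k => ‖∑ j ∈ Finset.range k, D j x‖) N ^ 2 + W) P :=
    iSup.add (integrable_const _)
  refine ⟨fun x => C₁ * (partialSups (fun k => ‖∑ j ∈ Finset.range k, D j x‖) N ^ 2 + W + Z N x),
    (iS.add (iZ N)).const_mul _, fun x => ?_, fun n x hn => ?_, fun n x hn => ?_, ?_⟩
  · have := hZ0 N x
    positivity
  · have h1 : ‖∑ j ∈ Finset.range n, D j x‖ ≤
        partialSups (fun k => ‖∑ j ∈ Finset.range k, D j x‖) N :=
      le_partialSups_of_le (fun k => ‖∑ j ∈ Finset.range k, D j x‖) hn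
    exact (hΔsq n x hn).trans (mul_le_mul_of_nonneg_left (add_le_add
      (add_le_add (pow_le_pow_left₀ (norm_nonneg _) h1 2) hw0) (hZmono n x hn)) (by linarith))
  · have h2 : β n ^ 2 * y n x ^ 2 ≤ Z N x :=
      Finset.single_le_sum (f := fun j => β j ^ 2 * y j x ^ 2) (fun j _ => by positivity)
        (Finset.mem_range.mpr hn)
    have h3 : 0 ≤ partialSups (fun k => ‖∑ j ∈ Finset.range k, D j x‖) N ^ 2 := sq_nonneg _
    nlinarith [hZ0 N x]
  · rw [integral_const_mul, integral_add iS (iZ N), integral_add iSup (integrable_const _),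
      integral_const, smul_eq_mul, ← hp, hZA]
    have h4 : ∫ x, partialSups (fun k => ‖∑ j ∈ Finset.range k, D j x‖) N ^ 2 ∂P ≤
        4 * (K ^ 2 * (C₂ * W)) := hdoob.trans (by gcongr; exact (hDA N).trans (by gcongr))
    calc _ ≤ C₁ * (4 * (K ^ 2 * (C₂ * W)) + p * W + C₂ * W) := by gcongr
      _ ≤ _ := by nlinarith

/-- A version of the conditional expectation that satisfies a given bound everywhere. -/
theorem exists_bounded_condExp {P : Measure Ω} [IsFiniteMeasure P] {m : MeasurableSpace Ω}
    (hm : m ≤ mΩ) {X : Ω → ℝ} (hX : Integrable X P) {B : ℝ} (hB0 : 0 ≤ B)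
    (hB : ∀ᵐ x ∂P, |(P[X | m]) x| ≤ B) :
    ∃ c : Ω → ℝ, StronglyMeasurable[m] c ∧ (∀ x, |c x| ≤ B) ∧
      ∀ g : Ω → ℂ, StronglyMeasurable[m] g → (∃ B' : ℝ, ∀ x, ‖g x‖ ≤ B') →
        ∫ x, g x * (c x : ℂ) ∂P = ∫ x, g x * (X x : ℂ) ∂P := by
  -- Truncation to `[-B, B]` preserves measurability and changes the conditional expectation only on
  -- a null set.
  refine ⟨fun x => max (-B) (min B ((P[X | m]) x)), ?_, fun x => ?_, fun g hg hgb => ?_⟩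
  · exact (by fun_prop : Continuous fun t : ℝ => max (-B) (min B t)).comp_stronglyMeasurable
      stronglyMeasurable_condExp
  · rw [abs_le]
    exact ⟨le_max_left _ _, max_le (by linarith) (min_le_left _ _)⟩
  · obtain ⟨B', hB'⟩ := hgb
    let L : ℂ →L[ℝ] ℝ →L[ℝ] ℂ :=
      (ContinuousLinearMap.mul ℝ ℂ).flip.comp Complex.ofRealCLM |>.flip
    have hL : ∀ z r, L z r = z * (r : ℂ) := fun z r => by simp [L, mul_comm]
    have h1 := condExp_stronglyMeasurable_bilin_of_bound L hm hg hX B'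
      (Filter.Eventually.of_forall hB')
    simp only [hL] at h1
    rw [← integral_condExp hm (f := fun x => g x * (X x : ℂ))]
    refine integral_congr_ae ?_
    filter_upwards [h1, hB] with x hx hxB
    rw [hx, min_eq_right (abs_le.mp hxB).2, max_eq_right (abs_le.mp hxB).1]

end SecondMoment

/-! ### The martingale decomposition by predicted amplitudes -/

theorem norm_mul_mul_sub_le {a₁ a₂ b₁ b₂ c₁ c₂ : ℂ} {A A' B B' C C' : ℝ} (ha₂ : ‖a₂‖ ≤ A)
    (ha : ‖a₁ - a₂‖ ≤ A') (hb₁ : ‖b₁‖ ≤ B) (hb₂ : ‖b₂‖ ≤ B) (hb : ‖b₁ - b₂‖ ≤ B')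
    (hc₁ : ‖c₁‖ ≤ C) (hc : ‖c₁ - c₂‖ ≤ C') :
    ‖a₁ * b₁ * c₁ - a₂ * b₂ * c₂‖ ≤ A' * B * C + A * B' * C + A * B * C' := by
  have e : a₁ * b₁ * c₁ - a₂ * b₂ * c₂ =
    (a₁ - a₂) * b₁ * c₁ + a₂ * (b₁ - b₂) * c₁ + a₂ * b₂ * (c₁ - c₂) := by ring
  have hA := (norm_nonneg _).trans ha₂
  have hA' := (norm_nonneg _).trans ha
  have hB := (norm_nonneg _).trans hb₁
  have hB' := (norm_nonneg _).trans hb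
  rw [e]
  refine norm_add₃_le.trans ?_
  simp only [norm_mul]
  gcongr

/-- The linear growth allowed for `e` accommodates `e^{2iκ₁i} - e^{2iκ₂i}`, whose bound grows with
`i`; geometric decay of the predictions still makes the sum converge. -/
theorem exists_geometric_bound {q : ℝ} (h0 : 0 ≤ q) (h1 : q < 1) :
    ∃ Q : ℝ, 0 ≤ Q ∧ ∀ (n : ℕ) (B E : ℝ) (e c : ℕ → ℂ), 0 ≤ B → 0 ≤ E →
      (∀ i, ‖e i‖ ≤ E * (i + 1)) → (∀ i, ‖c i‖ ≤ B * q ^ i) →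
      ‖∑ i ∈ Finset.range n, e i * c i‖ ≤ E * B * Q := by
  have hs : Summable fun i : ℕ => ((i : ℝ) + 1) * q ^ i := by
    have s1 := summable_pow_mul_geometric_of_norm_lt_one (R := ℝ) 1
      (by rwa [Real.norm_of_nonneg h0] : ‖q‖ < 1)
    refine (s1.add (summable_geometric_of_lt_one h0 h1)).congr fun i => ?_
    ring
  refine ⟨∑' i : ℕ, ((i : ℝ) + 1) * q ^ i, tsum_nonneg fun i => by positivity, ?_⟩
  intro n B E e c hB hE he hc
  refine (norm_sum_le _ _).trans ?_
  calc ∑ i ∈ Finset.range n, ‖e i * c i‖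
      ≤ ∑ i ∈ Finset.range n, E * B * (((i : ℝ) + 1) * q ^ i) := by
        refine Finset.sum_le_sum fun i _ => ?_
        rw [norm_mul]
        calc _ ≤ (E * (i + 1)) * (B * q ^ i) :=
              mul_le_mul (he i) (hc i) (norm_nonneg _) (by positivity)
          _ = _ := by ring
    _ = E * B * ∑ i ∈ Finset.range n, ((i : ℝ) + 1) * q ^ i := by rw [Finset.mul_sum]
    _ ≤ _ := by
        gcongr
        exact hs.sum_le_tsum _ fun i _ => by positivity

section Corrector

variable {Ω : Type*} {mΩ : MeasurableSpace Ω}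

/-- The sum of the predicted amplitudes `c k l`, `j ≤ l < N`, along the free phase. -/
noncomputable def phaseCorrector (c : ℕ → ℕ → Ω → ℝ) (κ : ℝ) (N k j : ℕ) (x : Ω) : ℂ :=
  ∑ i ∈ Finset.range (N - j), phaseExp (κ * i) * (c k (j + i) x : ℂ)

/-- Peeling off the first summand exhibits the amplitude at `j`, already known at stage `j + 1`, as
a discrete derivative of the corrector along the free rotation. -/
theorem phaseCorrector_succ {c : ℕ → ℕ → Ω → ℝ} {κ : ℝ} {N j : ℕ} (hj : j < N) (x : Ω) :
    phaseCorrector c κ N (j + 1) j x =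
      c (j + 1) j x + phaseExp κ * phaseCorrector c κ N (j + 1) (j + 1) x := by
  have hN : N - j = (N - (j + 1)) + 1 := by omega
  rw [phaseCorrector, hN, Finset.sum_range_succ', phaseCorrector, Finset.mul_sum]
  simp only [Nat.cast_zero, mul_zero, phaseExp_zero, one_mul, add_zero]
  rw [add_comm]
  congr 1
  refine Finset.sum_congr rfl fun i _ => ?_
  rw [← mul_assoc, ← phaseExp_add]
  congr 2
  · push_cast; ring_nf
  · rw [show j + (i + 1) = j + 1 + i by ring]

/-- Since `β` decreases, all predictions from `j` on are at most `β j` times a geometric factor. The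
bound is uniform in the cutoff `N`. -/
theorem exists_phaseCorrector_bound {K q : ℝ} (hK : 0 ≤ K) (h0 : 0 ≤ q) (h1 : q < 1) :
    ∃ Q : ℝ, 0 ≤ Q ∧ ∀ (c : ℕ → ℕ → Ω → ℝ) (β : ℕ → ℝ) (κ₁ κ₂ : ℝ) (N k j : ℕ),
      (∀ j, 0 ≤ β j) → Antitone β →
      (∀ k l x, k ≤ l + 1 → |c k l x| ≤ K * β l * q ^ (l + 1 - k)) → k ≤ j + 1 → ∀ x,
      ‖phaseCorrector c κ₁ N k j x‖ ≤ Q * β j ∧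
      ‖phaseCorrector c κ₁ N k j x - phaseCorrector c κ₂ N k j x‖ ≤
        2 * min 1 |κ₁ - κ₂| * (Q * β j) := by
  obtain ⟨Q, hQ0, hQ⟩ := exists_geometric_bound h0 h1
  refine ⟨K * Q, by positivity, fun c β κ₁ κ₂ N k j hβ0 hβa hc hk x => ?_⟩
  have hb : ∀ i : ℕ, ‖((c k (j + i) x : ℝ) : ℂ)‖ ≤ K * β j * q ^ i := fun i => by
    rw [Complex.norm_real, Real.norm_eq_abs]
    refine (hc k (j + i) x (by omega)).trans ?_
    have e1 : β (j + i) ≤ β j := hβa (Nat.le_add_right j i)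
    have e2 : q ^ (j + i + 1 - k) ≤ q ^ i := pow_le_pow_of_le_one h0 h1.le (by omega)
    have := hβ0 j
    gcongr
  have hB : 0 ≤ K * β j := mul_nonneg hK (hβ0 j)
  constructor
  · refine (hQ (N - j) (K * β j) 1 (fun i => phaseExp (κ₁ * i)) _ hB zero_le_one (fun i => ?_)
      hb).trans_eq (by ring)
    rw [norm_phaseExp, one_mul]
    linarith [(Nat.cast_nonneg i : (0 : ℝ) ≤ i)]
  · rw [phaseCorrector, phaseCorrector, ← Finset.sum_sub_distrib]
    simp_rw [← sub_mul]
    refine (hQ (N - j) (K * β j) (2 * min 1 |κ₁ - κ₂|)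
      (fun i => phaseExp (κ₁ * i) - phaseExp (κ₂ * i)) _ hB (by positivity) (fun i => ?_)
      hb).trans_eq (by ring)
    refine (norm_phaseExp_mul_nat_sub_le κ₁ κ₂ i).trans ?_
    have : 0 ≤ min 1 |κ₁ - κ₂| := by positivity
    nlinarith

/-- The mean square maximal estimate for the difference of two discrete oscillatory sums whose
phases are driven by amplitudes with exponentially decaying conditional expectations `c`. -/
theorem exists_discrete_bound (P : Measure Ω) [IsFiniteMeasure P] {K S q : ℝ} (hK : 0 < K)
    (hS : 0 ≤ S) (hq0 : 0 ≤ q) (hq1 : q < 1) :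
    ∃ C : ℝ, 0 < C ∧ ∀ (G : Filtration ℕ mΩ) (β w : ℕ → ℝ) (W : ℝ) (N : ℕ)
      (c : ℕ → ℕ → Ω → ℝ) (κ₁ κ₂ δ : ℝ) (F₁ F₂ : ℂ) (z₁ z₂ J₁ J₂ : ℕ → Ω → ℂ) (y : ℕ → Ω → ℝ),
      (∀ j, 0 ≤ β j) → β 0 ≤ 1 → Antitone β → (∀ n, ∑ j ∈ Finset.range n, β j ^ 2 ≤ S) →
      (∀ n, ∑ j ∈ Finset.range n, β j ^ 2 * w j ^ 2 ≤ W) → w 0 ^ 2 ≤ W →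
      δ = min 1 |κ₁ - κ₂| → (∀ j x, y j x = δ + ‖z₁ j x - z₂ j x‖) →
      (∀ k l, StronglyMeasurable[G k] (c k l)) →
      (∀ k l x, k ≤ l + 1 → |c k l x| ≤ K * β l * q ^ (l + 1 - k)) →
      (∀ k l, k ≤ l → ∀ g : Ω → ℂ, StronglyMeasurable[G k] g → (∃ B : ℝ, ∀ x, ‖g x‖ ≤ B) →
        ∫ x, g x * (c (k + 1) l x : ℂ) ∂P = ∫ x, g x * (c k l x : ℂ) ∂P) →
      ‖F₂‖ ≤ K → ‖F₁ - F₂‖ ≤ K * δ →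
      (∀ j, StronglyMeasurable[G j] (z₁ j)) → (∀ j, StronglyMeasurable[G j] (z₂ j)) →
      (∀ j x, ‖z₁ j x‖ = 1) → (∀ j x, ‖z₂ j x‖ = 1) → (∀ x, z₁ 0 x = z₂ 0 x) →
      (∀ j x, ‖z₁ (j + 1) x - phaseExp κ₁ * z₁ j x‖ ≤ K * β j) →
      (∀ j x, ‖(z₁ (j + 1) x - phaseExp κ₁ * z₁ j x) - (z₂ (j + 1) x - phaseExp κ₂ * z₂ j x)‖ ≤
        K * β j * y j x) →
      (∀ x, J₁ 0 x = J₂ 0 x) →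
      (∀ j x, ‖(J₁ (j + 1) x - J₁ j x - c (j + 1) j x * (F₁ * z₁ j x)) -
        (J₂ (j + 1) x - J₂ j x - c (j + 1) j x * (F₂ * z₂ j x))‖ ≤ K * β j ^ 2 * y j x) →
      (∀ j x, y j x ≤ K * (w j + ‖J₁ j x - J₂ j x‖)) → δ ≤ K * w 0 →
      ∃ H : Ω → ℝ, Integrable H P ∧ (∀ x, 0 ≤ H x) ∧
        (∀ n x, n ≤ N → ‖J₁ n x - J₂ n x‖ ^ 2 ≤ H x) ∧
        (∀ n x, n < N → β n ^ 2 * y n x ^ 2 ≤ H x) ∧ ∫ x, H x ∂P ≤ C * W := by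
  obtain ⟨Q, hQ0, hQ⟩ := exists_phaseCorrector_bound (Ω := Ω) hK.le hq0 hq1
  -- `8 * K * Q` covers the martingale increments and the boundary terms, `4 * K ^ 2 * Q + K` the
  -- errors, and `K + 3` the growth of `y` in one step.
  set K' : ℝ := 8 * K * Q + 4 * K ^ 2 * Q + K + 3 with hK'
  have r1 : 0 ≤ K * Q := by positivity
  have r2 : 0 ≤ K ^ 2 * Q := by positivity
  have hK'0 : 0 < K' := by positivity
  have hKK' : K ≤ K' := by rw [hK']; linarith
  obtain ⟨C, hC, hmain⟩ := exists_maximal_bound (mΩ := mΩ) P hK'0 hS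
  refine ⟨C, hC, ?_⟩
  intro G β w W N c κ₁ κ₂ δ F₁ F₂ z₁ z₂ J₁ J₂ y hβ0 hβ1 hβa hβS hW hw0 hδ hy hcm hcb hco hF₂ hF
    hz₁m hz₂m hz₁ hz₂ hz0 hR₁ hR hJ0 hJ hyJ hδw
  have hδ0 : 0 ≤ δ := by rw [hδ]; positivity
  have hδ1 : δ ≤ 1 := by rw [hδ]; exact min_le_left _ _
  have hδy : ∀ j x, δ ≤ y j x := fun j x => by rw [hy]; linarith [norm_nonneg (z₁ j x - z₂ j x)]
  have hzy : ∀ j x, ‖z₁ j x - z₂ j x‖ ≤ y j x := fun j x => by rw [hy]; linarith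
  have hy0 : ∀ j x, 0 ≤ y j x := fun j x => hδ0.trans (hδy j x)
  have hβle : ∀ j, β j ≤ 1 := fun j => (hβa (Nat.zero_le j)).trans hβ1
  let T : ℝ → ℕ → ℕ → Ω → ℂ := fun κ k j x => phaseCorrector c κ N k j x
  have hT : ∀ κ k j x, k ≤ j + 1 → ‖T κ k j x‖ ≤ Q * β j := fun κ k j x hk =>
    (hQ c β κ κ N k j hβ0 hβa hcb hk x).1
  have hTd : ∀ k j x, k ≤ j + 1 → ‖T κ₁ k j x - T κ₂ k j x‖ ≤ 2 * δ * (Q * β j) :=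
    fun k j x hk => by
      rw [hδ]; exact (hQ c β κ₁ κ₂ N k j hβ0 hβa hcb hk x).2
  -- Summation by parts against the corrector: `D` is the revision of the predictions between stages
  -- `j` and `j + 1`, `Bd` telescopes, and `Er` collects the failure of `z` to rotate freely and the
  -- error of the linearized increment of `J`.
  let D : ℕ → Ω → ℂ := fun j x => F₁ * (T κ₁ (j + 1) j x - T κ₁ j j x) * z₁ j x -
    F₂ * (T κ₂ (j + 1) j x - T κ₂ j j x) * z₂ j x
  let Bd : ℕ → Ω → ℂ := fun j x => F₁ * T κ₁ j j x * z₁ j x - F₂ * T κ₂ j j x * z₂ j x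
  let Er : ℕ → Ω → ℂ := fun j x =>
    (F₁ * T κ₁ (j + 1) (j + 1) x * (z₁ (j + 1) x - phaseExp κ₁ * z₁ j x) -
      F₂ * T κ₂ (j + 1) (j + 1) x * (z₂ (j + 1) x - phaseExp κ₂ * z₂ j x)) +
    ((J₁ (j + 1) x - J₁ j x - c (j + 1) j x * (F₁ * z₁ j x)) -
      (J₂ (j + 1) x - J₂ j x - c (j + 1) j x * (F₂ * z₂ j x)))
  have hD : ∀ j x, ‖D j x‖ ≤ K' * β j * y j x := fun j x => by
    have hU : ∀ κ, ‖T κ (j + 1) j x - T κ j j x‖ ≤ 2 * (Q * β j) := fun κ =>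
      (norm_sub_le _ _).trans (by linarith [hT κ (j + 1) j x le_rfl, hT κ j j x (by omega)])
    have hUd : ‖(T κ₁ (j + 1) j x - T κ₁ j j x) - (T κ₂ (j + 1) j x - T κ₂ j j x)‖ ≤
        4 * δ * (Q * β j) := by
      rw [sub_sub_sub_comm]
      exact (norm_sub_le _ _).trans
        (by linarith [hTd (j + 1) j x le_rfl, hTd j j x (by omega)])
    refine (norm_mul_mul_sub_le hF₂ hF (hU κ₁) (hU κ₂) hUd (hz₁ j x).le (hzy j x)).trans ?_
    have p1 : 0 ≤ K * Q * β j := mul_nonneg r1 (hβ0 j)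
    have p2 := mul_le_mul_of_nonneg_left (hδy j x) p1
    have p3 : 0 ≤ β j * y j x := mul_nonneg (hβ0 j) (hy0 j x)
    have p4 : 0 ≤ (4 * K ^ 2 * Q + K + 3) * (β j * y j x) := by positivity
    rw [hK']
    linarith
  have hBd : ∀ j x, ‖Bd j x‖ ≤ K' * β j * y j x := fun j x => by
    refine (norm_mul_mul_sub_le hF₂ hF (hT κ₁ j j x (by omega)) (hT κ₂ j j x (by omega))
      (hTd j j x (by omega)) (hz₁ j x).le (hzy j x)).trans ?_
    have p1 : 0 ≤ K * Q * β j := mul_nonneg r1 (hβ0 j)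
    have p2 := mul_le_mul_of_nonneg_left (hδy j x) p1
    have p3 : 0 ≤ β j * y j x := mul_nonneg (hβ0 j) (hy0 j x)
    have p4 : 0 ≤ (4 * K * Q + 4 * K ^ 2 * Q + K + 3) * (β j * y j x) := by positivity
    rw [hK']
    linarith
  have hEr : ∀ j x, ‖Er j x‖ ≤ K' * (β j ^ 2 * y j x) := fun j x => by
    have hs : Q * β (j + 1) ≤ Q * β j := mul_le_mul_of_nonneg_left (hβa j.le_succ) hQ0
    have hTd' := (hTd (j + 1) (j + 1) x (by omega)).trans
      (mul_le_mul_of_nonneg_left hs (by positivity))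
    refine (norm_add_le _ _).trans ((add_le_add (norm_mul_mul_sub_le hF₂ hF
      ((hT κ₁ (j + 1) (j + 1) x (by omega)).trans hs)
      ((hT κ₂ (j + 1) (j + 1) x (by omega)).trans hs) hTd' (hR₁ j x) (hR j x)) (hJ j x)).trans ?_)
    have p1 : 0 ≤ K ^ 2 * Q * β j ^ 2 := mul_nonneg r2 (sq_nonneg _)
    have p2 := mul_le_mul_of_nonneg_left (hδy j x) p1
    have p3 : 0 ≤ β j ^ 2 * y j x := mul_nonneg (sq_nonneg _) (hy0 j x)
    have p4 : 0 ≤ (8 * K * Q + 3) * (β j ^ 2 * y j x) := by positivity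
    rw [hK']
    linarith
  have hTm : ∀ κ k j, StronglyMeasurable[G k] (T κ k j) := fun κ k j =>
    Finset.stronglyMeasurable_fun_sum _ fun i _ =>
      stronglyMeasurable_const.mul (Complex.continuous_ofReal.comp_stronglyMeasurable (hcm k _))
  have hmart : IsBoundedMartingaleDifference P G D := by
    refine ⟨fun j => ?_, fun j => ⟨K' * β j * (δ + 2), fun x => (hD j x).trans ?_⟩,
      fun j g hg hgb => ?_⟩
    · have hz₁' := (hz₁m j).mono (G.mono j.le_succ)
      have hz₂' := (hz₂m j).mono (G.mono j.le_succ)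
      exact ((((hTm κ₁ (j + 1) j).sub ((hTm κ₁ j j).mono (G.mono j.le_succ))).const_mul
        F₁).mul hz₁').sub ((((hTm κ₂ (j + 1) j).sub
          ((hTm κ₂ j j).mono (G.mono j.le_succ))).const_mul F₂).mul hz₂')
    · have := hβ0 j
      gcongr
      rw [hy]
      gcongr
      exact (norm_sub_le _ _).trans (by rw [hz₁, hz₂]; norm_num)
    · obtain ⟨B, hB⟩ := hgb
      -- Orthogonality is checked for each prediction separately: all factors other than `c` are
      -- measurable at stage `j`, so `hco` applies with `h i` as test function.
      let h : ℕ → Ω → ℂ := fun i x =>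
        g x * (F₁ * phaseExp (κ₁ * i) * z₁ j x - F₂ * phaseExp (κ₂ * i) * z₂ j x)
      have hhm : ∀ i, StronglyMeasurable[G j] (h i) := fun i =>
        hg.mul (((hz₁m j).const_mul _).sub ((hz₂m j).const_mul _))
      have hhb : ∀ i x, ‖h i x‖ ≤ B * (‖F₁‖ + ‖F₂‖) := fun i x => by
        rw [norm_mul]
        refine mul_le_mul (hB x) ((norm_sub_le _ _).trans ?_) (norm_nonneg _)
          ((norm_nonneg _).trans (hB x))
        simp only [norm_mul, norm_phaseExp, hz₁, hz₂, mul_one]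
        exact le_rfl
      have ih : ∀ i k, k ≤ j + 1 → Integrable (fun x => h i x * (c k (j + i) x : ℂ)) P :=
        fun i k hk => integrable_of_bdd (((hhm i).mono (G.le j)).mul
          (Complex.continuous_ofReal.comp_stronglyMeasurable ((hcm k (j + i)).mono (G.le k))))
          ⟨B * (‖F₁‖ + ‖F₂‖) * (K * β (j + i) * q ^ (j + i + 1 - k)), fun x => by
            rw [norm_mul, Complex.norm_real, Real.norm_eq_abs]
            exact mul_le_mul (hhb i x) (hcb k (j + i) x (by omega)) (abs_nonneg _)
              ((norm_nonneg _).trans (hhb i x))⟩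
      have e : ∀ x, g x * D j x = ∑ i ∈ Finset.range (N - j),
          (h i x * (c (j + 1) (j + i) x : ℂ) - h i x * (c j (j + i) x : ℂ)) := fun x => by
        simp only [D, T, phaseCorrector, ← Finset.sum_sub_distrib, Finset.mul_sum, Finset.sum_mul]
        refine Finset.sum_congr rfl fun i _ => ?_
        simp only [h]; ring
      have ihd : ∀ i, Integrable (fun x => h i x * (c (j + 1) (j + i) x : ℂ) -
          h i x * (c j (j + i) x : ℂ)) P := fun i =>
        (ih i (j + 1) le_rfl).sub (ih i j (by omega))
      simp_rw [e]
      rw [integral_finsetSum _ fun i _ => ihd i]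
      refine Finset.sum_eq_zero fun i _ => ?_
      rw [integral_sub (ih i (j + 1) le_rfl) (ih i j (by omega)),
        hco j (j + i) (by omega) (h i) (hhm i) ⟨_, hhb i⟩, sub_self]
  have hdecomp : ∀ n x, n ≤ N → J₁ n x - J₂ n x =
      ∑ j ∈ Finset.range n, D j x + Bd 0 x - Bd n x + ∑ j ∈ Finset.range n, Er j x := by
    intro n x
    induction n with
    | zero => intro _; simp [hJ0 x]
    | succ n ih =>
      intro hn
      have e₁ := phaseCorrector_succ (c := c) (κ := κ₁) (N := N) (j := n) hn x
      have e₂ := phaseCorrector_succ (c := c) (κ := κ₂) (N := N) (j := n) hn x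
      rw [Finset.sum_range_succ, Finset.sum_range_succ]
      have ih' := ih (by omega)
      simp only [D, Bd, Er, T] at ih' ⊢
      rw [e₁, e₂]
      linear_combination ih'
  refine hmain G D β w W N y (fun n x => ‖J₁ n x - J₂ n x‖) hmart hβ0 hβ1 hβa hβS hW hw0
    (fun j => ?_) (fun j => ⟨δ + 2, fun x => ?_⟩) hy0 (fun j x => norm_nonneg _) hD
    (fun j x => ?_) (fun x => ?_) (fun j x => ?_) fun n x hn => ?_
  · have : y j = fun x => δ + ‖z₁ j x - z₂ j x‖ := funext (hy j)
    rw [this]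
    exact stronglyMeasurable_const.add
      (((hz₁m j).mono (G.le j)).sub ((hz₂m j).mono (G.le j))).norm
  · rw [Real.norm_of_nonneg (hy0 j x), hy]
    gcongr
    exact (norm_sub_le _ _).trans (by rw [hz₁, hz₂]; norm_num)
  · have e : z₁ (j + 1) x - z₂ (j + 1) x =
      ((z₁ (j + 1) x - phaseExp κ₁ * z₁ j x) - (z₂ (j + 1) x - phaseExp κ₂ * z₂ j x)) +
      (phaseExp κ₁ - phaseExp κ₂) * z₁ j x + phaseExp κ₂ * (z₁ j x - z₂ j x) := by ring
    have hk := norm_phaseExp_mul_sub_le (κ₁ := κ₁) (κ₂ := κ₂) zero_le_one le_rfl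
    rw [mul_one, mul_one, ← hδ] at hk
    have h3 : ‖z₁ (j + 1) x - z₂ (j + 1) x‖ ≤
        K * β j * y j x + 2 * δ + ‖z₁ j x - z₂ j x‖ := by
      rw [e]
      refine norm_add₃_le.trans ?_
      rw [norm_mul, norm_mul, hz₁, norm_phaseExp, mul_one, one_mul]
      exact add_le_add (add_le_add (hR j x) hk) le_rfl
    have h4 : K * β j * y j x ≤ K * 1 * y j x := by
      have := hy0 j x
      have := hβle j
      gcongr
    have h5 : 0 ≤ (8 * K * Q + 4 * K ^ 2 * Q) * y j x := mul_nonneg (by positivity) (hy0 j x)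
    rw [hy (j + 1), hK']
    linarith [hδy j x, hy j x]
  · rw [hy, hz0, sub_self, norm_zero, add_zero]
    have : 0 ≤ w 0 := by
      by_contra hneg
      push Not at hneg
      nlinarith
    exact hδw.trans (by gcongr)
  · exact (hyJ j x).trans (mul_le_mul_of_nonneg_right hKK' (by
      have := hyJ j x
      have h6 := hy0 j x
      by_contra hneg
      push Not at hneg
      nlinarith))
  · have h6 : ‖∑ j ∈ Finset.range n, Er j x‖ ≤
        K' * ∑ j ∈ Finset.range n, β j ^ 2 * y j x := by
      rw [Finset.mul_sum]
      exact (norm_sum_le _ _).trans (Finset.sum_le_sum fun j _ => hEr j x)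
    rw [hdecomp n x hn]
    have h7 : ‖∑ j ∈ Finset.range n, D j x + Bd 0 x - Bd n x + ∑ j ∈ Finset.range n, Er j x‖ ≤
        ‖∑ j ∈ Finset.range n, D j x‖ + ‖Bd 0 x‖ + ‖Bd n x‖ + ‖∑ j ∈ Finset.range n, Er j x‖ :=
      (norm_add_le _ _).trans (add_le_add ((norm_sub_le _ _).trans
        (add_le_add (norm_add_le _ _) le_rfl)) le_rfl)
    linarith [hBd 0 x, hBd n x]

end Corrector

/-! ### Pathwise estimates at two momenta -/

theorem MeasureTheory.MemLp.exists_ae_abs_le {f : ℝ → ℝ} (hf : MemLp f ⊤ volume) :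
    ∃ M : ℝ, ∀ᵐ t, |f t| ≤ M := by
  have h := hf.2
  rw [eLpNorm_exponent_top] at h
  refine ⟨(eLpNormEssSup f volume).toReal, ?_⟩
  filter_upwards [ae_le_eLpNormEssSup (f := f) (μ := volume)] with t ht
  have := ENNReal.toReal_mono h.ne ht
  rwa [toReal_enorm, Real.norm_eq_abs] at this

theorem le_rpow_of_le_one {u η : ℝ} (h0 : 0 ≤ u) (h1 : u ≤ 1) (hη0 : 0 < η) (hη1 : η ≤ 1) :
    u ≤ u ^ η := by
  rcases h0.eq_or_lt with rfl | h
  · rw [Real.zero_rpow hη0.ne']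
  · calc u = u ^ (1 : ℝ) := (Real.rpow_one u).symm
      _ ≤ u ^ η := Real.rpow_le_rpow_of_exponent_ge h h1 hη1

theorem min_one_le_rpow {u η : ℝ} (h0 : 0 ≤ u) (hη0 : 0 < η) (hη1 : η ≤ 1) :
    min 1 u ≤ u ^ η := by
  rcases le_total u 1 with h | h
  · exact (min_le_right _ _).trans (le_rpow_of_le_one h0 h hη0 hη1)
  · exact (min_le_left _ _).trans (Real.one_le_rpow h hη0.le)

/-- The path-by-path estimates on the phases and oscillatory integrals of an alloy potential at two
momenta. -/
theorem exists_alloy_bounds {f : ℝ → ℝ} {α M κmin : ℝ} (hfm : AEStronglyMeasurable f volume)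
    (hM : ∀ᵐ t, |f t| ≤ M) (hf : Function.support f ⊆ Icc 0 1) (hα : 0 ≤ α) (hκmin : 0 < κmin) :
    ∃ K : ℝ, 0 < K ∧ ∀ (a : ℕ → ℝ) (κ₁ κ₂ η : ℝ) (V : ℝ → ℝ) (z₁ z₂ J₁ J₂ : ℝ → ℂ) (y : ℕ → ℝ)
      (β : ℕ → ℝ), (∀ j, 1 ≤ j → |a j| ≤ 1) → κmin ≤ κ₁ → κmin ≤ κ₂ → 0 < η → η ≤ 1 →
      V = alloyPotential α f a → (z₁ = fun t => phaseExp (pruferPhase V κ₁ t)) →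
      (z₂ = fun t => phaseExp (pruferPhase V κ₂ t)) → J₁ = oscillatoryJ V κ₁ 0 →
      J₂ = oscillatoryJ V κ₂ 0 → (y = fun j : ℕ => min 1 |κ₁ - κ₂| + ‖z₁ j - z₂ j‖) →
      (β = fun j : ℕ => ((j : ℝ) + 1) ^ (-α)) → ∀ j : ℕ,
      ‖z₁ (j + 1 : ℕ) - phaseExp κ₁ * z₁ j‖ ≤ K * β j ∧
      ‖(z₁ (j + 1 : ℕ) - phaseExp κ₁ * z₁ j) - (z₂ (j + 1 : ℕ) - phaseExp κ₂ * z₂ j)‖ ≤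
        K * β j * y j ∧
      ‖(J₁ (j + 1 : ℕ) - J₁ j - alloyAmplitude α a j * (profileTransform f κ₁ * z₁ j)) -
        (J₂ (j + 1 : ℕ) - J₂ j - alloyAmplitude α a j * (profileTransform f κ₂ * z₂ j))‖ ≤
          K * β j ^ 2 * y j ∧
      (∀ s ∈ Icc (0 : ℝ) 1, ‖J₁ (j + s) - J₂ (j + s)‖ ≤ ‖J₁ j - J₂ j‖ + K * (β j * y j)) ∧
      y j ≤ K * (|κ₁ - κ₂| ^ η * ((j : ℝ) + 1) ^ η + ‖J₁ j - J₂ j‖) := by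
  have hM0 : 0 ≤ M := by
    obtain ⟨t, ht⟩ := hM.exists
    exact (abs_nonneg _).trans ht
  obtain ⟨K₁, hK₁, hincr⟩ := IsUnitPhase.exists_increment_bound hfm hM hκmin
  obtain ⟨K₂, hK₂, hphase⟩ := exists_norm_phaseExp_sub_le hκmin hM0
  set b : ℝ := 2 ^ α with hb
  have hb0 : 0 < b := by positivity
  refine ⟨2 * (M / κmin) * b + K₁ * b + K₁ * b ^ 2 + K₂ + 3, by positivity, ?_⟩
  intro a κ₁ κ₂ η V z₁ z₂ J₁ J₂ y β ha h₁ h₂ hη0 hη1 hV hz₁ hz₂ hJ₁ hJ₂ hy hβ j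
  set K := 2 * (M / κmin) * b + K₁ * b + K₁ * b ^ 2 + K₂ + 3 with hK
  have k1 : 0 ≤ 2 * (M / κmin) * b := by positivity
  have k2 : 0 ≤ K₁ * b := by positivity
  have k3 : 0 ≤ K₁ * b ^ 2 := by positivity
  have h10 : 0 < κ₁ := hκmin.trans_le h₁
  have h20 : 0 < κ₂ := hκmin.trans_le h₂
  have hx : |alloyAmplitude α a j| ≤ b * β j := by
    rw [hβ]; exact abs_alloyAmplitude_le hα ha j
  have hx1 := abs_alloyAmplitude_le_one hα ha j
  have hβ0 : 0 ≤ β j := by rw [hβ]; positivity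
  have hyj : y j = min 1 |κ₁ - κ₂| + ‖z₁ j - z₂ j‖ := by rw [hy]
  have hy0 : 0 ≤ y j := by rw [hyj]; positivity
  have u₁ := isUnitPhase_pruferPhase hfm hM hf hα ha h10 j
  have u₂ := isUnitPhase_pruferPhase hfm hM hf hα ha h20 j
  have v₁ := fun s hs => oscillatoryJ_add_sub hfm hM hf hα ha h10 j (s := s) hs
  have v₂ := fun s hs => oscillatoryJ_add_sub hfm hM hf hα ha h20 j (s := s) hs
  rw [← hV] at u₁ u₂
  simp only [← hV, ← hJ₁, ← hJ₂] at v₁ v₂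
  have e1 : ((j + 1 : ℕ) : ℝ) = (j : ℝ) + 1 := by push_cast; ring
  have e2 : ∀ s, phaseExp (pruferPhase V κ₁ s) = z₁ s := fun s => by rw [hz₁]
  have e3 : ∀ s, phaseExp (pruferPhase V κ₂ s) = z₂ s := fun s => by rw [hz₂]
  have h1m : (1 : ℝ) ∈ Icc (0 : ℝ) 1 := right_mem_Icc.mpr zero_le_one
  obtain ⟨hA, hB, hC⟩ := hincr κ₁ κ₂ (alloyAmplitude α a j) _ _ (y j) h₁ h₂ hx1 u₁ u₂
    (by simp only [add_zero, e2, e3, hyj])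
  have hC' : ∀ s ∈ Icc (0 : ℝ) 1,
      ‖(J₁ (j + s) - J₁ j) - (J₂ (j + s) - J₂ j)‖ ≤ K₁ * |alloyAmplitude α a j| * y j :=
    fun s hs => by
      rw [v₁ s hs, v₂ s hs]; exact hC s hs
  rw [← v₁ 1 h1m, ← v₂ 1 h1m] at hB
  simp only [add_zero, e2, e3] at hA hB
  rw [e1]
  refine ⟨?_, ?_, ?_, fun s hs => ?_, ?_⟩
  · have h3 := u₁.abs_sub_le hM hκmin h₁ h1m
    simp only [add_zero, mul_one] at h3
    have h4 : z₁ (j + 1) - phaseExp κ₁ * z₁ j = phaseExp κ₁ * z₁ j *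
        (phaseExp (pruferPhase V κ₁ (j + 1) - pruferPhase V κ₁ j - κ₁) - 1) := by
      rw [← e2, ← e2, mul_sub, ← phaseExp_add, ← phaseExp_add]; ring_nf
    rw [h4, norm_mul, norm_mul, ← e2, norm_phaseExp, norm_phaseExp, one_mul, one_mul]
    refine (norm_phaseExp_sub_one_le _).trans ?_
    calc _ ≤ 2 * (M / κmin * (b * β j)) := by
          gcongr; exact h3.trans (by gcongr)
      _ = 2 * (M / κmin) * b * β j := by ring
      _ ≤ _ := by gcongr; rw [hK]; linarith
  · refine hA.trans ?_
    calc _ ≤ K₁ * (b * β j) * y j := by gcongr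
      _ = K₁ * b * β j * y j := by ring
      _ ≤ _ := by gcongr; rw [hK]; linarith
  · refine hB.trans ?_
    calc _ ≤ K₁ * (b * β j) ^ 2 * y j := by gcongr
      _ = K₁ * b ^ 2 * β j ^ 2 * y j := by ring
      _ ≤ _ := by gcongr; rw [hK]; linarith
  · have h3 : J₁ (j + s) - J₂ (j + s) =
        (J₁ j - J₂ j) + ((J₁ (j + s) - J₁ j) - (J₂ (j + s) - J₂ j)) := by ring
    rw [h3]
    refine (norm_add_le _ _).trans (add_le_add le_rfl ((hC' s hs).trans ?_))
    calc _ ≤ K₁ * (b * β j) * y j := by gcongr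
      _ = K₁ * b * (β j * y j) := by ring
      _ ≤ _ := by gcongr; rw [hK]; linarith
  · set δ := |κ₁ - κ₂| with hδ
    have hδ0 : 0 ≤ δ := abs_nonneg _
    have hj0 : (0 : ℝ) ≤ j := Nat.cast_nonneg j
    have hVm : AEStronglyMeasurable V volume := hV ▸ aestronglyMeasurable_alloyPotential hfm hf
    have hVb : ∀ᵐ t, |V t| ≤ M := hV ▸ ae_abs_alloyPotential_le hα ha hM hf
    have h3 := hphase V κ₁ κ₂ j hVm hVb h₁ h₂ hj0
    rw [e2, e3, ← hJ₁, ← hJ₂] at h3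
    set w := δ ^ η * ((j : ℝ) + 1) ^ η with hw
    have hw1 : δ ^ η ≤ w :=
      le_mul_of_one_le_right (by positivity) (Real.one_le_rpow (by linarith) hη0.le)
    have hw2 : (δ * j) ^ η ≤ w := by
      rw [Real.mul_rpow hδ0 hj0, hw]
      gcongr
      linarith
    have h4 := (min_one_le_rpow hδ0 hη0 hη1).trans hw1
    have hw0 : 0 ≤ w := by positivity
    -- Interpolation between two bounds: for `δ j ≤ 1` the linear one is weakened to `(δ j)^η`; for
    -- `δ j ≥ 1` the trivial bound 2 suffices.
    have h5 : ‖z₁ j - z₂ j‖ ≤ (K₂ + 2) * (w + ‖J₁ j - J₂ j‖) := by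
      have hn := norm_nonneg (J₁ j - J₂ j)
      rcases le_total (δ * j) 1 with h | h
      · have h6 := (le_rpow_of_le_one (by positivity) h hη0 hη1).trans hw2
        refine h3.trans ?_
        calc _ ≤ K₂ * (w + ‖J₁ j - J₂ j‖) := by gcongr
          _ ≤ _ := by gcongr; linarith
      · have h6 := (Real.one_le_rpow h hη0.le).trans hw2
        have h7 : ‖z₁ j - z₂ j‖ ≤ 2 := by rw [← e2, ← e3]; exact norm_phaseExp_sub_le_two _ _
        have := mul_nonneg hK₂.le (add_nonneg hw0 hn)
        linarith
    have hn := norm_nonneg (J₁ j - J₂ j)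
    have q1 : 0 ≤ (2 * (M / κmin) * b + K₁ * b + K₁ * b ^ 2) * (w + ‖J₁ j - J₂ j‖) := by positivity
    rw [hyj, hK]
    linarith

/-! ### Measurability of the phases and prediction of the amplitudes -/

section Stochastic

variable {Ω : Type*} {mΩ : MeasurableSpace Ω}

/-- A function that factors through a measurable one in a Lipschitz way is measurable. -/
theorem stronglyMeasurable_of_lipschitz {m : MeasurableSpace Ω} {E : Type*} [MetricSpace E]
    {u : Ω → E} {v : Ω → ℂ} (hu : StronglyMeasurable[m] u) {K : ℝ} (hK : 0 ≤ K)
    (h : ∀ x x', dist (v x) (v x') ≤ K * dist (u x) (u x')) : StronglyMeasurable[m] v := by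
  have hfac : v.FactorsThrough u := fun x x' hxx => by
    have := h x x'
    rw [hxx, dist_self, mul_zero] at this
    exact dist_le_zero.mp this
  -- The factor map is Lipschitz on the range of `u`, hence extends to a continuous map on all of
  -- `E`; no measurability of the range is needed.
  have hlip : LipschitzOnWith K.toNNReal (Function.extend u v 0) (range u) := by
    refine LipschitzOnWith.of_dist_le_mul ?_
    rintro _ ⟨x, rfl⟩ _ ⟨x', rfl⟩
    rw [hfac.extend_apply, hfac.extend_apply, Real.coe_toNNReal _ hK]
    exact h x x'
  obtain ⟨g, hg, hgeq⟩ := hlip.extend_finite_dimension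
  have : v = fun x => g (u x) := funext fun x => by
    rw [← hgeq (mem_range_self x), hfac.extend_apply]
  rw [this]
  exact hg.continuous.comp_stronglyMeasurable hu

/-- The filtration delayed by one step (and started at time `1`). -/
def delayedFiltration (ℱ : Filtration ℕ mΩ) : Filtration ℕ mΩ where
  seq k := ℱ (max (k - 1) 1)
  mono' _ _ h := ℱ.mono (max_le_max (Nat.sub_le_sub_right h 1) le_rfl)
  le' _ := ℱ.le _

theorem alloyAmplitude_eq_mul (α : ℝ) (a : ℕ → ℝ) (j : ℕ) :
    alloyAmplitude α a j = alloyAmplitude α (fun _ => 1) j * a j := by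
  cases j with
  | zero => simp [alloyAmplitude]
  | succ j => simp only [alloyAmplitude]; ring

namespace ExpDecayingCorrelations

variable {P : Measure Ω} {ρ : ℝ} {ℱ : Filtration ℕ mΩ} {ω : ℕ → Ω → ℝ}

theorem stronglyMeasurable_alloyAmplitude (hω : ExpDecayingCorrelations P ρ ℱ ω) (α : ℝ) (j : ℕ) :
    StronglyMeasurable[delayedFiltration ℱ (j + 1)]
      (fun x => alloyAmplitude α (fun i => ω i x) j) := by
  cases j with
  | zero => exact stronglyMeasurable_const
  | succ j =>
    have h : StronglyMeasurable[ℱ (j + 1)]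
        (fun x => alloyAmplitude α (fun i => ω i x) (j + 1)) :=
      (hω.adapted (j + 1) (by omega)).mul_const (((j : ℝ) + 1) ^ α)⁻¹
    exact h.mono (ℱ.mono (le_max_left _ _))

/-- With truncated subtraction one bound also covers `l ≤ k`: the amplitude is then already known
and the exponent is 0. -/
theorem ae_abs_condExp_le [IsProbabilityMeasure P] (hω : ExpDecayingCorrelations P ρ ℱ ω) {k l : ℕ}
    (hk : 1 ≤ k) (hl : 1 ≤ l) :
    ∀ᵐ x ∂P, |(P[ω l | ℱ k]) x| ≤ Real.exp (-ρ) ^ (l - k) := by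
  rcases Nat.lt_or_ge k l with h | h
  · filter_upwards [hω.decay k l hk h] with x hx
    rw [← Real.exp_nat_mul, Nat.cast_sub h.le]
    convert! hx using 2
    ring
  · have hm := (hω.adapted l hl).mono (ℱ.mono h)
    have hi : Integrable (ω l) P :=
      integrable_of_bdd (hm.mono (ℱ.le k)) ⟨1, fun x => hω.bounded l hl x⟩
    rw [condExp_of_stronglyMeasurable (ℱ.le k) hm hi, Nat.sub_eq_zero_of_le h, pow_zero]
    exact Filter.Eventually.of_forall fun x => hω.bounded l hl x

/-- Predictions of the amplitudes of an alloy potential with an exponentially decaying bound. -/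
theorem exists_predictions [IsProbabilityMeasure P] (hω : ExpDecayingCorrelations P ρ ℱ ω)
    (hρ : 0 < ρ) {α : ℝ} (hα : 0 ≤ α) : ∃ K : ℝ, 0 < K ∧ ∃ c : ℕ → ℕ → Ω → ℝ,
      (∀ k l, StronglyMeasurable[delayedFiltration ℱ k] (c k l)) ∧
      (∀ k l x, k ≤ l + 1 →
        |c k l x| ≤ K * ((l : ℝ) + 1) ^ (-α) * Real.exp (-ρ) ^ (l + 1 - k)) ∧
      (∀ l x, c (l + 1) l x = alloyAmplitude α (fun i => ω i x) l) ∧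
      (∀ k l, k ≤ l → ∀ g : Ω → ℂ, StronglyMeasurable[delayedFiltration ℱ k] g →
        (∃ B : ℝ, ∀ x, ‖g x‖ ≤ B) →
          ∫ x, g x * (c (k + 1) l x : ℂ) ∂P = ∫ x, g x * (c k l x : ℂ) ∂P) := by
  set q := Real.exp (-ρ) with hq
  have hq0 : 0 < q := Real.exp_pos _
  have hq1 : q ≤ 1 := Real.exp_le_one_iff.mpr (by linarith)
  -- The delayed filtration starts at time 1, so at stages 0 and 1 up to two powers of `q` are lost;
  -- `(q ^ 2)⁻¹` restores them.
  set K : ℝ := 2 ^ α * (q ^ 2)⁻¹ with hK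
  have hK0 : 0 < K := by positivity
  have hbd : ∀ x j, 1 ≤ j → |ω j x| ≤ 1 := fun x j hj => hω.bounded j hj x
  have hb : ∀ l : ℕ, |alloyAmplitude α (fun _ => 1) l| ≤ 2 ^ α * ((l : ℝ) + 1) ^ (-α) :=
    fun l => abs_alloyAmplitude_le hα (fun _ _ => by simp) l
  let X : ℕ → Ω → ℝ := fun l x => alloyAmplitude α (fun i => ω i x) l
  have hXm : ∀ l, StronglyMeasurable[delayedFiltration ℱ (l + 1)] (X l) :=
    hω.stronglyMeasurable_alloyAmplitude α
  have hXi : ∀ l, Integrable (X l) P := fun l =>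
    integrable_of_bdd ((hXm l).mono ((delayedFiltration ℱ).le _))
      ⟨1, fun x => abs_alloyAmplitude_le_one hα (hbd x) l⟩
  have hq2 : ∀ k l, k ≤ l + 1 → ∀ i, l + 1 - k ≤ i + 2 → q ^ i ≤ (q ^ 2)⁻¹ * q ^ (l + 1 - k) :=
    fun k l _ i hi => by
      have h1 : q ^ (i + 2) ≤ q ^ (l + 1 - k) := pow_le_pow_of_le_one hq0.le hq1 hi
      rw [pow_add] at h1
      rw [inv_mul_eq_div, le_div_iff₀ (by positivity)]
      exact h1
  have hcond : ∀ k l, k ≤ l + 1 → ∀ᵐ x ∂P, |(P[X l | delayedFiltration ℱ k]) x| ≤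
      K * ((l : ℝ) + 1) ^ (-α) * q ^ (l + 1 - k) := fun k l hk => by
    rcases Nat.eq_zero_or_pos l with rfl | hl
    · have hz : X 0 = 0 := rfl
      rw [hz, condExp_zero]
      refine Filter.Eventually.of_forall fun x => ?_
      simp only [Pi.zero_apply, abs_zero]
      positivity
    · have hX : X l = alloyAmplitude α (fun _ => 1) l • ω l :=
        funext fun x => alloyAmplitude_eq_mul α _ l
      have h1 := hω.ae_abs_condExp_le (k := max (k - 1) 1) (le_max_right _ _) hl
      have h2 := condExp_smul (μ := P) (alloyAmplitude α (fun _ => 1) l) (ω l)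
        (delayedFiltration ℱ k)
      rw [hX]
      filter_upwards [h1, h2] with x hx1 hx2
      rw [hx2, Pi.smul_apply, smul_eq_mul, abs_mul]
      have h3 := hq2 k l hk (l - max (k - 1) 1) (by omega)
      calc _ ≤ (2 ^ α * ((l : ℝ) + 1) ^ (-α)) * ((q ^ 2)⁻¹ * q ^ (l + 1 - k)) :=
            mul_le_mul (hb l) (hx1.trans h3) (abs_nonneg _) (by positivity)
        _ = _ := by rw [hK]; ring
  -- For `k ≥ l + 1` the amplitude itself is taken, so that the prediction at stage `l + 1` equals
  -- it at every point and not just almost surely.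
  have hex : ∀ k l, ∃ c : Ω → ℝ, StronglyMeasurable[delayedFiltration ℱ k] c ∧
      (k ≤ l + 1 → ∀ x, |c x| ≤ K * ((l : ℝ) + 1) ^ (-α) * q ^ (l + 1 - k)) ∧
      (k = l + 1 → c = X l) ∧
      (k ≤ l + 1 → ∀ g : Ω → ℂ, StronglyMeasurable[delayedFiltration ℱ k] g →
        (∃ B : ℝ, ∀ x, ‖g x‖ ≤ B) →
          ∫ x, g x * (c x : ℂ) ∂P = ∫ x, g x * (X l x : ℂ) ∂P) := fun k l => by
    rcases Nat.lt_or_ge k (l + 1) with h | h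
    · obtain ⟨c, hc1, hc2, hc3⟩ := exists_bounded_condExp ((delayedFiltration ℱ).le k) (hXi l)
        (by positivity) (hcond k l h.le)
      exact ⟨c, hc1, fun _ => hc2, fun he => absurd he h.ne, fun _ => hc3⟩
    · refine ⟨X l, (hXm l).mono ((delayedFiltration ℱ).mono h), fun hk x => ?_, fun _ => rfl,
        fun _ _ _ _ => rfl⟩
      have h3 := hq2 k l hk 0 (by omega)
      rw [pow_zero] at h3
      calc |X l x| ≤ 2 ^ α * ((l : ℝ) + 1) ^ (-α) * 1 := by
            rw [mul_one]; exact abs_alloyAmplitude_le hα (hbd x) l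
        _ ≤ 2 ^ α * ((l : ℝ) + 1) ^ (-α) * ((q ^ 2)⁻¹ * q ^ (l + 1 - k)) := by gcongr
        _ = _ := by rw [hK]; ring
  choose c hc1 hc2 hc3 hc4 using hex
  refine ⟨K, hK0, c, hc1, fun k l x hk => hc2 k l hk x, fun l x => by rw [hc3 (l + 1) l rfl],
    fun k l hk g hg hgb => ?_⟩
  rw [hc4 (k + 1) l (by omega) g (hg.mono ((delayedFiltration ℱ).mono k.le_succ)) hgb,
    hc4 k l (by omega) g hg hgb]

/-- `pruferPhase` is chosen separately for each realization, so its measurability is not automatic.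
But `e^{2iθ}` at `j + 1` is a Lipschitz function of the amplitude on the cell and of `e^{2iθ}` at
`j`; induction on cells gives the claim. The delay fits, since the phase at `j` sees only amplitudes
of index below `j`. -/
theorem stronglyMeasurable_phaseExp (hω : ExpDecayingCorrelations P ρ ℱ ω) {f : ℝ → ℝ} {α M κ : ℝ}
    (hfm : AEStronglyMeasurable f volume) (hM : ∀ᵐ t, |f t| ≤ M)
    (hf : Function.support f ⊆ Icc 0 1) (hα : 0 ≤ α) (hκ : 0 < κ) (j : ℕ) :
    StronglyMeasurable[delayedFiltration ℱ j] (fun x =>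
      phaseExp (pruferPhase (alloyPotential α f fun i => ω i x) κ j)) := by
  have hbd : ∀ x j, 1 ≤ j → |ω j x| ≤ 1 := fun x j hj => hω.bounded j hj x
  induction j with
  | zero =>
    have : ∀ x, pruferPhase (alloyPotential α f fun i => ω i x) κ ((0 : ℕ) : ℝ) = 0 := fun x => by
      rw [Nat.cast_zero]
      exact (isPruferPhase_alloyPotential hfm hM hf hα (hbd x) hκ).zero
    simp_rw [this]
    exact stronglyMeasurable_const
  | succ j ih =>
    obtain ⟨K, hK, hlip⟩ := IsUnitPhase.exists_lipschitz hfm hM hκ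
    refine stronglyMeasurable_of_lipschitz (K := 2 * K)
      ((hω.stronglyMeasurable_alloyAmplitude α j).prodMk
        (ih.mono ((delayedFiltration ℱ).mono j.le_succ))) (by positivity) fun x x' => ?_
    have h1 := hlip _ _ _ _ (abs_alloyAmplitude_le_one hα (hbd x) j)
      (abs_alloyAmplitude_le_one hα (hbd x') j)
      (isUnitPhase_pruferPhase hfm hM hf hα (hbd x) hκ j)
      (isUnitPhase_pruferPhase hfm hM hf hα (hbd x') hκ j)
    simp only [add_zero] at h1
    rw [dist_eq_norm, Nat.cast_add, Nat.cast_one]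
    refine h1.trans ?_
    rw [mul_comm 2 K, mul_assoc]
    refine mul_le_mul_of_nonneg_left ?_ hK.le
    rw [Prod.dist_eq, Real.dist_eq, dist_eq_norm, two_mul]
    exact add_le_add (le_max_left _ _) (le_max_right _ _)

end ExpDecayingCorrelations

end Stochastic

/-! ### The maximal estimate -/

theorem summable_natCast_add_one_rpow {p : ℝ} (hp : p < -1) :
    Summable fun j : ℕ => ((j : ℝ) + 1) ^ p := by
  have h := (summable_nat_add_iff 1).mpr (Real.summable_nat_rpow.mpr hp)
  simpa using h

theorem proposition4 {Ω : Type*} [mΩ : MeasurableSpace Ω] (P : Measure Ω) [IsProbabilityMeasure P]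
    (ℱ : Filtration ℕ mΩ) (ω : ℕ → Ω → ℝ) (ρ : ℝ) (hρ : 0 < ρ)
    (hω : ExpDecayingCorrelations P ρ ℱ ω)
    (α : ℝ) (hα : 1 / 2 < α)
    (f : ℝ → ℝ) (hf : MemLp f ⊤ volume) (hf_supp : Function.support f ⊆ Set.Icc 0 1)
    (η : ℝ) (hη_pos : 0 < η) (hη_lt : η < α - 1 / 2) (hη_le : η ≤ 1)
    (κmin : ℝ) (hκmin : 0 < κmin) :
    ∃ C : ℝ, 0 < C ∧ ∀ κ₁ κ₂ : ℝ, κmin ≤ κ₁ → κmin ≤ κ₂ → ∀ m N : ℝ, 0 ≤ m → m ≤ N →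
      ∫⁻ x, ⨆ t ∈ Set.Icc m N,
          ENNReal.ofReal
            (‖oscillatoryJ (alloyPotential α f fun j => ω j x) κ₁ m t -
              oscillatoryJ (alloyPotential α f fun j => ω j x) κ₂ m t‖ ^ 2) ∂P
        ≤ ENNReal.ofReal (C * |κ₁ - κ₂| ^ (2 * η)) := by
  have hα0 : 0 ≤ α := by linarith
  have hfm := hf.1
  obtain ⟨M, hM⟩ := hf.exists_ae_abs_le
  have hM0 : 0 ≤ M := by
    obtain ⟨t, ht⟩ := hM.exists
    exact (abs_nonneg _).trans ht
  obtain ⟨Ka, hKa, hpath⟩ := exists_alloy_bounds hfm hM hf_supp hα0 hκmin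
  obtain ⟨Kc, hKc, c, hcm, hcb, hcx, hco⟩ := hω.exists_predictions hρ hα0
  have hsβ : Summable fun j : ℕ => ((j : ℝ) + 1) ^ (-(2 * α)) :=
    summable_natCast_add_one_rpow (by linarith)
  -- This is where `η < α - 1/2` enters.
  have hsw : Summable fun j : ℕ => ((j : ℝ) + 1) ^ (-(2 * α) + 2 * η) :=
    summable_natCast_add_one_rpow (by linarith)
  set S : ℝ := ∑' j : ℕ, ((j : ℝ) + 1) ^ (-(2 * α)) with hS
  set W₀ : ℝ := ∑' j : ℕ, ((j : ℝ) + 1) ^ (-(2 * α) + 2 * η) with hW₀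
  have hS0 : 0 ≤ S := tsum_nonneg fun j => by positivity
  -- The first term of the series is 1; this yields `w 0 ^ 2 ≤ W`.
  have hW1 : 1 ≤ W₀ := by
    have := hsw.sum_le_tsum (Finset.range 1) fun j _ => by positivity
    simpa using this
  set q := Real.exp (-ρ) with hq
  have hq1 : q < 1 := Real.exp_lt_one_iff.mpr (by linarith)
  set K := Ka + Kc + 2 * M + 1 with hK
  have hK0 : 0 < K := by positivity
  have hKa' : Ka ≤ K := by rw [hK]; linarith
  have hKc' : Kc ≤ K := by rw [hK]; linarith
  obtain ⟨C, hC, hdisc⟩ := exists_discrete_bound (mΩ := mΩ) P hK0 hS0 (Real.exp_pos (-ρ)).le hq1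
  -- `2 * (1 + Ka ^ 2)` passes from integer to real times, and a further factor 4 arises from
  -- writing the integral from `m` to `t` as a difference of two integrals from 0.
  refine ⟨8 * (1 + Ka ^ 2) * (C * W₀), by positivity, ?_⟩
  intro κ₁ κ₂ h₁ h₂ m N hm hmN
  have h10 : 0 < κ₁ := hκmin.trans_le h₁
  have h20 : 0 < κ₂ := hκmin.trans_le h₂
  set δ := |κ₁ - κ₂| with hδ
  have hδ0 : 0 ≤ δ := abs_nonneg _
  have hbd : ∀ x j, 1 ≤ j → |ω j x| ≤ 1 := fun x j hj => hω.bounded j hj x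
  let V : Ω → ℝ → ℝ := fun x => alloyPotential α f fun j => ω j x
  let z₁ : ℝ → Ω → ℂ := fun t x => phaseExp (pruferPhase (V x) κ₁ t)
  let z₂ : ℝ → Ω → ℂ := fun t x => phaseExp (pruferPhase (V x) κ₂ t)
  let J₁ : ℝ → Ω → ℂ := fun t x => oscillatoryJ (V x) κ₁ 0 t
  let J₂ : ℝ → Ω → ℂ := fun t x => oscillatoryJ (V x) κ₂ 0 t
  let y : ℕ → Ω → ℝ := fun j x => min 1 δ + ‖z₁ j x - z₂ j x‖
  let β : ℕ → ℝ := fun j => ((j : ℝ) + 1) ^ (-α)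
  let w : ℕ → ℝ := fun j => δ ^ η * ((j : ℝ) + 1) ^ η
  have hy0 : ∀ j x, 0 ≤ y j x := fun j x => by positivity
  have hβ0 : ∀ j, 0 ≤ β j := fun j => by positivity
  have hp := fun (x : Ω) => hpath (fun j => ω j x) κ₁ κ₂ η (V x) (fun t => z₁ t x)
    (fun t => z₂ t x) (fun t => J₁ t x) (fun t => J₂ t x) (fun j => y j x) β (hbd x) h₁ h₂ hη_pos
    hη_le rfl rfl rfl rfl rfl rfl rfl
  have hβsq : ∀ j, β j ^ 2 = ((j : ℝ) + 1) ^ (-(2 * α)) := fun j => by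
    rw [← Real.rpow_natCast, ← Real.rpow_mul (by positivity)]
    congr 1; push_cast; ring
  have hδsq : (δ ^ η) ^ 2 = δ ^ (2 * η) := by
    rw [← Real.rpow_natCast, ← Real.rpow_mul hδ0]
    congr 1; push_cast; ring
  have hw0 : w 0 = δ ^ η := by simp [w]
  have hβw : ∀ j, β j ^ 2 * w j ^ 2 = δ ^ (2 * η) * ((j : ℝ) + 1) ^ (-(2 * α) + 2 * η) := fun j => by
    have hj : (0 : ℝ) < (j : ℝ) + 1 := by positivity
    have e : (((j : ℝ) + 1) ^ η) ^ 2 = ((j : ℝ) + 1) ^ (2 * η) := by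
      rw [← Real.rpow_natCast, ← Real.rpow_mul hj.le]
      congr 1; push_cast; ring
    simp only [w]
    rw [hβsq, mul_pow, hδsq, e, Real.rpow_add hj]
    ring
  -- The horizon is `⌊N⌋₊ + 1` because the bound on `β n * y n` requires `n` strictly below it, and
  -- it is needed at `n = ⌊N⌋₊`.
  obtain ⟨H, hHi, hH0, hHJ, hHy, hHint⟩ := hdisc (delayedFiltration ℱ) β w (δ ^ (2 * η) * W₀)
    (⌊N⌋₊ + 1) c κ₁ κ₂ (min 1 δ) (profileTransform f κ₁) (profileTransform f κ₂)
    (fun j => z₁ j) (fun j => z₂ j) (fun j => J₁ j) (fun j => J₂ j) y hβ0 (by simp [β])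
    (fun i j hij => Real.rpow_le_rpow_of_nonpos (by positivity)
      (by have : (i : ℝ) ≤ j := by exact_mod_cast hij
          linarith) (by linarith))
    (fun n => by
      simp_rw [hβsq]
      exact hsβ.sum_le_tsum _ fun j _ => by positivity)
    (fun n => by
      simp_rw [hβw, ← Finset.mul_sum]
      gcongr
      exact hsw.sum_le_tsum _ fun j _ => by positivity)
    (by
      rw [hw0, hδsq]
      exact le_mul_of_one_le_right (by positivity) hW1)
    rfl (fun j x => rfl) hcm
    (fun k l x hk => (hcb k l x hk).trans (by gcongr))
    hco ((norm_profileTransform_le hM κ₂).trans (by rw [hK]; linarith))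
    ((norm_profileTransform_sub_le hfm hM κ₁ κ₂).trans (by
      have : 0 ≤ min 1 δ := by positivity
      rw [← hδ, mul_right_comm, hK]
      gcongr
      linarith))
    (fun j => hω.stronglyMeasurable_phaseExp hfm hM hf_supp hα0 h10 j)
    (fun j => hω.stronglyMeasurable_phaseExp hfm hM hf_supp hα0 h20 j)
    (fun j x => norm_phaseExp _) (fun j x => norm_phaseExp _)
    (fun x => by
      simp only [z₁, z₂, Nat.cast_zero]
      rw [(isPruferPhase_alloyPotential hfm hM hf_supp hα0 (hbd x) h10).zero,
        (isPruferPhase_alloyPotential hfm hM hf_supp hα0 (hbd x) h20).zero])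
    (fun j x => (hp x j).1.trans (by have := hβ0 j; gcongr))
    (fun j x => (hp x j).2.1.trans (by have := hβ0 j; have := hy0 j x; gcongr))
    (fun x => by simp [J₁, J₂, oscillatoryJ])
    (fun j x => by
      rw [hcx]
      exact (hp x j).2.2.1.trans (by have := hβ0 j; have := hy0 j x; gcongr))
    (fun j x => (hp x j).2.2.2.2.trans (by gcongr))
    (by
      rw [hw0]
      have h3 := min_one_le_rpow hδ0 hη_pos hη_le
      have h4 : 0 ≤ δ ^ η := by positivity
      nlinarith)
  have hreal : ∀ x t, 0 ≤ t → t ≤ N → ‖J₁ t x - J₂ t x‖ ^ 2 ≤ 2 * (1 + Ka ^ 2) * H x :=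
    fun x t ht htN => by
    have hfl : ⌊t⌋₊ ≤ ⌊N⌋₊ := Nat.floor_le_floor htN
    have hs : t - ⌊t⌋₊ ∈ Icc (0 : ℝ) 1 :=
      ⟨by linarith [Nat.floor_le ht], by linarith [Nat.lt_floor_add_one t]⟩
    have h3 := (hp x ⌊t⌋₊).2.2.2.1 _ hs
    rw [add_sub_cancel] at h3
    have h4 := hHJ ⌊t⌋₊ x (by omega)
    have h5 := hHy ⌊t⌋₊ x (by omega)
    have h6 := pow_le_pow_left₀ (norm_nonneg _) h3 2
    refine h6.trans ?_
    rw [← mul_pow] at h5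
    have h7 := mul_le_mul_of_nonneg_left h5 (sq_nonneg Ka)
    nlinarith [sq_nonneg (‖J₁ ⌊t⌋₊ x - J₂ ⌊t⌋₊ x‖ - Ka * (β ⌊t⌋₊ * y ⌊t⌋₊ x))]
  -- The supremum runs over uncountably many `t`; bounding it at each point by the integrable `H`
  -- avoids any question of its measurability.
  have hsup : ∀ x, ⨆ t ∈ Set.Icc m N, ENNReal.ofReal
      (‖oscillatoryJ (alloyPotential α f fun j => ω j x) κ₁ m t -
        oscillatoryJ (alloyPotential α f fun j => ω j x) κ₂ m t‖ ^ 2) ≤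
      ENNReal.ofReal (8 * (1 + Ka ^ 2) * H x) := fun x => by
    refine iSup₂_le fun t ht => ENNReal.ofReal_le_ofReal ?_
    have ht0 : 0 ≤ t := hm.trans ht.1
    rw [oscillatoryJ_sub hfm hM hf_supp hα0 (hbd x) h10 hm ht0,
      oscillatoryJ_sub hfm hM hf_supp hα0 (hbd x) h20 hm ht0, sub_sub_sub_comm]
    have h3 := hreal x t ht0 ht.2
    have h4 := hreal x m hm hmN
    have h5 := pow_le_pow_left₀ (norm_nonneg _) (norm_sub_le (J₁ t x - J₂ t x) (J₁ m x - J₂ m x)) 2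
    refine h5.trans ?_
    nlinarith [sq_nonneg (‖J₁ t x - J₂ t x‖ - ‖J₁ m x - J₂ m x‖)]
  refine (lintegral_mono hsup).trans ?_
  rw [← ofReal_integral_eq_lintegral_ofReal (hHi.const_mul _)
    (Filter.Eventually.of_forall fun x => mul_nonneg (by positivity) (hH0 x)), integral_const_mul]
  refine ENNReal.ofReal_le_ofReal ?_
  calc _ ≤ 8 * (1 + Ka ^ 2) * (C * (δ ^ (2 * η) * W₀)) := by gcongr
    _ = _ := by ring
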